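/- An algebra over $\mathbb C$ is a complex vector space with a bilinear product, not assumed associative. For elements of an algebra put $J(a,b,c)=(ab)c+(bc)a+(ca)b$. An anticommutative algebra is called a Tortkara algebra if $(ab)(cb)=J(a,b,c)b$ for all $a,b,c$, and a Malcev algebra if $J(x,y,xz)=J(x,y,z)x$ for all $x,y,z$. An algebra is nilpotent if for some $n\ge 1$ all products of $n$ elements, with any arrangement of brackets, vanish. Consider the following anticommutative algebras with basis $e_1,\dots,e_6$ over $\mathbb C$, where $\alpha\in\mathbb C$ and where the products $e_ie_j$ with $i<j$ that are not listed are zero: - $\mathbb T^6_{00}$: $e_1e_2=e_3,\ e_1e_3=e_4,\ e_2e_4=e_5$; - $\mathbb T^6_{01}$: $e_1e_2=e_3,\ e_1e_3=e_4,\ e_1e_4=e_5,\ e_2e_3=e_5,\ e_2e_4=e_6$; - $\mathbb T^6_{02}$: $e_1e_2=e_3,\ e_1e_3=e_4,\ e_2e_3=e_5,\ e_2e_4=e_6$; - $\mathbb T^6_{03}$: $e_1e_2=e_3,\ e_1e_3=e_4,\ e_1e_4=e_5,\ e_2e_4=e_6$; - $\mathbb T^6_{04}$: $e_1e_2=e_3,\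 e_1e_3=e_4,\ e_1e_5=e_6,\ e_2e_4=e_6$; - $\mathbb T^6_{05}$: $e_1e_2=e_3,\ e_1e_3=e_4,\ e_2e_3=e_6,\ e_4e_5=e_6$; - $\mathbb T^6_{06}$: $e_1e_2=e_3,\ e_1e_3=e_4,\ e_2e_4=e_6,\ e_3e_5=e_6$; - $\mathbb T^6_{07}$: $e_1e_2=e_3,\ e_1e_3=e_4,\ e_4e_5=e_6$; - $\mathbb T^6_{08}$: $e_1e_2=e_3,\ e_1e_3=e_4,\ e_1e_4=e_6,\ e_1e_5=-e_6,\ e_2e_3=e_5,\ e_2e_4=e_6$; - $\mathbb T^6_{09}(\alpha)$: $e_1e_2=e_3,\ e_1e_3=e_4,\ e_1e_5=(\alpha+1)e_6,\ e_2e_3=e_5,\ e_2e_4=\alpha e_6$; - $\mathbb T^6_{10}$: $e_1e_2=e_3,\ e_1e_3=e_6,\ e_1e_4=e_5,\ e_2e_3=e_5,\ e_4e_5=e_6$; - $\mathbb T^6_{11}$: $e_1e_2=e_3,\ e_1e_4=e_5,\ e_1e_5=e_6,\ e_2e_3=e_5$; - $\mathbb T^6_{12}$: $e_1e_2=e_3,\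 e_1e_4=e_5,\ e_1e_5=e_6,\ e_2e_3=e_5,\ e_2e_4=e_6$; - $\mathbb T^6_{13}$: $e_1e_2=e_3,\ e_1e_4=e_5,\ e_1e_5=e_6,\ e_2e_3=e_5,\ e_3e_4=e_6$; - $\mathbb T^6_{14}$: $e_1e_2=e_3,\ e_1e_4=e_5,\ e_2e_3=e_5,\ e_4e_5=e_6$; - $\mathbb T^6_{15}$: $e_1e_2=e_3,\ e_1e_3=e_4,\ e_1e_4=e_5,\ e_1e_5=e_6,\ e_2e_4=e_6$; - $\mathbb T^6_{16}$: $e_1e_2=e_3,\ e_1e_3=e_4,\ e_1e_4=e_5,\ e_2e_5=e_6$; - $\mathbb T^6_{17}$: $e_1e_2=e_3,\ e_1e_3=e_4,\ e_1e_4=e_5,\ e_2e_3=e_5,\ e_2e_5=e_6$; - $\mathbb T^6_{18}(\alpha)$: $e_1e_2=e_3,\ e_1e_3=e_4,\ e_1e_4=e_5,\ e_1e_5=(\alpha+1)e_6,\ e_2e_3=e_5,\ e_2e_4=\alpha e_6$; - $\mathbb T^6_{19}$: $e_1e_2=e_3,\ e_1e_3=e_4,\ e_1e_5=e_6,\ e_2e_4=e_5,\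 e_3e_4=e_6$. **Theorem.** All these algebras are nilpotent Tortkara algebras and none of them is a Malcev algebra. Conversely, every $6$-dimensional nilpotent Tortkara algebra over $\mathbb C$ that is not a Malcev algebra is isomorphic to one of $\mathbb T^6_{00},\dots,\mathbb T^6_{19}$, where the parameter can be taken with $\alpha\notin\{0,-1\}$ in $\mathbb T^6_{09}(\alpha)$ and with $\alpha\ne-1$ in $\mathbb T^6_{18}(\alpha)$. With these restrictions on the parameters, the listed algebras are pairwise non-isomorphic, except that $\mathbb T^6_{09}(\alpha)\cong\mathbb T^6_{09}(-\alpha-1)$. At the excluded values one has $\mathbb T^6_{09}(0)\cong\mathbb T^6_{09}(-1)\cong\mathbb T^6_{02}$ and $\mathbb T^6_{18}(-1)\cong\mathbb T^6_{01}$. -/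

import Mathlib

namespace Tortkara

/-- A (not necessarily associative) algebra over `ℂ` is a complex vector space `V` together with a
bilinear product `V →ₗ[ℂ] V →ₗ[ℂ] V`. -/
abbrev Product (V : Type*) [AddCommGroup V] [Module ℂ V] : Type _ := V →ₗ[ℂ] V →ₗ[ℂ] V

section Algebras

variable {V : Type*} [AddCommGroup V] [Module ℂ V]
variable {W : Type*} [AddCommGroup W] [Module ℂ W]

def IsAnticommutative (μ : Product V) : Prop :=
  ∀ x y, μ x y = -μ y x

/-- `J(a, b, c) = (ab)c + (bc)a + (ca)b`. -/
def jacobian (μ : Product V) (a b c : V) : V :=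
  μ (μ a b) c + μ (μ b c) a + μ (μ c a) b

/-- Tortkara algebras: anticommutative, with `(ab)(cb) = J(a, b, c) b`. -/
def IsTortkara (μ : Product V) : Prop :=
  IsAnticommutative μ ∧ ∀ a b c, μ (μ a b) (μ c b) = μ (jacobian μ a b c) b

/-- Malcev algebras: anticommutative, with `J(x, y, xz) = J(x, y, z) x`. -/
def IsMalcev (μ : Product V) : Prop :=
  IsAnticommutative μ ∧ ∀ x y z, jacobian μ x y (μ x z) = μ (jacobian μ x y z) x

/-- `IsProductOf μ n v`: the vector `v` is a product of `n` elements of the algebra, with some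
arrangement of brackets. -/
inductive IsProductOf (μ : Product V) : ℕ → V → Prop
  | single (x : V) : IsProductOf μ 1 x
  | mul {m n : ℕ} {x y : V} :
      IsProductOf μ m x → IsProductOf μ n y → IsProductOf μ (m + n) (μ x y)

/-- An algebra is nilpotent if, for some `n ≥ 1`, all products of `n` elements vanish, whatever the
arrangement of brackets. -/
def IsNilpotent (μ : Product V) : Prop :=
  ∃ n : ℕ, 1 ≤ n ∧ ∀ v, IsProductOf μ n v → v = 0

/-- Isomorphism of algebras: a linear bijection that respects the products. -/
def Isomorphic (μ : Product V) (ν : Product W) : Prop :=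
  ∃ φ : V ≃ₗ[ℂ] W, ∀ x y, φ (μ x y) = ν (φ x) (φ y)

end Algebras

/-- The standard basis of `ℂ⁶`, indexed from `0`: the vector usually called `e₁` is `e 0`, …, the
vector usually called `e₆` is `e 5`. -/
def e (i : Fin 6) : Fin 6 → ℂ := Pi.single i 1

/-- The anticommutative product on `ℂ⁶` whose only nonzero products of basis vectors are
`(e i)(e j) = v` and `(e j)(e i) = -v` (for `i ≠ j`). -/
def elementary (i j : Fin 6) (v : Fin 6 → ℂ) : Product (Fin 6 → ℂ) :=
  LinearMap.mk₂ ℂ (fun x y => (x i * y j - x j * y i) • v)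
    (fun x x' y => by rw [← add_smul]; congr 1; simp only [Pi.add_apply]; ring)
    (fun c x y => by rw [smul_smul]; congr 1; simp only [Pi.smul_apply, smul_eq_mul]; ring)
    (fun x y y' => by rw [← add_smul]; congr 1; simp only [Pi.add_apply]; ring)
    (fun c x y => by rw [smul_smul]; congr 1; simp only [Pi.smul_apply, smul_eq_mul]; ring)

/-- The names of the algebras of the classification; two of them carry a parameter. -/
inductive Name : Type
  | T00 | T01 | T02 | T03 | T04 | T05 | T06 | T07 | T08
  | T09 (α : ℂ)
  | T10 | T11 | T12 | T13 | T14 | T15 | T16 | T17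
  | T18 (α : ℂ)
  | T19

/-- The multiplication tables. An entry `(i, j, v)` means `(e i)(e j) = v`. -/
def Name.table : Name → List (Fin 6 × Fin 6 × (Fin 6 → ℂ))
  -- e₁e₂ = e₃, e₁e₃ = e₄, e₂e₄ = e₅
  | .T00 => [(0, 1, e 2), (0, 2, e 3), (1, 3, e 4)]
  -- e₁e₂ = e₃, e₁e₃ = e₄, e₁e₄ = e₅, e₂e₃ = e₅, e₂e₄ = e₆
  | .T01 => [(0, 1, e 2), (0, 2, e 3), (0, 3, e 4), (1, 2, e 4), (1, 3, e 5)]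
  -- e₁e₂ = e₃, e₁e₃ = e₄, e₂e₃ = e₅, e₂e₄ = e₆
  | .T02 => [(0, 1, e 2), (0, 2, e 3), (1, 2, e 4), (1, 3, e 5)]
  -- e₁e₂ = e₃, e₁e₃ = e₄, e₁e₄ = e₅, e₂e₄ = e₆
  | .T03 => [(0, 1, e 2), (0, 2, e 3), (0, 3, e 4), (1, 3, e 5)]
  -- e₁e₂ = e₃, e₁e₃ = e₄, e₁e₅ = e₆, e₂e₄ = e₆
  | .T04 => [(0, 1, e 2), (0, 2, e 3), (0, 4, e 5), (1, 3, e 5)]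
  -- e₁e₂ = e₃, e₁e₃ = e₄, e₂e₃ = e₆, e₄e₅ = e₆
  | .T05 => [(0, 1, e 2), (0, 2, e 3), (1, 2, e 5), (3, 4, e 5)]
  -- e₁e₂ = e₃, e₁e₃ = e₄, e₂e₄ = e₆, e₃e₅ = e₆
  | .T06 => [(0, 1, e 2), (0, 2, e 3), (1, 3, e 5), (2, 4, e 5)]
  -- e₁e₂ = e₃, e₁e₃ = e₄, e₄e₅ = e₆
  | .T07 => [(0, 1, e 2), (0, 2, e 3), (3, 4, e 5)]
  -- e₁e₂ = e₃, e₁e₃ = e₄, e₁e₄ = e₆, e₁e₅ = -e₆, e₂e₃ = e₅, e₂e₄ = e₆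
  | .T08 => [(0, 1, e 2), (0, 2, e 3), (0, 3, e 5), (0, 4, -e 5), (1, 2, e 4), (1, 3, e 5)]
  -- e₁e₂ = e₃, e₁e₃ = e₄, e₁e₅ = (α + 1)e₆, e₂e₃ = e₅, e₂e₄ = αe₆
  | .T09 α => [(0, 1, e 2), (0, 2, e 3), (0, 4, (α + 1) • e 5), (1, 2, e 4), (1, 3, α • e 5)]
  -- e₁e₂ = e₃, e₁e₃ = e₆, e₁e₄ = e₅, e₂e₃ = e₅, e₄e₅ = e₆
  | .T10 => [(0, 1, e 2), (0, 2, e 5), (0, 3, e 4), (1, 2, e 4), (3, 4, e 5)]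
  -- e₁e₂ = e₃, e₁e₄ = e₅, e₁e₅ = e₆, e₂e₃ = e₅
  | .T11 => [(0, 1, e 2), (0, 3, e 4), (0, 4, e 5), (1, 2, e 4)]
  -- e₁e₂ = e₃, e₁e₄ = e₅, e₁e₅ = e₆, e₂e₃ = e₅, e₂e₄ = e₆
  | .T12 => [(0, 1, e 2), (0, 3, e 4), (0, 4, e 5), (1, 2, e 4), (1, 3, e 5)]
  -- e₁e₂ = e₃, e₁e₄ = e₅, e₁e₅ = e₆, e₂e₃ = e₅, e₃e₄ = e₆
  | .T13 => [(0, 1, e 2), (0, 3, e 4), (0, 4, e 5), (1, 2, e 4), (2, 3, e 5)]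
  -- e₁e₂ = e₃, e₁e₄ = e₅, e₂e₃ = e₅, e₄e₅ = e₆
  | .T14 => [(0, 1, e 2), (0, 3, e 4), (1, 2, e 4), (3, 4, e 5)]
  -- e₁e₂ = e₃, e₁e₃ = e₄, e₁e₄ = e₅, e₁e₅ = e₆, e₂e₄ = e₆
  | .T15 => [(0, 1, e 2), (0, 2, e 3), (0, 3, e 4), (0, 4, e 5), (1, 3, e 5)]
  -- e₁e₂ = e₃, e₁e₃ = e₄, e₁e₄ = e₅, e₂e₅ = e₆
  | .T16 => [(0, 1, e 2), (0, 2, e 3), (0, 3, e 4), (1, 4, e 5)]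
  -- e₁e₂ = e₃, e₁e₃ = e₄, e₁e₄ = e₅, e₂e₃ = e₅, e₂e₅ = e₆
  | .T17 => [(0, 1, e 2), (0, 2, e 3), (0, 3, e 4), (1, 2, e 4), (1, 4, e 5)]
  -- e₁e₂ = e₃, e₁e₃ = e₄, e₁e₄ = e₅, e₁e₅ = (α + 1)e₆, e₂e₃ = e₅, e₂e₄ = αe₆
  | .T18 α => [(0, 1, e 2), (0, 2, e 3), (0, 3, e 4), (0, 4, (α + 1) • e 5), (1, 2, e 4),
      (1, 3, α • e 5)]
  -- e₁e₂ = e₃, e₁e₃ = e₄, e₁e₅ = e₆, e₂e₄ = e₅, e₃e₄ = e₆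
  | .T19 => [(0, 1, e 2), (0, 2, e 3), (0, 4, e 5), (1, 3, e 4), (2, 3, e 5)]

/-- The product on `ℂ⁶` given by the multiplication table: anticommutative, and the products of basis
vectors that are neither listed nor opposite to a listed one are zero. -/
def Name.product (N : Name) : Product (Fin 6 → ℂ) :=
  (N.table.map fun t => elementary t.1 t.2.1 t.2.2).sum

/-- The parameter values for which the algebra is a genuinely new one: at the excluded values the
basis vector `e₄` or `e₅` falls into the annihilator, and the algebra is isomorphic to
`T02` (for `T09`) or to `T01` (for `T18`). -/
def Name.Nondegenerate : Name → Prop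
  | .T09 α => α ≠ 0 ∧ α ≠ -1
  | .T18 α => α ≠ -1
  | _ => True

end Tortkara

/-! ### The listed algebras: coordinates, identities, nilpotency. -/

namespace Tortkara

/-! The classification follows the lower central series `lcs μ n`, numbered so that `lcs μ 0` is the
whole algebra. Written as (ab)(ac) = -J(a,b,c)a, the Tortkara identity pushes products of two
elements of the square unexpectedly deep: into `lcs μ 3` for at most three generators
(`Generate.mul_mem_three`), and into `lcs μ 4` when a single product z = xy spans the square modulo
the cube (`Adapted.one_mul_one`). On the other hand, a Tortkara algebra is Malcev as soon as its
square has zero product and left multiplications commute on the square (`isMalcev_of_mul_comm`).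
Hence `lcs μ 3` is nonzero in a non-Malcev algebra, and in dimension six the factors of the series
can only have dimensions (3,1,1,1), (2,1,2,1), (2,1,1,2) or (2,1,1,1,1).

In each pattern the table depends on a few scalars, recorded in the `Frame…` structures, and changes
of generators lead to a listed table. Pattern (3,1,1,1) gives `T00`, `T04`–`T07` and `T10`–`T14`. In
pattern (2,1,2,1) the rule g(hz) = B(g,h)u defines a bilinear form on the plane of generators; a
symmetric B makes the algebra Malcev, and the non-symmetric forms, up to congruence and scaling,
give `T02`, `T08` and `T09`. Pattern (2,1,1,2) gives `T01` and `T03`, and (2,1,1,1,1) gives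
`T15`–`T19`.

For non-isomorphism, the codimensions of four characteristic subspaces separate all names, up to
parameters, except `T08` from `T09`. That pair differs by the cone of isotropic vectors of B, and
the parameters of `T09` and `T18` are recovered by comparing coordinates of products under an
isomorphism. -/

/-- The coordinates of the product of `x` and `y`. -/
def Name.coords : Name → (Fin 6 → ℂ) → (Fin 6 → ℂ) → (Fin 6 → ℂ)
  | .T00, x, y =>
    ![0, 0, x 0 * y 1 - x 1 * y 0, x 0 * y 2 - x 2 * y 0, x 1 * y 3 - x 3 * y 1, 0]
  | .T01, x, y =>
    ![0, 0, x 0 * y 1 - x 1 * y 0, x 0 * y 2 - x 2 * y 0,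
      (x 0 * y 3 - x 3 * y 0) + (x 1 * y 2 - x 2 * y 1), x 1 * y 3 - x 3 * y 1]
  | .T02, x, y =>
    ![0, 0, x 0 * y 1 - x 1 * y 0, x 0 * y 2 - x 2 * y 0, x 1 * y 2 - x 2 * y 1,
      x 1 * y 3 - x 3 * y 1]
  | .T03, x, y =>
    ![0, 0, x 0 * y 1 - x 1 * y 0, x 0 * y 2 - x 2 * y 0, x 0 * y 3 - x 3 * y 0,
      x 1 * y 3 - x 3 * y 1]
  | .T04, x, y =>
    ![0, 0, x 0 * y 1 - x 1 * y 0, x 0 * y 2 - x 2 * y 0, 0,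
      (x 0 * y 4 - x 4 * y 0) + (x 1 * y 3 - x 3 * y 1)]
  | .T05, x, y =>
    ![0, 0, x 0 * y 1 - x 1 * y 0, x 0 * y 2 - x 2 * y 0, 0,
      (x 1 * y 2 - x 2 * y 1) + (x 3 * y 4 - x 4 * y 3)]
  | .T06, x, y =>
    ![0, 0, x 0 * y 1 - x 1 * y 0, x 0 * y 2 - x 2 * y 0, 0,
      (x 1 * y 3 - x 3 * y 1) + (x 2 * y 4 - x 4 * y 2)]
  | .T07, x, y =>
    ![0, 0, x 0 * y 1 - x 1 * y 0, x 0 * y 2 - x 2 * y 0, 0, x 3 * y 4 - x 4 * y 3]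
  | .T08, x, y =>
    ![0, 0, x 0 * y 1 - x 1 * y 0, x 0 * y 2 - x 2 * y 0, x 1 * y 2 - x 2 * y 1,
      (x 0 * y 3 - x 3 * y 0) - (x 0 * y 4 - x 4 * y 0) + (x 1 * y 3 - x 3 * y 1)]
  | .T09 α, x, y =>
    ![0, 0, x 0 * y 1 - x 1 * y 0, x 0 * y 2 - x 2 * y 0, x 1 * y 2 - x 2 * y 1,
      (x 0 * y 4 - x 4 * y 0) * (α + 1) + (x 1 * y 3 - x 3 * y 1) * α]
  | .T10, x, y =>
    ![0, 0, x 0 * y 1 - x 1 * y 0, 0, (x 0 * y 3 - x 3 * y 0) + (x 1 * y 2 - x 2 * y 1),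
      (x 0 * y 2 - x 2 * y 0) + (x 3 * y 4 - x 4 * y 3)]
  | .T11, x, y =>
    ![0, 0, x 0 * y 1 - x 1 * y 0, 0, (x 0 * y 3 - x 3 * y 0) + (x 1 * y 2 - x 2 * y 1),
      x 0 * y 4 - x 4 * y 0]
  | .T12, x, y =>
    ![0, 0, x 0 * y 1 - x 1 * y 0, 0, (x 0 * y 3 - x 3 * y 0) + (x 1 * y 2 - x 2 * y 1),
      (x 0 * y 4 - x 4 * y 0) + (x 1 * y 3 - x 3 * y 1)]
  | .T13, x, y =>
    ![0, 0, x 0 * y 1 - x 1 * y 0, 0, (x 0 * y 3 - x 3 * y 0) + (x 1 * y 2 - x 2 * y 1),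
      (x 0 * y 4 - x 4 * y 0) + (x 2 * y 3 - x 3 * y 2)]
  | .T14, x, y =>
    ![0, 0, x 0 * y 1 - x 1 * y 0, 0, (x 0 * y 3 - x 3 * y 0) + (x 1 * y 2 - x 2 * y 1),
      x 3 * y 4 - x 4 * y 3]
  | .T15, x, y =>
    ![0, 0, x 0 * y 1 - x 1 * y 0, x 0 * y 2 - x 2 * y 0, x 0 * y 3 - x 3 * y 0,
      (x 0 * y 4 - x 4 * y 0) + (x 1 * y 3 - x 3 * y 1)]
  | .T16, x, y =>
    ![0, 0, x 0 * y 1 - x 1 * y 0, x 0 * y 2 - x 2 * y 0, x 0 * y 3 - x 3 * y 0,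
      x 1 * y 4 - x 4 * y 1]
  | .T17, x, y =>
    ![0, 0, x 0 * y 1 - x 1 * y 0, x 0 * y 2 - x 2 * y 0,
      (x 0 * y 3 - x 3 * y 0) + (x 1 * y 2 - x 2 * y 1), x 1 * y 4 - x 4 * y 1]
  | .T18 α, x, y =>
    ![0, 0, x 0 * y 1 - x 1 * y 0, x 0 * y 2 - x 2 * y 0,
      (x 0 * y 3 - x 3 * y 0) + (x 1 * y 2 - x 2 * y 1),
      (x 0 * y 4 - x 4 * y 0) * (α + 1) + (x 1 * y 3 - x 3 * y 1) * α]
  | .T19, x, y =>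
    ![0, 0, x 0 * y 1 - x 1 * y 0, x 0 * y 2 - x 2 * y 0, x 1 * y 3 - x 3 * y 1,
      (x 0 * y 4 - x 4 * y 0) + (x 2 * y 3 - x 3 * y 2)]

/-- Turns every identity in a listed algebra into polynomial identities in coordinates. -/
theorem product_apply (N : Name) (x y : Fin 6 → ℂ) : N.product x y = N.coords x y := by
  cases N <;> ext k <;> fin_cases k <;>
    simp [Name.product, Name.table, Name.coords, elementary, e]
  ring

theorem isAnticommutative_product (N : Name) : IsAnticommutative N.product := by
  intro x y
  simp only [product_apply]
  cases N <;> ext k <;> fin_cases k <;>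
    simp only [Name.coords, Pi.neg_apply, Fin.zero_eta, Fin.mk_one, Fin.reduceFinMk,
      Matrix.cons_val] <;> ring

theorem isTortkara_product (N : Name) : IsTortkara N.product := by
  refine ⟨isAnticommutative_product N, fun a b c => ?_⟩
  simp only [jacobian, product_apply]
  cases N <;> ext k <;> fin_cases k <;>
    simp only [Name.coords, Pi.add_apply, Fin.zero_eta, Fin.mk_one, Fin.reduceFinMk,
      Matrix.cons_val] <;> ring

theorem not_isMalcev_product (N : Name) : ¬ IsMalcev N.product := by
  rintro ⟨-, h⟩
  cases N
  -- For each group of names, a triple of basis vectors and a coordinate in which the two sides of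
  -- the Malcev identity differ.
  case T05 | T07 =>
    simpa [jacobian, product_apply, Name.coords, e] using congrFun (h (e 0) (e 4) (e 1)) 5
  case T10 | T14 =>
    simpa [jacobian, product_apply, Name.coords, e] using congrFun (h (e 1) (e 3) (e 0)) 5
  case T16 | T17 =>
    simpa [jacobian, product_apply, Name.coords, e] using congrFun (h (e 0) (e 1) (e 2)) 5
  case T00 | T19 =>
    simpa [jacobian, product_apply, Name.coords, e] using congrFun (h (e 0) (e 1) (e 1)) 4
  all_goals
    simpa [jacobian, product_apply, Name.coords, e] using congrFun (h (e 0) (e 1) (e 1)) 5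

/-- An algebra on `ℂ⁶` is nilpotent if its basis carries weights, all less than `n`, such that the
weights add up under multiplication. -/
theorem isNilpotent_of_weight {μ : Product (Fin 6 → ℂ)} (w : Fin 6 → ℕ) {n : ℕ}
    (hw : ∀ k, 1 ≤ w k) (hn : ∀ k, w k < n)
    (h : ∀ (l m : ℕ) (x y : Fin 6 → ℂ), (∀ k, w k < l → x k = 0) → (∀ k, w k < m → y k = 0) →
      ∀ k, w k < l + m → μ x y k = 0) : IsNilpotent μ := by
  refine ⟨n, Nat.one_le_of_lt (hn 0), fun v hv => funext fun k => ?_⟩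
  have key : ∀ m v, IsProductOf μ m v → ∀ k, w k < m → v k = 0 := by
    intro m v hv
    induction hv with
    | single x => intro k hk; have := hw k; omega
    | mul _ _ ih₁ ih₂ => exact h _ _ _ _ ih₁ ih₂
  exact key n v hv k (hn k)

/-- Weights that show that the algebra is nilpotent. -/
def Name.weight : Name → Fin 6 → ℕ
  | .T05 | .T06 | .T07 => ![1, 1, 2, 3, 1, 4]
  | .T10 | .T11 | .T12 | .T13 | .T14 => ![1, 1, 2, 1, 3, 4]
  | _ => ![1, 1, 2, 3, 4, 5]

/-- The only check on the tables needed for nilpotency. All weights are at most 5, so products of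
six elements vanish. -/
theorem table_weight (N : Name) : ∀ t ∈ N.table, ∀ k, t.2.2 k ≠ 0 →
    N.weight t.1 + N.weight t.2.1 ≤ N.weight k := by
  cases N <;> simp [Name.table, Name.weight, Fin.forall_fin_succ, e]

theorem isNilpotent_product (N : Name) : IsNilpotent N.product := by
  refine isNilpotent_of_weight N.weight (n := 6) ?_ ?_ ?_
  · cases N <;> simp [Name.weight, Fin.forall_fin_succ]
  · cases N <;> simp [Name.weight, Fin.forall_fin_succ]
  intro l m x y hx hy k hk
  have key : ∀ L : List (Fin 6 × Fin 6 × (Fin 6 → ℂ)),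
      (∀ t ∈ L, ∀ k, t.2.2 k ≠ 0 → N.weight t.1 + N.weight t.2.1 ≤ N.weight k) →
      (L.map fun t => elementary t.1 t.2.1 t.2.2).sum x y k = 0 := by
    intro L
    induction L with
    | nil => simp
    | cons t L ih =>
      intro h
      have h₁ := h t (by simp) k
      have h₂ := ih fun s hs => h s (List.mem_cons_of_mem _ hs)
      have h₃ : elementary t.1 t.2.1 t.2.2 x y k = 0 := by
        by_cases hv : t.2.2 k = 0
        · simp [elementary, hv]
        · have h₄ := h₁ hv
          have h₅ : x t.1 * y t.2.1 = 0 := by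
            rcases lt_or_ge (N.weight t.1) l with h | h
            · simp [hx _ h]
            · simp [hy t.2.1 (by omega)]
          have h₆ : x t.2.1 * y t.1 = 0 := by
            rcases lt_or_ge (N.weight t.2.1) l with h | h
            · simp [hx _ h]
            · simp [hy t.1 (by omega)]
          simp [elementary, h₅, h₆]
      simp only [List.map_cons, List.sum_cons, LinearMap.add_apply, Pi.add_apply, h₂, h₃, add_zero]
  exact key _ (table_weight N)

end Tortkara

/-! ### Characteristic subspaces as isomorphism invariants. -/

namespace Tortkara

section Invariants

variable {V : Type*} [AddCommGroup V] [Module ℂ V]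
variable {W : Type*} [AddCommGroup W] [Module ℂ W]

/-- Membership in the second term of the upper central series. -/
def IsSecondCentral (μ : Product V) (v : V) : Prop := ∀ a b, μ (μ a v) b = 0

/-- Membership in the Malcev centre: the linearized Malcev identity holds for `v`. -/
def IsMalcevCentral (μ : Product V) (v : V) : Prop :=
  ∀ x y z, jacobian μ x y (μ v z) + jacobian μ v y (μ x z) =
    μ (jacobian μ x y z) v + μ (jacobian μ v y z) x

/-- The elements `v` which map the square of the algebra into the annihilator. -/
def SendsSquareToCentre (μ : Product V) (v : V) : Prop := ∀ a b c, μ (μ v (μ a b)) c = 0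

/-- The elements `v` which annihilate the cube of the algebra. -/
def KillsCube (μ : Product V) (v : V) : Prop := ∀ a b c, μ v (μ a (μ b c)) = 0

/-- The elements `v` which annihilate all elements with the property `P`. -/
def Annihilates (μ : Product V) (P : V → Prop) (v : V) : Prop := ∀ w, P w → μ v w = 0

theorem jacobian_equiv {μ : Product V} {ν : Product W} (φ : V ≃ₗ[ℂ] W)
    (h : ∀ x y, φ (μ x y) = ν (φ x) (φ y)) (a b c : V) :
    jacobian ν (φ a) (φ b) (φ c) = φ (jacobian μ a b c) := by
  simp [jacobian, h]

/-- Like the next four, this holds because the property is phrased purely in terms of products and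
quantifiers over the algebra. -/
theorem isSecondCentral_equiv {μ : Product V} {ν : Product W} (φ : V ≃ₗ[ℂ] W)
    (h : ∀ x y, φ (μ x y) = ν (φ x) (φ y)) (v : V) :
    IsSecondCentral μ v ↔ IsSecondCentral ν (φ v) := by
  simp only [IsSecondCentral, φ.surjective.forall, ← h, map_eq_zero_iff φ φ.injective]

theorem isMalcevCentral_equiv {μ : Product V} {ν : Product W} (φ : V ≃ₗ[ℂ] W)
    (h : ∀ x y, φ (μ x y) = ν (φ x) (φ y)) (v : V) :
    IsMalcevCentral μ v ↔ IsMalcevCentral ν (φ v) := by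
  simp only [IsMalcevCentral, φ.surjective.forall, ← h, jacobian_equiv φ h, ← map_add,
    φ.injective.eq_iff]

theorem sendsSquareToCentre_equiv {μ : Product V} {ν : Product W} (φ : V ≃ₗ[ℂ] W)
    (h : ∀ x y, φ (μ x y) = ν (φ x) (φ y)) (v : V) :
    SendsSquareToCentre μ v ↔ SendsSquareToCentre ν (φ v) := by
  simp only [SendsSquareToCentre, φ.surjective.forall, ← h, map_eq_zero_iff φ φ.injective]

theorem killsCube_equiv {μ : Product V} {ν : Product W} (φ : V ≃ₗ[ℂ] W)
    (h : ∀ x y, φ (μ x y) = ν (φ x) (φ y)) (v : V) :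
    KillsCube μ v ↔ KillsCube ν (φ v) := by
  simp only [KillsCube, φ.surjective.forall, ← h, map_eq_zero_iff φ φ.injective]

theorem annihilates_equiv {μ : Product V} {ν : Product W} (φ : V ≃ₗ[ℂ] W)
    (h : ∀ x y, φ (μ x y) = ν (φ x) (φ y)) {P : V → Prop} {Q : W → Prop}
    (hPQ : ∀ v, P v ↔ Q (φ v)) (v : V) :
    Annihilates μ P v ↔ Annihilates ν Q (φ v) := by
  simp only [Annihilates, φ.surjective.forall, ← h, ← hPQ, map_eq_zero_iff φ φ.injective]

end Invariants

/-- The property `P` defines a coordinate subspace of codimension `n` of `ℂ⁶`. -/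
def HasCodim (P : (Fin 6 → ℂ) → Prop) (n : ℕ) : Prop :=
  ∃ T : Finset (Fin 6), T.card = n ∧ ∀ v, P v ↔ ∀ i ∈ T, v i = 0

/-- All the characteristic subspaces of the listed algebras turn out to be coordinate subspaces, so
comparing dimensions amounts to comparing the cardinalities of finite sets of indices. -/
theorem HasCodim.eq {P Q : (Fin 6 → ℂ) → Prop} {m n : ℕ} (hP : HasCodim P m) (hQ : HasCodim Q n)
    (φ : (Fin 6 → ℂ) ≃ₗ[ℂ] (Fin 6 → ℂ)) (h : ∀ v, P v ↔ Q (φ v)) : m = n := by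
  obtain ⟨S, rfl, hS⟩ := hP
  obtain ⟨T, rfl, hT⟩ := hQ
  have key : ∀ T : Finset (Fin 6), Module.finrank ℂ
      (⨅ i ∈ T, LinearMap.ker (LinearMap.proj i : (Fin 6 → ℂ) →ₗ[ℂ] ℂ) :
        Submodule ℂ (Fin 6 → ℂ)) = 6 - T.card := by
    intro T
    have := (LinearMap.iInfKerProjEquiv ℂ (fun _ : Fin 6 => ℂ) (I := ((Tᶜ : Finset (Fin 6)) : Set _))
      (J := (T : Set (Fin 6))) (by
        rw [Finset.disjoint_coe]; exact disjoint_compl_left) (by simp)).finrank_eq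
    simp only [Module.finrank_fintype_fun_eq_card, Fintype.card_coe, Finset.coe_sort_coe,
      Finset.card_compl, Fintype.card_fin] at this
    exact this
  have hmap : Submodule.map (φ : (Fin 6 → ℂ) →ₗ[ℂ] (Fin 6 → ℂ))
      (⨅ i ∈ S, LinearMap.ker (LinearMap.proj i : (Fin 6 → ℂ) →ₗ[ℂ] ℂ)) =
      ⨅ i ∈ T, LinearMap.ker (LinearMap.proj i : (Fin 6 → ℂ) →ₗ[ℂ] ℂ) := by
    ext w
    obtain ⟨v, rfl⟩ := φ.surjective w
    have := (hS v).symm.trans ((h v).trans (hT (φ v)))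
    simpa [Submodule.mem_map, Submodule.mem_iInf] using this
  have h₁ := key S
  have h₂ := key T
  rw [← hmap, LinearEquiv.finrank_map_eq φ, h₁] at h₂
  have := Finset.card_le_univ S
  have := Finset.card_le_univ T
  simp only [Fintype.card_fin] at *
  omega

/-! ### The values of the invariants on the list. -/

/-- The coordinates which vanish on the second centre. -/
def Name.secondCentre : Name → Finset (Fin 6)
  | .T10 | .T11 | .T12 | .T13 | .T14 | .T15 | .T16 | .T17 | .T18 _ | .T19 => {0, 1, 2, 3}
  | _ => {0, 1, 2}

/-- The coordinates which vanish on the Malcev centre. -/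
def Name.malcevCentre : Name → Finset (Fin 6)
  | .T05 | .T07 => {0, 1, 4}
  | .T10 | .T14 => {0, 1, 3}
  | .T16 | .T17 | .T19 => {0, 1, 2}
  | _ => {0, 1}

/-- The coordinates which vanish on the elements that map the square into the annihilator. -/
def Name.squareToCentre : Name → Finset (Fin 6)
  | .T08 | .T09 _ | .T17 | .T18 _ | .T19 => {0, 1}
  | .T10 | .T11 | .T12 | .T13 | .T14 => {1}
  | _ => {0}

/-- The coordinates which vanish on the annihilator of the elements that map the square into the
annihilator. -/
def Name.annSquareToCentre : Name → Finset (Fin 6)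
  | .T00 | .T03 | .T04 | .T15 => {0, 1, 3}
  | .T01 | .T02 | .T19 => {0, 1, 2, 3}
  | .T05 | .T06 | .T10 | .T13 => {0, 1, 2, 3, 4}
  | .T07 => {0, 3, 4}
  | .T08 | .T09 _ | .T17 | .T18 _ => {0, 1}
  | .T11 | .T12 | .T14 => {0, 1, 3, 4}
  | .T16 => {0, 1, 4}

open Classical in
/-- The coordinates which vanish on the annihilator of the cube. -/
noncomputable def Name.annCube : Name → Finset (Fin 6)
  | .T00 | .T02 | .T04 | .T06 => {1}
  | .T05 | .T07 => {4}
  | .T10 | .T14 => {3}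
  | .T11 | .T12 | .T13 => {0}
  | .T18 α => if α = 0 then {0} else {0, 1}
  | .T19 => {0, 1, 2}
  | _ => {0, 1}

open Classical in
/-- The coordinates which vanish on the second annihilator of the cube. -/
noncomputable def Name.annAnnCube : Name → Finset (Fin 6)
  | .T00 | .T02 | .T11 | .T19 => {0, 1, 2}
  | .T04 | .T05 | .T06 | .T07 => {0, 1, 2, 4}
  | .T10 | .T12 | .T13 | .T14 => {0, 1, 2, 3}
  | .T18 α => if α = 0 then {0, 1, 2} else {0, 1}
  | _ => {0, 1}

set_option maxHeartbeats 2000000 in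
theorem isSecondCentral_iff (N : Name) (hN : N.Nondegenerate) (v : Fin 6 → ℂ) :
    IsSecondCentral N.product v ↔ ∀ i ∈ N.secondCentre, v i = 0 := by
  constructor
  · intro h
    have h₁ := h (e 0) (e 0)
    have h₂ := h (e 1) (e 0)
    have h₃ := h (e 0) (e 1)
    have h₄ := h (e 1) (e 1)
    have h₅ := h (e 0) (e 4)
    have h₆ := h (e 0) (e 3)
    have h₇ := h (e 1) (e 3)
    clear h
    simp only [product_apply] at h₁ h₂ h₃ h₄ h₅ h₆ h₇
    cases N <;> simp [Name.coords, e, funext_iff, Fin.forall_fin_succ, Name.Nondegenerate,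
      Name.secondCentre] at * <;> grind
  · intro h a b
    simp only [product_apply]
    cases N <;> simp [Name.secondCentre] at h <;> ext k <;> fin_cases k <;>
      simp [Name.coords, h]

/-- Nondegeneracy matters here: v(e 2) has the terms v 0 • e 3 and v 1 • e 4, and in `T09` the
vector e 3 is central for α = 0 and e 4 for α = -1; in `T18` the vector e 4 is central for α = -1.
-/
theorem sendsSquareToCentre_iff (N : Name) (hN : N.Nondegenerate) (v : Fin 6 → ℂ) :
    SendsSquareToCentre N.product v ↔ ∀ i ∈ N.squareToCentre, v i = 0 := by
  constructor
  · intro h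
    have h₁ := h (e 0) (e 1) (e 0)
    have h₂ := h (e 0) (e 1) (e 1)
    have h₃ := h (e 0) (e 1) (e 3)
    have h₄ := h (e 0) (e 1) (e 4)
    have h₅ := h (e 0) (e 2) (e 0)
    clear h
    simp only [product_apply] at h₁ h₂ h₃ h₄ h₅
    cases N <;> simp [Name.coords, e, funext_iff, Fin.forall_fin_succ, Name.Nondegenerate,
      Name.squareToCentre] at * <;> grind
  · intro h a b c
    simp only [product_apply]
    cases N <;> simp [Name.squareToCentre] at h <;> ext k <;> fin_cases k <;>
      simp [Name.coords, h]

/-- Passing to the annihilator gives a finer invariant: the subspace itself has codimension only 1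
or 2, its annihilator any codimension from 2 to 5. -/
theorem annihilates_sendsSquareToCentre_iff (N : Name) (hN : N.Nondegenerate) (v : Fin 6 → ℂ) :
    Annihilates N.product (SendsSquareToCentre N.product) v ↔
      ∀ i ∈ N.annSquareToCentre, v i = 0 := by
  simp only [Annihilates, sendsSquareToCentre_iff N hN, product_apply]
  constructor
  · intro h
    have h₀ := h (e 0)
    have h₁ := h (e 1)
    have h₂ := h (e 2)
    have h₃ := h (e 3)
    have h₄ := h (e 4)
    clear h
    cases N <;> simp [Name.coords, e, funext_iff, Fin.forall_fin_succ,
      Name.squareToCentre, Name.annSquareToCentre] at * <;> grind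
  · intro h w hw
    cases N <;> simp [Name.squareToCentre, Name.annSquareToCentre] at h hw <;> ext k <;>
      fin_cases k <;> simp [Name.coords, h, hw]

theorem killsCube_iff (N : Name) (hN : N.Nondegenerate) (v : Fin 6 → ℂ) :
    KillsCube N.product v ↔ ∀ i ∈ N.annCube, v i = 0 := by
  constructor
  · intro h
    have h₁ := h (e 0) (e 0) (e 1)
    have h₂ := h (e 1) (e 0) (e 1)
    have h₃ := h (e 0) (e 0) (e 2)
    have h₄ := h (e 1) (e 0) (e 2)
    clear h
    simp only [product_apply] at h₁ h₂ h₃ h₄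
    cases N <;> simp [Name.coords, e, funext_iff, Fin.forall_fin_succ, Name.Nondegenerate,
      Name.annCube] at * <;> grind
  · intro h a b c
    simp only [product_apply]
    cases N
    -- The cube is spanned by e 3, e 4, e 5, and v 1 enters its products with v only through (e 1)(e
    -- 3) = α • e 5, hence the split at α = 0.
    case T18 α =>
      by_cases hα : α = 0 <;> simp [Name.annCube, hα] at h <;> ext k <;> fin_cases k <;>
        simp [Name.coords, h, hα]
    all_goals
      simp [Name.annCube] at h
      ext k
      fin_cases k <;> simp [Name.coords, h]

theorem annihilates_killsCube_iff (N : Name) (hN : N.Nondegenerate) (v : Fin 6 → ℂ) :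
    Annihilates N.product (KillsCube N.product) v ↔ ∀ i ∈ N.annAnnCube, v i = 0 := by
  simp only [Annihilates, killsCube_iff N hN, product_apply]
  constructor
  · intro h
    have h₀ := h (e 0)
    have h₁ := h (e 1)
    have h₂ := h (e 2)
    have h₃ := h (e 3)
    have h₄ := h (e 4)
    clear h
    cases N <;> simp [Name.coords, e, funext_iff, Fin.forall_fin_succ,
      Name.annCube, Name.annAnnCube] at * <;> grind
  · intro h w hw
    cases N
    case T18 α =>
      by_cases hα : α = 0 <;> simp [Name.annCube, Name.annAnnCube, hα] at h hw <;> ext k <;>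
        fin_cases k <;> simp [Name.coords, h, hw, hα]
    all_goals
      simp [Name.annCube, Name.annAnnCube] at h hw
      ext k
      fin_cases k <;> simp [Name.coords, h, hw]

set_option maxHeartbeats 8000000 in
theorem isMalcevCentral_iff (N : Name) (hN : N.Nondegenerate) (v : Fin 6 → ℂ) :
    IsMalcevCentral N.product v ↔ ∀ i ∈ N.malcevCentre, v i = 0 := by
  constructor
  · intro h
    have h₁ := h (e 1) (e 0) (e 0)
    have h₂ := h (e 0) (e 1) (e 1)
    have h₃ := h (e 0) (e 4) (e 0)
    have h₄ := h (e 0) (e 4) (e 1)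
    have h₅ := h (e 0) (e 3) (e 1)
    have h₆ := h (e 1) (e 3) (e 1)
    have h₇ := h (e 0) (e 0) (e 2)
    have h₈ := h (e 0) (e 1) (e 2)
    have h₉ := h (e 0) (e 0) (e 1)
    clear h
    simp only [jacobian, product_apply] at h₁ h₂ h₃ h₄ h₅ h₆ h₇ h₈ h₉
    cases N <;> simp [Name.coords, e, funext_iff, Fin.forall_fin_succ, Name.Nondegenerate,
      Name.malcevCentre] at * <;> grind
  · intro h x y z
    simp only [jacobian, product_apply]
    cases N <;> simp [Name.malcevCentre] at h <;> ext k <;> fin_cases k <;>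
      simp only [Name.coords, Pi.add_apply, Fin.zero_eta, Fin.mk_one, Fin.reduceFinMk,
      Matrix.cons_val, h] <;> ring

end Tortkara

/-! ### Isomorphisms between the listed algebras. -/

namespace Tortkara

section Isomorphic

variable {V : Type*} [AddCommGroup V] [Module ℂ V]

theorem Isomorphic.refl (μ : Product V) : Isomorphic μ μ :=
  ⟨LinearEquiv.refl ℂ V, fun _ _ => rfl⟩

theorem Isomorphic.trans {W X : Type*} [AddCommGroup W] [Module ℂ W] [AddCommGroup X] [Module ℂ X]
    {μ : Product V} {ν : Product W} {ξ : Product X} (h : Isomorphic μ ν) (h' : Isomorphic ν ξ) :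
    Isomorphic μ ξ := by
  obtain ⟨φ, hφ⟩ := h
  obtain ⟨ψ, hψ⟩ := h'
  exact ⟨φ.trans ψ, fun x y => by simp [hφ, hψ]⟩

theorem IsAnticommutative.mul_self {μ : Product V} (h : IsAnticommutative μ) (x : V) :
    μ x x = 0 := by
  have h₁ : (2 : ℂ) • μ x x = 0 := by
    rw [two_smul]
    nth_rewrite 1 [h x x]
    exact neg_add_cancel _
  simpa using h₁

/-- A spanning family of six vectors whose products are given by one of the multiplication tables
defines an isomorphism. -/
theorem isomorphic_of_frame {μ : Product V} (hV : Module.finrank ℂ V = 6)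
    (hμ : IsAnticommutative μ) (N : Name) (f : Fin 6 → V)
    (hf : ∀ S : Submodule ℂ V, (∀ i, f i ∈ S) → S = ⊤)
    (h : ∀ i j, i < j → μ (f i) (f j) = ∑ k, N.coords (e i) (e j) k • f k) :
    Isomorphic μ N.product := by
  have hspan : ⊤ ≤ Submodule.span ℂ (Set.range f) :=
    (hf _ fun i => Submodule.subset_span (Set.mem_range_self i)).ge
  let b := basisOfTopLeSpanOfCardEqFinrank f hspan (by simp [hV])
  have hb : ∀ x, b.equivFun.symm x = ∑ k, x k • f k := by
    intro x
    simp [b, Module.Basis.equivFun_symm_apply]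
  have hbe : ∀ i, b.equivFun.symm (e i) = f i := by
    intro i
    rw [hb, Finset.sum_eq_single i] <;> simp +contextual [e]
  have hlt : ∀ i j, i < j → μ (f i) (f j) = b.equivFun.symm (N.product (e i) (e j)) := by
    intro i j hij
    rw [h i j hij, hb, product_apply]
  have hall : ∀ i j, b.equivFun.symm (N.product (e i) (e j)) = μ (f i) (f j) := by
    intro i j
    rcases lt_trichotomy i j with hij | rfl | hij
    · exact (hlt i j hij).symm
    · rw [(isAnticommutative_product N).mul_self, hμ.mul_self, map_zero]
    · rw [isAnticommutative_product N, map_neg, ← hlt j i hij, hμ (f i)]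
  -- Bilinear maps are compared on a basis; the pairs with i ≥ j were supplied by anticommutativity.
  have key : N.product.compr₂ b.equivFun.symm.toLinearMap =
      μ.compl₁₂ b.equivFun.symm.toLinearMap b.equivFun.symm.toLinearMap := by
    refine LinearMap.ext_basis (Pi.basisFun ℂ (Fin 6)) (Pi.basisFun ℂ (Fin 6)) fun i j => ?_
    have := hall i j
    rw [← hbe i, ← hbe j] at this
    simpa [e] using this
  refine ⟨b.equivFun, fun x y => b.equivFun.symm.injective ?_⟩
  have := LinearMap.congr_fun₂ key (b.equivFun x) (b.equivFun y)
  simp only [LinearMap.compr₂_apply, LinearMap.compl₁₂_apply, LinearEquiv.coe_coe,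
    LinearEquiv.symm_apply_apply] at this
  rw [this, LinearEquiv.symm_apply_apply]

end Isomorphic

/-- An involutive matrix that respects the products defines an isomorphism. -/
theorem isomorphic_of_involutive {M N : Name} (f : (Fin 6 → ℂ) →ₗ[ℂ] (Fin 6 → ℂ))
    (hf : Function.Involutive f) (h : ∀ x y, f (M.coords x y) = N.coords (f x) (f y)) :
    Isomorphic M.product N.product :=
  ⟨LinearEquiv.ofInvolutive f hf, fun x y => by simpa [product_apply] using h x y⟩

/-- The linear map that exchanges the first two basis vectors and the fourth and the fifth one. -/
def swap (c : ℂ) : (Fin 6 → ℂ) →ₗ[ℂ] (Fin 6 → ℂ) :=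
  LinearMap.pi ![LinearMap.proj 1, LinearMap.proj 0, -LinearMap.proj 2, -LinearMap.proj 4,
    -LinearMap.proj 3, c • LinearMap.proj 5]

/-- The linear map that changes the sign of the last basis vector. -/
def flip : (Fin 6 → ℂ) →ₗ[ℂ] (Fin 6 → ℂ) :=
  LinearMap.pi ![LinearMap.proj 0, LinearMap.proj 1, LinearMap.proj 2, LinearMap.proj 3,
    LinearMap.proj 4, -LinearMap.proj 5]

theorem swap_apply (c : ℂ) (x : Fin 6 → ℂ) :
    swap c x = ![x 1, x 0, -x 2, -x 4, -x 3, c * x 5] := by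
  ext k
  fin_cases k <;> simp [swap]

theorem flip_apply (x : Fin 6 → ℂ) : flip x = ![x 0, x 1, x 2, x 3, x 4, -x 5] := by
  ext k
  fin_cases k <;> simp [flip]

theorem involutive_swap {c : ℂ} (hc : c * c = 1) : Function.Involutive (swap c) := by
  intro x
  ext k
  fin_cases k <;> simp [swap_apply, ← mul_assoc, hc]

theorem involutive_flip : Function.Involutive flip := by
  intro x
  ext k
  fin_cases k <;> simp [flip_apply]

/-- Exchanging the generators replaces z by -z, so the coefficients (α + 1, α) of (e 0)(e 4), (e
1)(e 3) become (-α, -α - 1). -/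
theorem isomorphic_T09_neg (α : ℂ) :
    Isomorphic (Name.T09 α).product (Name.T09 (-α - 1)).product := by
  refine isomorphic_of_involutive (swap 1) (involutive_swap (by norm_num)) fun x y => ?_
  ext k
  fin_cases k <;> simp [swap_apply, Name.coords]
  all_goals ring

theorem isomorphic_T09_zero : Isomorphic (Name.T09 0).product Name.T02.product := by
  refine isomorphic_of_involutive (swap (-1)) (involutive_swap (by norm_num)) fun x y => ?_
  ext k
  fin_cases k <;> simp [swap_apply, Name.coords]
  all_goals ring

theorem isomorphic_T09_neg_one : Isomorphic (Name.T09 (-1)).product Name.T02.product := by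
  refine isomorphic_of_involutive flip involutive_flip fun x y => ?_
  ext k
  fin_cases k <;> simp [flip_apply, Name.coords]

theorem isomorphic_T18_neg_one : Isomorphic (Name.T18 (-1)).product Name.T01.product := by
  refine isomorphic_of_involutive flip involutive_flip fun x y => ?_
  ext k
  fin_cases k <;> simp [flip_apply, Name.coords]

/-- The elements `v` with `v(v(va)) = 0` for all `a`. -/
def IsCubicNull {V : Type*} [AddCommGroup V] [Module ℂ V] (μ : Product V) (v : V) : Prop :=
  ∀ a, μ v (μ v (μ v a)) = 0

theorem isCubicNull_equiv {V W : Type*} [AddCommGroup V] [Module ℂ V] [AddCommGroup W] [Module ℂ W]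
    {μ : Product V} {ν : Product W} (φ : V ≃ₗ[ℂ] W) (h : ∀ x y, φ (μ x y) = ν (φ x) (φ y)) (v : V) :
    IsCubicNull μ v ↔ IsCubicNull ν (φ v) := by
  simp only [IsCubicNull, φ.surjective.forall, ← h, map_eq_zero_iff φ φ.injective]

theorem isCubicNull_T08 (v : Fin 6 → ℂ) : IsCubicNull Name.T08.product v ↔ v 0 = 0 := by
  simp only [IsCubicNull, product_apply]
  constructor
  · intro h
    have := congrFun (h (e 1)) 5
    simp [Name.coords, e] at this
    exact eq_zero_of_pow_eq_zero (n := 3) (by linear_combination this)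
  · intro h a
    ext k
    fin_cases k <;> simp [Name.coords, h]

/-- The element v(v(va)) is a multiple of B(v,v), the quadratic form of the generators: (v 0)² for
`T08` and (2α + 1)(v 0)(v 1) for `T09`. The null elements of `T08` form a hyperplane. In `T09` both
e 0 and e 1 are null, so linearity would make their sum null, forcing 2α + 1 = 0; but then every
element of `T09` is null. -/
theorem not_isomorphic_T08_T09 (α : ℂ) : ¬ Isomorphic Name.T08.product (Name.T09 α).product := by
  rintro ⟨φ, h⟩
  have hφ := isCubicNull_equiv φ h
  have h₀ : IsCubicNull (Name.T09 α).product (e 0) := by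
    intro a
    ext k
    fin_cases k <;> simp [product_apply, Name.coords, e]
  have h₁ : IsCubicNull (Name.T09 α).product (e 1) := by
    intro a
    ext k
    fin_cases k <;> simp [product_apply, Name.coords, e]
  obtain ⟨x, hx⟩ := φ.surjective (e 0)
  obtain ⟨y, hy⟩ := φ.surjective (e 1)
  rw [← hx, ← hφ, isCubicNull_T08] at h₀
  rw [← hy, ← hφ, isCubicNull_T08] at h₁
  have h₂ : ∀ a b : ℂ, IsCubicNull (Name.T09 α).product (a • e 0 + b • e 1) := by
    intro a b
    rw [← hx, ← hy, ← map_smul, ← map_smul, ← map_add, ← hφ, isCubicNull_T08]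
    simp [h₀, h₁]
  have h₃ : 2 * α + 1 = 0 := by
    have := congrFun (h₂ 1 1 (e 1)) 5
    simp [product_apply, Name.coords, e] at this
    linear_combination this
  have h₄ : IsCubicNull (Name.T09 α).product (φ (e 0)) := by
    intro a
    ext k
    fin_cases k <;> simp [product_apply, Name.coords]
    grind
  rw [← hφ, isCubicNull_T08] at h₄
  simp [e] at h₄

/-- The image x of e 0 is isotropic, since (e 0)(e 3) = 0. If 2β + 1 ≠ 0, then x 0 = 0 or x 1 = 0:
the isomorphism exchanges or preserves the two isotropic lines, which accounts for the two values of
β. -/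
theorem isomorphic_T09_T09 {α β : ℂ} (hα : α ≠ -1)
    (h : Isomorphic (Name.T09 α).product (Name.T09 β).product) : β = α ∨ β = -α - 1 := by
  obtain ⟨φ, h⟩ := h
  have h₀₁ := h (e 0) (e 1)
  have h₁₂ := h (e 1) (e 2)
  have h₀₂ := h (e 0) (e 2)
  have h₀₃ := h (e 0) (e 3)
  have h₀₄ := h (e 0) (e 4)
  have h₁₃ := h (e 1) (e 3)
  have e₀₁ : (Name.T09 α).coords (e 0) (e 1) = e 2 := by
    ext k; fin_cases k <;> simp [Name.coords, e]
  have e₁₂ : (Name.T09 α).coords (e 1) (e 2) = e 4 := by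
    ext k; fin_cases k <;> simp [Name.coords, e]
  have e₀₂ : (Name.T09 α).coords (e 0) (e 2) = e 3 := by
    ext k; fin_cases k <;> simp [Name.coords, e]
  have e₀₃ : (Name.T09 α).coords (e 0) (e 3) = 0 := by
    ext k; fin_cases k <;> simp [Name.coords, e]
  have e₀₄ : (Name.T09 α).coords (e 0) (e 4) = (α + 1) • e 5 := by
    ext k; fin_cases k <;> simp [Name.coords, e]
  have e₁₃ : (Name.T09 α).coords (e 1) (e 3) = α • e 5 := by
    ext k; fin_cases k <;> simp [Name.coords, e]
  simp only [product_apply, e₀₁, e₁₂, e₀₂, e₀₃, e₀₄, e₁₃, map_smul, map_zero] at *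
  have hα' : α + 1 ≠ 0 := fun h => hα (by linear_combination h)
  have h₅ : φ (e 5) ≠ 0 := by simp [map_eq_zero_iff φ φ.injective, e]
  rw [h₁₂, h₀₁] at h₀₄
  rw [h₀₂, h₀₁] at h₀₃ h₁₃
  generalize φ (e 0) = x at *
  generalize φ (e 1) = y at *
  generalize φ (e 5) = z at *
  -- Here (α + 1) • z = x(y(xy)) is a fourfold product, whose first five coordinates vanish; so z 5
  -- = 0 would give z = 0.
  have hz : z 5 ≠ 0 := by
    intro hz
    refine h₅ (smul_right_injective _ hα' ?_)
    dsimp only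
    rw [h₀₄]
    have h₆ := congrFun h₀₄ 5
    rw [Pi.smul_apply, hz, smul_zero] at h₆
    ext k
    fin_cases k
    iterate 5 simp [Name.coords]
    simpa using h₆.symm
  have k₀₃ := congrFun h₀₃ 5
  have k₀₄ := congrFun h₀₄ 5
  have k₁₃ := congrFun h₁₃ 5
  clear * - hα' hz k₀₃ k₀₄ k₁₃
  simp only [Name.coords, Matrix.cons_val, Pi.smul_apply, smul_eq_mul, Pi.zero_apply] at *
  have r₀₃ : (x 0 * y 1 - x 1 * y 0) * (x 0 * x 1 * (2 * β + 1)) = 0 := by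
    linear_combination -k₀₃
  have r₀₄ : (α + 1) * z 5 =
      (x 0 * y 1 - x 1 * y 0) * (x 0 * y 1 * (β + 1) + x 1 * y 0 * β) := by
    linear_combination k₀₄
  have r₁₃ : α * z 5 = (x 0 * y 1 - x 1 * y 0) * (x 1 * y 0 * (β + 1) + x 0 * y 1 * β) := by
    linear_combination k₁₃
  -- The antisymmetric part of the form is normalized to 1 on both sides, so the difference of the
  -- two relations contains neither α nor β.
  have rz : z 5 = (x 0 * y 1 - x 1 * y 0) * (x 0 * y 1 - x 1 * y 0) := by
    linear_combination r₀₄ - r₁₃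
  have hD : x 0 * y 1 - x 1 * y 0 ≠ 0 := by
    intro hD
    exact hz (by rw [rz, hD, zero_mul])
  rw [rz, mul_left_comm] at r₁₃
  have r := mul_left_cancel₀ hD r₁₃
  have r₃ := (mul_eq_zero.mp r₀₃).resolve_left hD
  by_cases hβ : 2 * β + 1 = 0
  · left
    refine mul_right_cancel₀ hD ?_
    linear_combination -r - x 1 * y 0 * hβ
  · have s₃ := (mul_eq_zero.mp r₃).resolve_right hβ
    rcases mul_eq_zero.mp s₃ with h0 | h0 <;> simp only [h0, zero_mul, zero_sub,
      sub_zero, zero_add, add_zero, neg_ne_zero] at r hD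
    · right
      refine mul_right_cancel₀ hD ?_
      linear_combination -r
    · left
      refine mul_right_cancel₀ hD ?_
      linear_combination -r

/-- The relation (e 0)(e 3) = (e 1)(e 2), carried over to the images x, y, forces y 0 = 0 and y 1 =
(x 0)². The isomorphism then acts on the two coefficients α + 1 and α by the same factor, and their
difference is 1 on both sides. -/
theorem isomorphic_T18_T18 {α β : ℂ} (hα : α ≠ -1)
    (h : Isomorphic (Name.T18 α).product (Name.T18 β).product) : β = α := by
  obtain ⟨φ, h⟩ := h
  have h₀₁ := h (e 0) (e 1)
  have h₁₂ := h (e 1) (e 2)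
  have h₀₂ := h (e 0) (e 2)
  have h₀₃ := h (e 0) (e 3)
  have h₀₄ := h (e 0) (e 4)
  have h₁₃ := h (e 1) (e 3)
  have e₀₁ : (Name.T18 α).coords (e 0) (e 1) = e 2 := by
    ext k; fin_cases k <;> simp [Name.coords, e]
  have e₁₂ : (Name.T18 α).coords (e 1) (e 2) = e 4 := by
    ext k; fin_cases k <;> simp [Name.coords, e]
  have e₀₂ : (Name.T18 α).coords (e 0) (e 2) = e 3 := by
    ext k; fin_cases k <;> simp [Name.coords, e]
  have e₀₃ : (Name.T18 α).coords (e 0) (e 3) = e 4 := by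
    ext k; fin_cases k <;> simp [Name.coords, e]
  have e₀₄ : (Name.T18 α).coords (e 0) (e 4) = (α + 1) • e 5 := by
    ext k; fin_cases k <;> simp [Name.coords, e]
  have e₁₃ : (Name.T18 α).coords (e 1) (e 3) = α • e 5 := by
    ext k; fin_cases k <;> simp [Name.coords, e]
  simp only [product_apply, e₀₁, e₁₂, e₀₂, e₀₃, e₀₄, e₁₃, map_smul] at *
  have hα' : α + 1 ≠ 0 := fun h => hα (by linear_combination h)
  have h₅ : φ (e 5) ≠ 0 := by simp [map_eq_zero_iff φ φ.injective, e]
  rw [h₀₃, h₀₂, h₀₁] at h₀₄ h₁₂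
  rw [h₀₂, h₀₁] at h₁₃
  generalize φ (e 0) = x at *
  generalize φ (e 1) = y at *
  generalize φ (e 5) = z at *
  have hz : z 5 ≠ 0 := by
    intro hz
    refine h₅ (smul_right_injective _ hα' ?_)
    dsimp only
    rw [h₀₄]
    have h₆ := congrFun h₀₄ 5
    rw [Pi.smul_apply, hz, smul_zero] at h₆
    ext k
    fin_cases k
    iterate 5 simp [Name.coords]
    simpa using h₆.symm
  have k₀₄ := congrFun h₀₄ 5
  have k₁₃ := congrFun h₁₃ 5
  have l₁₂ := congrFun h₁₂ 3
  have k₁₂ := congrFun h₁₂ 4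
  clear * - hα' hz k₀₄ k₁₃ l₁₂ k₁₂
  simp only [Name.coords, Matrix.cons_val, Pi.smul_apply, smul_eq_mul] at *
  have r₀₄ : (α + 1) * z 5 = (x 0 * y 1 - x 1 * y 0) * (x 0 ^ 3 * (β + 1)) := by
    linear_combination k₀₄
  have hD : x 0 * y 1 - x 1 * y 0 ≠ 0 := by
    intro hD
    rw [hD, zero_mul] at r₀₄
    exact (mul_ne_zero hα' hz) r₀₄
  have hy : y 0 = 0 := by
    refine (mul_eq_zero.mp ?_).resolve_left hD
    linear_combination -l₁₂
  simp only [hy, mul_zero, zero_mul, sub_zero, zero_add, add_zero] at *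
  have hy' : y 1 = x 0 ^ 2 := by
    refine mul_right_cancel₀ hD ?_
    linear_combination -k₁₂
  have r₁₃ : α * z 5 = x 0 * y 1 * (x 0 ^ 3 * β) := by
    rw [k₁₃, hy']
    ring
  refine mul_right_cancel₀ hz ?_
  linear_combination -r₁₃ - β * (r₁₃ - r₀₄)

/-- The quadruples of codimensions are pairwise distinct for distinct names, except that `T08` and
`T09` both have (3, 2, 2, 2). -/
theorem isomorphic_product_iff (N N' : Name) (hN : N.Nondegenerate) (hN' : N'.Nondegenerate) :
    Isomorphic N.product N'.product ↔ N = N' ∨ ∃ α : ℂ, N = .T09 α ∧ N' = .T09 (-α - 1) := by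
  constructor
  · intro h
    have h' := h
    obtain ⟨φ, hφ⟩ := h'
    have h₁ : N.secondCentre.card = N'.secondCentre.card :=
      HasCodim.eq ⟨_, rfl, isSecondCentral_iff N hN⟩ ⟨_, rfl, isSecondCentral_iff N' hN'⟩ φ
        (isSecondCentral_equiv φ hφ)
    have h₂ : N.malcevCentre.card = N'.malcevCentre.card :=
      HasCodim.eq ⟨_, rfl, isMalcevCentral_iff N hN⟩ ⟨_, rfl, isMalcevCentral_iff N' hN'⟩ φ
        (isMalcevCentral_equiv φ hφ)
    have h₃ : N.annSquareToCentre.card = N'.annSquareToCentre.card :=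
      HasCodim.eq ⟨_, rfl, annihilates_sendsSquareToCentre_iff N hN⟩
        ⟨_, rfl, annihilates_sendsSquareToCentre_iff N' hN'⟩ φ
        (annihilates_equiv φ hφ (sendsSquareToCentre_equiv φ hφ))
    have h₄ : N.annAnnCube.card = N'.annAnnCube.card :=
      HasCodim.eq ⟨_, rfl, annihilates_killsCube_iff N hN⟩ ⟨_, rfl, annihilates_killsCube_iff N' hN'⟩
        φ (annihilates_equiv φ hφ (killsCube_equiv φ hφ))
    have hsymm : Isomorphic N'.product N.product := by
      refine ⟨φ.symm, fun x y => φ.injective ?_⟩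
      simp [hφ]
    clear hφ
    cases N <;> cases N' <;> first
      | exact Or.inl rfl
      | exact absurd h₁ (by decide)
      | exact absurd h₂ (by decide)
      | exact absurd h₃ (by decide)
      | exact absurd h₄ (by decide)
      -- With a free parameter in the name, the set of indices has to be unfolded before `decide`
      -- applies.
      | exact absurd h₁ (by simp only [Name.secondCentre]; decide)
      | exact absurd h₂ (by simp only [Name.malcevCentre]; decide)
      | exact absurd h₃ (by simp only [Name.annSquareToCentre]; decide)
      | skip
    case T08.T09 α => exact absurd h (not_isomorphic_T08_T09 α)
    case T09.T08 α => exact absurd hsymm (not_isomorphic_T08_T09 α)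
    case T09.T09 α β =>
      rcases isomorphic_T09_T09 hN.2 h with rfl | rfl
      · exact Or.inl rfl
      · exact Or.inr ⟨α, rfl, rfl⟩
    case T18.T18 α β => exact Or.inl (by rw [isomorphic_T18_T18 hN h])
  · rintro (rfl | ⟨α, rfl, rfl⟩)
    · exact Isomorphic.refl _
    · exact isomorphic_T09_neg α

end Tortkara

/-! ### The lower central series and products within the square. -/

namespace Tortkara

variable {V : Type*} [AddCommGroup V] [Module ℂ V]

/-- The lower central series, starting with the whole algebra in degree `0`. -/
def lcs (μ : Product V) : ℕ → Submodule ℂ V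
  | 0 => ⊤
  | n + 1 => Submodule.map₂ μ ⊤ (lcs μ n)

theorem mul_mem_lcs (μ : Product V) {n : ℕ} (a : V) {x : V} (hx : x ∈ lcs μ n) :
    μ a x ∈ lcs μ (n + 1) :=
  Submodule.apply_mem_map₂ _ Submodule.mem_top hx

theorem lcs_succ_le (μ : Product V) (n : ℕ) : lcs μ (n + 1) ≤ lcs μ n := by
  induction n with
  | zero => exact le_top
  | succ n ih => exact Submodule.map₂_le_map₂_right ih

theorem mul_mem_lcs_one (μ : Product V) (a b : V) : μ a b ∈ lcs μ 1 :=
  mul_mem_lcs μ a (Submodule.mem_top (x := b))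

theorem lcs_succ_le_iff (μ : Product V) {n : ℕ} {S : Submodule ℂ V} :
    lcs μ (n + 1) ≤ S ↔ ∀ a, ∀ b ∈ lcs μ n, μ a b ∈ S := by
  simp [lcs, Submodule.map₂_le]

/-- Right-normed products suffice to span the series, so nilpotency for arbitrary bracketings forces
some term to vanish. -/
theorem lcs_le_span (μ : Product V) (n : ℕ) :
    lcs μ n ≤ Submodule.span ℂ {v | IsProductOf μ (n + 1) v} := by
  induction n with
  | zero => exact fun v _ => Submodule.subset_span (IsProductOf.single v)
  | succ n ih =>
    rw [lcs_succ_le_iff]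
    intro a b hb
    refine Submodule.span_induction (p := fun b _ => μ a b ∈ _) ?_ ?_ ?_ ?_ (ih hb)
    · intro v hv
      rw [add_comm (n + 1) 1]
      exact Submodule.subset_span (IsProductOf.mul (IsProductOf.single a) hv)
    · simp
    · intro v w _ _ hv hw
      rw [map_add]
      exact add_mem hv hw
    · intro c v _ hv
      rw [map_smul]
      exact Submodule.smul_mem _ c hv

theorem IsNilpotent.exists_lcs_eq_bot {μ : Product V} (h : IsNilpotent μ) : ∃ n, lcs μ n = ⊥ := by
  obtain ⟨n, hn, h⟩ := h
  obtain ⟨m, rfl⟩ := Nat.exists_eq_add_of_le' hn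
  refine ⟨m, eq_bot_iff.mpr ((lcs_le_span μ m).trans (Submodule.span_le.mpr fun v hv => ?_))⟩
  exact h v hv

/-- A series that stops descending stays constant, while by nilpotency it reaches zero. -/
theorem lcs_eq_bot_of_le {μ : Product V} (h : IsNilpotent μ) {n : ℕ}
    (hn : lcs μ n ≤ lcs μ (n + 1)) : lcs μ n = ⊥ := by
  have hle : ∀ k, lcs μ n ≤ lcs μ (n + k) := by
    intro k
    induction k with
    | zero => exact le_rfl
    | succ k ih => exact hn.trans (Submodule.map₂_le_map₂_right ih)
  have hanti : Antitone (lcs μ) := antitone_nat_of_succ_le (lcs_succ_le μ)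
  obtain ⟨m, hm⟩ := h.exists_lcs_eq_bot
  exact eq_bot_iff.mpr ((hle m).trans ((hanti (Nat.le_add_left m n)).trans hm.le))

theorem finrank_lcs_succ_lt [FiniteDimensional ℂ V] {μ : Product V} (h : IsNilpotent μ) {n : ℕ}
    (hn : lcs μ n ≠ ⊥) : Module.finrank ℂ (lcs μ (n + 1)) < Module.finrank ℂ (lcs μ n) := by
  refine Submodule.finrank_lt_finrank_of_lt (lt_of_le_not_ge (lcs_succ_le μ n) fun h' => ?_)
  exact hn (lcs_eq_bot_of_le h h')

section Tortkara

variable {μ : Product V}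

theorem mul_mem_lcs' (hμ : IsAnticommutative μ) {n : ℕ} {x : V} (hx : x ∈ lcs μ n) (a : V) :
    μ x a ∈ lcs μ (n + 1) := by
  rw [hμ]
  exact neg_mem (mul_mem_lcs μ a hx)

theorem IsTortkara.linearized (h : IsTortkara μ) (a b b' c : V) :
    μ (μ a b) (μ c b') + μ (μ a b') (μ c b) =
      μ (jacobian μ a b c) b' + μ (jacobian μ a b' c) b := by
  have h₁ := h.2 a (b + b') c
  have h₂ := h.2 a b c
  have h₃ := h.2 a b' c
  simp only [jacobian, map_add, LinearMap.add_apply] at *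
  linear_combination (norm := module) h₁ - h₂ - h₃

end Tortkara

/-- A subspace of codimension at most one and a vector outside of it span the whole space. -/
theorem exists_sub_smul_mem [FiniteDimensional ℂ V] {M M' : Submodule ℂ V} (hle : M' ≤ M)
    (hfin : Module.finrank ℂ M ≤ Module.finrank ℂ M' + 1) {w : V} (hw : w ∈ M) (hw' : w ∉ M')
    {a : V} (ha : a ∈ M) : ∃ c : ℂ, a - c • w ∈ M' := by
  have h₁ : M' < Submodule.span ℂ {w} ⊔ M' := by
    refine lt_of_le_of_ne le_sup_right fun h => hw' ?_
    rw [h]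
    exact Submodule.mem_sup_left (Submodule.mem_span_singleton_self w)
  have h₂ : Submodule.span ℂ {w} ⊔ M' ≤ M :=
    sup_le ((Submodule.span_singleton_le_iff_mem w M).mpr hw) hle
  have h₃ := Submodule.finrank_lt_finrank_of_lt h₁
  have h₄ := Submodule.eq_of_le_of_finrank_le h₂ (by omega)
  rw [← h₄] at ha
  obtain ⟨b, hb, l, hl, rfl⟩ := Submodule.mem_sup.mp ha
  obtain ⟨c, rfl⟩ := Submodule.mem_span_singleton.mp hb
  exact ⟨c, by simpa using hl⟩

/-- The vectors `x`, `y`, `t` generate the algebra modulo its square. -/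
def Generate (μ : Product V) (x y t : V) : Prop :=
  ∀ a, ∃ α β γ : ℂ, a - (α • x + β • y + γ • t) ∈ lcs μ 1

theorem exists_finrank_le_span_sup [FiniteDimensional ℂ V] (M : Submodule ℂ V) :
    ∃ v : V, min (Module.finrank ℂ V) (Module.finrank ℂ M + 1) ≤
      Module.finrank ℂ (Submodule.span ℂ {v} ⊔ M : Submodule ℂ V) := by
  by_cases hM : M = ⊤
  · subst hM
    exact ⟨0, by rw [sup_top_eq, finrank_top]; exact min_le_left _ _⟩
  · obtain ⟨v, hv⟩ : ∃ v, v ∉ M := by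
      by_contra! h
      exact hM (eq_top_iff.mpr fun v _ => h v)
    refine ⟨v, (min_le_right _ _).trans (Submodule.finrank_lt_finrank_of_lt ?_)⟩
    refine lt_of_le_of_ne le_sup_right fun h => hv ?_
    rw [h]
    exact Submodule.mem_sup_left (Submodule.mem_span_singleton_self v)

theorem exists_generate_of_sup [FiniteDimensional ℂ V] (μ : Product V) (t : V)
    (h : Module.finrank ℂ V ≤
      Module.finrank ℂ (Submodule.span ℂ {t} ⊔ lcs μ 1 : Submodule ℂ V) + 2) :
    ∃ x y, Generate μ x y t := by
  obtain ⟨y, hy⟩ := exists_finrank_le_span_sup (Submodule.span ℂ {t} ⊔ lcs μ 1)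
  obtain ⟨x, hx⟩ :=
    exists_finrank_le_span_sup (Submodule.span ℂ {y} ⊔ (Submodule.span ℂ {t} ⊔ lcs μ 1))
  have htop := Submodule.eq_top_of_finrank_eq (le_antisymm (Submodule.finrank_le
    (Submodule.span ℂ {x} ⊔ (Submodule.span ℂ {y} ⊔ (Submodule.span ℂ {t} ⊔ lcs μ 1)))) (by omega))
  refine ⟨x, y, fun a => ?_⟩
  have ha : a ∈ (⊤ : Submodule ℂ V) := trivial
  rw [← htop] at ha
  obtain ⟨_, h₁, a₁, ha₁, rfl⟩ := Submodule.mem_sup.mp ha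
  obtain ⟨_, h₂, a₂, ha₂, rfl⟩ := Submodule.mem_sup.mp ha₁
  obtain ⟨_, h₃, a₃, ha₃, rfl⟩ := Submodule.mem_sup.mp ha₂
  obtain ⟨α, rfl⟩ := Submodule.mem_span_singleton.mp h₁
  obtain ⟨β, rfl⟩ := Submodule.mem_span_singleton.mp h₂
  obtain ⟨γ, rfl⟩ := Submodule.mem_span_singleton.mp h₃
  refine ⟨α, β, γ, ?_⟩
  convert ha₃ using 1
  module

theorem exists_generate_three [FiniteDimensional ℂ V] (μ : Product V)
    (h : Module.finrank ℂ V ≤ Module.finrank ℂ (lcs μ 1) + 3) : ∃ x y t, Generate μ x y t := by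
  obtain ⟨t, ht⟩ := exists_finrank_le_span_sup (lcs μ 1)
  obtain ⟨x, y, hxy⟩ := exists_generate_of_sup μ t (by omega)
  exact ⟨x, y, t, hxy⟩

theorem exists_generate_two [FiniteDimensional ℂ V] (μ : Product V)
    (h : Module.finrank ℂ V ≤ Module.finrank ℂ (lcs μ 1) + 2) : ∃ x y, Generate μ x y 0 :=
  exists_generate_of_sup μ 0 (by rwa [Submodule.span_zero_singleton, bot_sup_eq])

section Generators

variable {μ : Product V} {x y t : V}

/-- Expand ab bilinearly in generators: the remainders contribute to `lcs μ 2`, and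
anticommutativity leaves three products of generators. -/
theorem Generate.lcs_one_le (hG : Generate μ x y t) (hμ : IsAnticommutative μ) {S : Submodule ℂ V}
    (hS : lcs μ 2 ≤ S) (hxy : μ x y ∈ S) (hxt : μ x t ∈ S) (hyt : μ y t ∈ S) : lcs μ 1 ≤ S := by
  rw [lcs_succ_le_iff]
  intro a b _
  obtain ⟨α, β, γ, ha⟩ := hG a
  obtain ⟨α', β', γ', hb⟩ := hG b
  have h₁ := hS (mul_mem_lcs μ a hb)
  have h₂ := hS (mul_mem_lcs' hμ ha (α' • x + β' • y + γ' • t))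
  have h₃ : μ a b = μ a (b - (α' • x + β' • y + γ' • t)) +
      μ (a - (α • x + β • y + γ • t)) (α' • x + β' • y + γ' • t) + (α * β' - β * α') • μ x y +
      (α * γ' - γ * α') • μ x t + (β * γ' - γ * β') • μ y t := by
    simp only [map_add, map_sub, map_smul, LinearMap.add_apply, LinearMap.sub_apply,
      LinearMap.smul_apply, hμ.mul_self, hμ y x, hμ t x, hμ t y]
    module
  rw [h₃]
  exact add_mem (add_mem (add_mem (add_mem h₁ h₂) (S.smul_mem _ hxy)) (S.smul_mem _ hxt))
    (S.smul_mem _ hyt)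

/-- To bound a term of the lower central series, it suffices to multiply by generators. -/
theorem Generate.lcs_le (hG : Generate μ x y t) {n : ℕ} {S : Submodule ℂ V}
    (h₁ : ∀ b ∈ lcs μ n, ∀ l ∈ lcs μ 1, μ l b ∈ S) (hx : ∀ b ∈ lcs μ n, μ x b ∈ S)
    (hy : ∀ b ∈ lcs μ n, μ y b ∈ S) (ht : ∀ b ∈ lcs μ n, μ t b ∈ S) : lcs μ (n + 1) ≤ S := by
  rw [lcs_succ_le_iff]
  intro a b hb
  obtain ⟨α, β, γ, ha⟩ := hG a
  have h := h₁ b hb _ ha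
  have h₃ : μ a b = μ (a - (α • x + β • y + γ • t)) b + α • μ x b + β • μ y b + γ • μ t b := by
    simp only [map_add, map_sub, map_smul, LinearMap.add_apply, LinearMap.sub_apply,
      LinearMap.smul_apply]
    module
  rw [h₃]
  exact add_mem (add_mem (add_mem h (S.smul_mem _ (hx b hb))) (S.smul_mem _ (hy b hb)))
    (S.smul_mem _ (ht b hb))

theorem jacobian_mem (hμ : IsAnticommutative μ) (a b c : V) : jacobian μ a b c ∈ lcs μ 2 :=
  add_mem (add_mem (mul_mem_lcs' hμ (mul_mem_lcs_one μ _ _) _)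
    (mul_mem_lcs' hμ (mul_mem_lcs_one μ _ _) _)) (mul_mem_lcs' hμ (mul_mem_lcs_one μ _ _) _)

theorem jacobian_swap (hμ : IsAnticommutative μ) (a b c : V) :
    jacobian μ b a c = -jacobian μ a b c := by
  simp only [jacobian, hμ b a, hμ a c, hμ c b, map_neg, LinearMap.neg_apply]
  abel

theorem jacobian_rotate (a b c : V) : jacobian μ b c a = jacobian μ a b c := by
  simp only [jacobian]
  abel

theorem mul_mul_eq (hT : IsTortkara μ) (a b c : V) :
    μ (μ a b) (μ a c) = -μ (jacobian μ a b c) a := by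
  rw [hT.1 a b, hT.1 a c, map_neg, map_neg, LinearMap.neg_apply, neg_neg, hT.2 b a c,
    jacobian_swap hT.1, map_neg, LinearMap.neg_apply]

/-- Among three letters any two of xy, xt, yt share one, so `mul_mul_eq` writes their product as a
Jacobian, which is in `lcs μ 2`, times a generator. -/
theorem Generate.mul_mem_three (hT : IsTortkara μ) (hG : Generate μ x y t) {a b : V}
    (ha : a ∈ lcs μ 1) (hb : b ∈ lcs μ 1) : μ a b ∈ lcs μ 3 := by
  have key : ∀ a b c, μ (μ a b) (μ a c) ∈ lcs μ 3 := by
    intro a b c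
    rw [mul_mul_eq hT]
    exact neg_mem (mul_mem_lcs' hT.1 (jacobian_mem hT.1 _ _ _) _)
  have key' : ∀ a b c, μ (μ a b) (μ b c) ∈ lcs μ 3 := by
    intro a b c
    rw [hT.1 a b, map_neg, LinearMap.neg_apply]
    exact neg_mem (key _ _ _)
  have key'' : ∀ a b c, μ (μ a b) (μ c b) ∈ lcs μ 3 := by
    intro a b c
    rw [hT.1 c b, map_neg]
    exact neg_mem (key' _ _ _)
  have h₁ : ∀ u, μ u (μ x y) ∈ lcs μ 3 → μ u (μ x t) ∈ lcs μ 3 →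
      μ u (μ y t) ∈ lcs μ 3 → μ u b ∈ lcs μ 3 := fun u h₁ h₂ h₃ =>
    hG.lcs_one_le hT.1 (S := (lcs μ 3).comap (μ u)) (fun l hl => mul_mem_lcs μ _ hl) h₁ h₂ h₃ hb
  exact hG.lcs_one_le hT.1 (S := (lcs μ 3).comap (μ.flip b)) (fun l hl => mul_mem_lcs' hT.1 hl _)
    (h₁ _ (key _ _ _) (key _ _ _) (key' _ _ _)) (h₁ _ (key _ _ _) (key _ _ _) (key'' _ _ _))
    (h₁ _ (by rw [hT.1]; exact neg_mem (key' _ _ _)) (key'' _ _ _) (key _ _ _)) ha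

/-- Generators `x`, `y`, `t` such that the square is generated by `xy` modulo the cube. -/
structure Adapted (μ : Product V) (x y t : V) : Prop where
  tortkara : IsTortkara μ
  generate : Generate μ x y t
  xt_mem : μ x t ∈ lcs μ 2
  yt_mem : μ y t ∈ lcs μ 2

namespace Adapted

theorem exists_sub_smul_mem (h : Adapted μ x y t) {a : V} (ha : a ∈ lcs μ 1) :
    ∃ c : ℂ, a - c • μ x y ∈ lcs μ 2 := by
  have h₁ := h.generate.lcs_one_le h.tortkara.1 (S := Submodule.span ℂ {μ x y} ⊔ lcs μ 2)
    le_sup_right (Submodule.mem_sup_left (Submodule.mem_span_singleton_self _))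
    (Submodule.mem_sup_right h.xt_mem) (Submodule.mem_sup_right h.yt_mem) ha
  obtain ⟨b, hb, l, hl, rfl⟩ := Submodule.mem_sup.mp h₁
  obtain ⟨c, rfl⟩ := Submodule.mem_span_singleton.mp hb
  exact ⟨c, by simpa using hl⟩

theorem jacobian_mem_three (h : Adapted μ x y t) (a b : V) {q : V} (hq : q ∈ lcs μ 1) :
    jacobian μ a b q ∈ lcs μ 3 :=
  add_mem (add_mem (h.generate.mul_mem_three h.tortkara (mul_mem_lcs_one μ _ _) hq)
    (mul_mem_lcs' h.tortkara.1 (mul_mem_lcs μ _ hq) _))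
    (mul_mem_lcs' h.tortkara.1 (mul_mem_lcs' h.tortkara.1 hq _) _)

/-- Modulo deeper terms both factors are of the form gz with z = xy, and (gz)(g'z) = J(g,z,g')z,
where the Jacobian has an argument in the square and so lies in `lcs μ 3`. -/
theorem two_mul_two (h : Adapted μ x y t) {a b : V} (ha : a ∈ lcs μ 2) (hb : b ∈ lcs μ 2) :
    μ a b ∈ lcs μ 4 := by
  refine (lcs_succ_le_iff μ (S := (lcs μ 4).comap (μ.flip b))).mpr (fun g p hp => ?_) ha
  refine (lcs_succ_le_iff μ (S := (lcs μ 4).comap (μ (μ g p)))).mpr (fun g' p' hp' => ?_) hb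
  obtain ⟨c, hc⟩ := h.exists_sub_smul_mem hp
  obtain ⟨c', hc'⟩ := h.exists_sub_smul_mem hp'
  have h₁ : μ (μ g p) (μ g' p') = μ (μ g (p - c • μ x y)) (μ g' p') +
      μ (μ g (c • μ x y)) (μ g' (p' - c' • μ x y)) +
      (c * c') • μ (μ g (μ x y)) (μ g' (μ x y)) := by
    simp only [map_sub, map_smul, LinearMap.sub_apply, LinearMap.smul_apply]
    module
  rw [Submodule.mem_comap, h₁, h.tortkara.2]
  refine add_mem (add_mem ?_ ?_) (Submodule.smul_mem _ _ ?_)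
  · exact mul_mem_lcs' h.tortkara.1 (mul_mem_lcs μ _ hc) _
  · exact mul_mem_lcs μ _ (mul_mem_lcs μ _ hc')
  · refine mul_mem_lcs' h.tortkara.1 ?_ _
    rw [← jacobian_rotate]
    rw [← jacobian_rotate]
    exact h.jacobian_mem_three _ _ (mul_mem_lcs_one μ _ _)

/-- It suffices to treat z(gz) for the generators g. As z = xy shares a letter with xz and with yz,
the identity applies directly for g = x, y. For g = t the linearized identity leaves the error
(xt)(zy), covered by `two_mul_two` because xt is in `lcs μ 2`. -/
theorem one_mul_two (h : Adapted μ x y t) {a b : V} (ha : a ∈ lcs μ 1) (hb : b ∈ lcs μ 2) :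
    μ a b ∈ lcs μ 4 := by
  have hμ := h.tortkara.1
  have hz := mul_mem_lcs_one μ x y
  have hxz : μ (μ x y) (μ x (μ x y)) ∈ lcs μ 4 := by
    rw [mul_mul_eq h.tortkara]
    exact neg_mem (mul_mem_lcs' hμ (h.jacobian_mem_three _ _ hz) _)
  have hyz : μ (μ x y) (μ y (μ x y)) ∈ lcs μ 4 := by
    rw [hμ y, map_neg, h.tortkara.2]
    exact neg_mem (mul_mem_lcs' hμ (h.jacobian_mem_three _ _ hz) _)
  have htz : μ (μ x y) (μ t (μ x y)) ∈ lcs μ 4 := by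
    have h₁ := h.tortkara.linearized x y t (μ x y)
    rw [hμ t, map_neg, eq_sub_of_add_eq h₁]
    refine neg_mem (sub_mem (add_mem ?_ ?_) ?_)
    · exact mul_mem_lcs' hμ (h.jacobian_mem_three _ _ hz) _
    · exact mul_mem_lcs' hμ (h.jacobian_mem_three _ _ hz) _
    · exact h.two_mul_two h.xt_mem (mul_mem_lcs' hμ hz _)
  have hzb : μ (μ x y) b ∈ lcs μ 4 := by
    refine (lcs_succ_le_iff μ (S := (lcs μ 4).comap (μ (μ x y)))).mpr (fun g p hp => ?_) hb
    obtain ⟨c, hc⟩ := h.exists_sub_smul_mem hp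
    obtain ⟨α, β, γ, hg⟩ := h.generate g
    have h₁ : μ g p = μ g (p - c • μ x y) + c • (μ (g - (α • x + β • y + γ • t)) (μ x y) +
        α • μ x (μ x y) + β • μ y (μ x y) + γ • μ t (μ x y)) := by
      simp only [map_add, map_sub, map_smul, LinearMap.add_apply, LinearMap.sub_apply,
        LinearMap.smul_apply]
      module
    rw [h₁]
    refine add_mem (mul_mem_lcs μ _ (mul_mem_lcs μ _ hc)) (Submodule.smul_mem _ _
      (add_mem (add_mem (add_mem ?_ (Submodule.smul_mem _ _ hxz)) (Submodule.smul_mem _ _ hyz))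
        (Submodule.smul_mem _ _ htz)))
    exact mul_mem_lcs μ _ (h.generate.mul_mem_three h.tortkara hg hz)
  obtain ⟨c, hc⟩ := h.exists_sub_smul_mem ha
  have h₁ : μ a b = μ (a - c • μ x y) b + c • μ (μ x y) b := by
    simp only [map_sub, map_smul, LinearMap.sub_apply, LinearMap.smul_apply]
    module
  rw [h₁]
  exact add_mem (h.two_mul_two hc hb) (Submodule.smul_mem _ _ hzb)

theorem one_mul_one (h : Adapted μ x y t) {a b : V} (ha : a ∈ lcs μ 1) (hb : b ∈ lcs μ 1) :
    μ a b ∈ lcs μ 4 := by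
  obtain ⟨c, hc⟩ := h.exists_sub_smul_mem ha
  obtain ⟨c', hc'⟩ := h.exists_sub_smul_mem hb
  have h₁ : μ a b = μ a (b - c' • μ x y) + c' • -μ (μ x y) (a - c • μ x y) := by
    simp only [map_sub, map_smul, h.tortkara.1.mul_self, h.tortkara.1 (μ x y) a]
    module
  rw [h₁]
  exact add_mem (h.one_mul_two ha hc') (Submodule.smul_mem _ _
    (neg_mem (h.one_mul_two (mul_mem_lcs_one μ _ _) hc)))

end Adapted

/-- The first hypothesis gives J(a,b,c)a = -(ab)(ac) = 0 and removes (ab)(ac) from J(a,b,ac); what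
remains there is the commutator of left multiplications by a and b, applied to ac. -/
theorem isMalcev_of_mul_comm (hT : IsTortkara μ)
    (h₁ : ∀ a ∈ lcs μ 1, ∀ b ∈ lcs μ 1, μ a b = 0)
    (h₂ : ∀ q ∈ lcs μ 1, ∀ a b, μ a (μ b q) = μ b (μ a q)) : IsMalcev μ := by
  refine ⟨hT.1, fun a b c => ?_⟩
  have h₃ := mul_mul_eq hT a b c
  rw [h₁ _ (mul_mem_lcs_one μ _ _) _ (mul_mem_lcs_one μ _ _), zero_eq_neg] at h₃
  rw [h₃, jacobian, h₁ _ (mul_mem_lcs_one μ _ _) _ (mul_mem_lcs_one μ _ _), hT.1 _ a,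
    h₂ _ (mul_mem_lcs_one μ _ _), hT.1 _ b, hT.1 _ a]
  simp

theorem lcs_three_ne_bot (hV : Module.finrank ℂ V = 6) (hT : IsTortkara μ) (hN : IsNilpotent μ)
    (hM : ¬ IsMalcev μ) : lcs μ 3 ≠ ⊥ := by
  intro h₃
  have : FiniteDimensional ℂ V := Module.finite_of_finrank_eq_succ hV
  have hzero : ∀ a ∈ lcs μ 1, ∀ b ∈ lcs μ 1, μ a b ∈ lcs μ 3 := by
    intro a ha b hb
    by_cases h₁ : 3 ≤ Module.finrank ℂ (lcs μ 1)
    · obtain ⟨x, y, t, hG⟩ := exists_generate_three μ (by omega)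
      exact hG.mul_mem_three hT ha hb
    by_cases h₂ : lcs μ 2 = ⊥
    · have := mul_mem_lcs μ a hb
      rw [h₂, Submodule.mem_bot] at this
      rw [this]
      exact zero_mem _
    have h₄ := finrank_lcs_succ_lt hN h₂
    have h₅ : lcs μ 1 ≠ ⊥ := fun h => h₂ (eq_bot_iff.mpr ((lcs_succ_le μ 1).trans h.le))
    have h₆ : ∃ w ∈ lcs μ 1, w ∉ lcs μ 2 := by
      by_contra! h
      exact h₅ (lcs_eq_bot_of_le hN h)
    obtain ⟨w, hw, hw'⟩ := h₆
    obtain ⟨c, hc⟩ := exists_sub_smul_mem (M' := lcs μ 2) (lcs_succ_le μ 1) (by omega) hw hw' ha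
    obtain ⟨c', hc'⟩ := exists_sub_smul_mem (M' := lcs μ 2) (lcs_succ_le μ 1) (by omega) hw hw' hb
    have h₇ : μ a b = μ a (b - c' • w) + c' • μ (a - c • w) w := by
      simp only [map_sub, map_smul, LinearMap.sub_apply, LinearMap.smul_apply, hT.1.mul_self]
      module
    rw [h₇]
    exact add_mem (mul_mem_lcs μ _ hc') (Submodule.smul_mem _ _ (mul_mem_lcs' hT.1 hc _))
  refine hM (isMalcev_of_mul_comm hT (fun a ha b hb => ?_) fun q hq a b => ?_)
  · have := hzero a ha b hb
    rwa [h₃, Submodule.mem_bot] at this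
  · have h₁ := mul_mem_lcs μ a (mul_mem_lcs μ b hq)
    have h₂ := mul_mem_lcs μ b (mul_mem_lcs μ a hq)
    rw [h₃, Submodule.mem_bot] at h₁ h₂
    rw [h₁, h₂]

end Generators

end Tortkara

/-! ### Three generators: reduction of the multiplication table. -/

namespace Tortkara

variable {V : Type*} [AddCommGroup V] [Module ℂ V]

/-- The multiplication table of an algebra with three generators `x`, `y`, `t`, whose lower central
series has the factors `⟨x, y, t⟩`, `⟨z⟩`, `⟨w⟩`, `⟨u⟩`. -/
structure FrameThree (μ : Product V) (x y t z w u : V) (p q a b c d k l m : ℂ) : Prop where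
  anti : IsAnticommutative μ
  span : ∀ S : Submodule ℂ V, x ∈ S → y ∈ S → t ∈ S → z ∈ S → w ∈ S → u ∈ S → S = ⊤
  products : μ x y = z ∧ μ x t = a • w + b • u ∧ μ x z = w ∧ μ x w = k • u ∧ μ x u = 0 ∧
    μ y t = c • w + d • u ∧ μ y z = p • u ∧ μ y w = l • u ∧ μ y u = 0 ∧
    μ t z = q • u ∧ μ t w = m • u ∧ μ t u = 0 ∧ μ z w = 0 ∧ μ z u = 0 ∧ μ w u = 0

namespace FrameThree

variable {μ : Product V} {x y t z w u : V} {p q a b c d k l m : ℂ}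

theorem table (F : FrameThree μ x y t z w u p q a b c d k l m) :
    (μ x y = z ∧ μ x t = a • w + b • u ∧ μ x z = w ∧ μ x w = k • u ∧ μ x u = 0 ∧
    μ y t = c • w + d • u ∧ μ y z = p • u ∧ μ y w = l • u ∧ μ y u = 0 ∧
    μ t z = q • u ∧ μ t w = m • u ∧ μ t u = 0 ∧ μ z w = 0 ∧ μ z u = 0 ∧ μ w u = 0) ∧
    (μ y x = -z ∧ μ t x = -(a • w + b • u) ∧ μ z x = -w ∧ μ w x = -(k • u) ∧ μ u x = 0 ∧
    μ t y = -(c • w + d • u) ∧ μ z y = -(p • u) ∧ μ w y = -(l • u) ∧ μ u y = 0 ∧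
    μ z t = -(q • u) ∧ μ w t = -(m • u) ∧ μ u t = 0 ∧ μ w z = 0 ∧ μ u z = 0 ∧ μ u w = 0) := by
  refine ⟨F.products, ?_⟩
  rw [F.anti y x, F.anti t x, F.anti z x, F.anti w x, F.anti u x, F.anti t y, F.anti z y,
    F.anti w y, F.anti u y, F.anti z t, F.anti w t, F.anti u t, F.anti w z, F.anti u z, F.anti u w]
  simp only [F.products, neg_zero, and_self]

theorem scale (F : FrameThree μ x y t z w u p q a b c d k l m) {α β γ δ : ℂ} (hα : α ≠ 0)
    (hβ : β ≠ 0) (hγ : γ ≠ 0) (hδ : δ ≠ 0) :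
    FrameThree μ (α • x) (β • y) (γ • t) ((α * β) • z) ((α ^ 2 * β) • w) (δ • u)
      (α * β ^ 2 * p / δ) (α * β * γ * q / δ) (γ * a / (α * β)) (α * γ * b / δ) (γ * c / α ^ 2)
      (β * γ * d / δ) (α ^ 3 * β * k / δ) (α ^ 2 * β ^ 2 * l / δ) (α ^ 2 * β * γ * m / δ) where
  anti := F.anti
  span S hx hy ht hz hw hu := F.span S ((S.smul_mem_iff hα).mp hx) ((S.smul_mem_iff hβ).mp hy)
    ((S.smul_mem_iff hγ).mp ht) ((S.smul_mem_iff (by positivity)).mp hz)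
    ((S.smul_mem_iff (by positivity)).mp hw) ((S.smul_mem_iff hδ).mp hu)
  products := by
    refine ⟨?_, ?_, ?_, ?_, ?_, ?_, ?_, ?_, ?_, ?_, ?_, ?_, ?_, ?_, ?_⟩ <;>
      simp only [F.table, map_smul, LinearMap.smul_apply, smul_zero] <;> match_scalars <;> field_simp

/-- The products with `w` can be made to vanish except for `tw`. -/
theorem exists_tw (F : FrameThree μ x y t z w u p q a b c d k l 1) :
    ∃ x y t z w u p q a b c d, FrameThree μ x y t z w u p q a b c d 0 0 1 := by
  -- Since tw = u, subtracting multiples of t kills xw and yw. The new z and w are the products xy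
  -- and xz of the new generators.
  refine ⟨x - k • t, y - l • t, t, z + (k * c - l * a) • w + (k * d - l * b) • u,
    w - (k * q) • u, u, p - l * q, q + (k * c - l * a), a, b + a * k * q, c, d + c * k * q,
    F.anti, fun S hx hy ht hz hw hu => ?_, ?_⟩
  · have hw' : w ∈ S := by simpa using S.add_mem hw (S.smul_mem (k * q) hu)
    refine F.span S ?_ ?_ ht ?_ hw' hu
    · simpa using S.add_mem hx (S.smul_mem k ht)
    · simpa using S.add_mem hy (S.smul_mem l ht)
    · exact (S.add_mem_iff_left (S.smul_mem _ hw')).mp ((S.add_mem_iff_left (S.smul_mem _ hu)).mp hz)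
  · refine ⟨?_, ?_, ?_, ?_, ?_, ?_, ?_, ?_, ?_, ?_, ?_, ?_, ?_, ?_, ?_⟩ <;>
      simp only [F.table, F.anti.mul_self, map_add, map_sub, map_smul, LinearMap.add_apply,
        LinearMap.sub_apply, LinearMap.smul_apply] <;> module

/-- If only `tw` survives among the products with `w`, then most of the parameters can be made to
vanish. -/
theorem exists_reduced_tw (F : FrameThree μ x y t z w u p q a b c d 0 0 1) :
    ∃ x y t z w u p c, FrameThree μ x y t z w u p 0 0 0 c 0 0 0 1 := by
  -- The correction -q • z in y kills tz, -a • z in t kills the w-part of xt, and the multiples of w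
  -- in x and y kill the u-parts of xt and yt.
  refine ⟨x + b • w, y - q • z + (d + q ^ 2 - a * p) • w, t - a • z + (a * q) • w, z - q • w, w, u,
    p, c, F.anti, fun S hx hy ht hz hw hu => ?_, ?_⟩
  · have hz' : z ∈ S := (S.sub_mem_iff_left (S.smul_mem _ hw)).mp hz
    refine F.span S ?_ ?_ ?_ hz' hw hu
    · exact (S.add_mem_iff_left (S.smul_mem _ hw)).mp hx
    · exact (S.sub_mem_iff_left (S.smul_mem _ hz')).mp
        ((S.add_mem_iff_left (S.smul_mem _ hw)).mp hy)
    · exact (S.sub_mem_iff_left (S.smul_mem _ hz')).mp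
        ((S.add_mem_iff_left (S.smul_mem _ hw)).mp ht)
  · refine ⟨?_, ?_, ?_, ?_, ?_, ?_, ?_, ?_, ?_, ?_, ?_, ?_, ?_, ?_, ?_⟩ <;>
      simp only [F.table, F.anti.mul_self, map_add, map_sub, map_smul, LinearMap.add_apply,
        LinearMap.sub_apply, LinearMap.smul_apply] <;> module

theorem exists_yw (F : FrameThree μ x y t z w u p q a b c d k 1 0) :
    ∃ x y t z w u p q a b c d, FrameThree μ x y t z w u p q a b c d 0 1 0 := by
  refine ⟨x - k • y, y, t, z, w - (k * p) • u, u, p, q, a - k * c,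
    b - k * d + (a - k * c) * (k * p), c, d + c * k * p,
    F.anti, fun S hx hy ht hz hw hu => ?_, ?_⟩
  · exact F.span S ((S.sub_mem_iff_left (S.smul_mem _ hy)).mp hx) hy ht hz
      ((S.sub_mem_iff_left (S.smul_mem _ hu)).mp hw) hu
  · refine ⟨?_, ?_, ?_, ?_, ?_, ?_, ?_, ?_, ?_, ?_, ?_, ?_, ?_, ?_, ?_⟩ <;>
      simp only [F.table, F.anti.mul_self, map_add, map_sub, map_smul, LinearMap.add_apply,
        LinearMap.sub_apply, LinearMap.smul_apply] <;> module

theorem exists_reduced_yw (F : FrameThree μ x y t z w u p q a b c d 0 1 0) :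
    ∃ x y t z w u q b c, FrameThree μ x y t z w u 0 q 0 b c 0 0 1 0 := by
  -- With yw = u, the correction -p • z kills yz; those in t kill the w-part of xt and the u-part of
  -- yt.
  refine ⟨x, y - p • z, t - a • (z - p • w) - (d + p * q) • w, z - p • w, w, u, q, b, c,
    F.anti, fun S hx hy ht hz hw hu => ?_, ?_⟩
  · have hz' : z ∈ S := (S.sub_mem_iff_left (S.smul_mem _ hw)).mp hz
    exact F.span S hx ((S.sub_mem_iff_left (S.smul_mem _ hz')).mp hy)
      ((S.sub_mem_iff_left (S.smul_mem _ hz)).mp ((S.sub_mem_iff_left (S.smul_mem _ hw)).mp ht))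
      hz' hw hu
  · refine ⟨?_, ?_, ?_, ?_, ?_, ?_, ?_, ?_, ?_, ?_, ?_, ?_, ?_, ?_, ?_⟩ <;>
      simp only [F.table, F.anti.mul_self, map_add, map_sub, map_smul, LinearMap.add_apply,
        LinearMap.sub_apply, LinearMap.smul_apply] <;> module

theorem exists_xt_eq_zero (F : FrameThree μ x y t z w u 0 q 0 b c 0 0 1 0) (hq : q ≠ 0) :
    ∃ x, FrameThree μ x y t z w u 0 q 0 0 c 0 0 1 0 := by
  refine ⟨x + (b / q) • z, F.anti, fun S hx hy ht hz hw hu => ?_, ?_⟩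
  · exact F.span S ((S.add_mem_iff_left (S.smul_mem _ hz)).mp hx) hy ht hz hw hu
  · refine ⟨?_, ?_, ?_, ?_, ?_, ?_, ?_, ?_, ?_, ?_, ?_, ?_, ?_, ?_, ?_⟩ <;>
      simp only [F.table, F.anti.mul_self, map_add, map_sub, map_smul, LinearMap.add_apply,
        LinearMap.sub_apply, LinearMap.smul_apply] <;> match_scalars <;> field_simp <;> ring

theorem cast (F : FrameThree μ x y t z w u p q a b c d k l m) {p' q' a' b' c' d' k' l' m' : ℂ}
    (hp : p = p') (hq : q = q') (ha : a = a') (hb : b = b') (hc : c = c') (hd : d = d')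
    (hk : k = k') (hl : l = l') (hm : m = m') :
    FrameThree μ x y t z w u p' q' a' b' c' d' k' l' m' := by
  subst hp hq ha hb hc hd hk hl hm
  exact F

theorem isomorphic_T00 (F : FrameThree μ x y t z w u 0 0 0 0 0 0 0 1 0)
    (hV : Module.finrank ℂ V = 6) : Isomorphic μ Name.T00.product := by
  refine isomorphic_of_frame hV F.anti .T00 ![x, y, z, w, u, t] (fun S hS => ?_) ?_
  · simp [Fin.forall_fin_succ] at hS
    grind [F.span S]
  · intro i j hij
    fin_cases i <;> fin_cases j <;> simp [F.table, Name.coords, e, Fin.sum_univ_succ] at hij ⊢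

theorem isomorphic_T04 (F : FrameThree μ x y t z w u 0 0 0 1 0 0 0 1 0)
    (hV : Module.finrank ℂ V = 6) : Isomorphic μ Name.T04.product := by
  refine isomorphic_of_frame hV F.anti .T04 ![x, y, z, w, t, u] (fun S hS => ?_) ?_
  · simp [Fin.forall_fin_succ] at hS
    grind [F.span S]
  · intro i j hij
    fin_cases i <;> fin_cases j <;> simp [F.table, Name.coords, e, Fin.sum_univ_succ] at hij ⊢

theorem isomorphic_T05 (F : FrameThree μ x y t z w u 1 0 0 0 0 0 0 0 1)
    (hV : Module.finrank ℂ V = 6) : Isomorphic μ Name.T05.product := by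
  refine isomorphic_of_frame hV F.anti .T05 ![x, y, z, w, -t, u] (fun S hS => ?_) ?_
  · simp [Fin.forall_fin_succ] at hS
    grind [F.span S]
  · intro i j hij
    fin_cases i <;> fin_cases j <;> simp [F.table, Name.coords, e, Fin.sum_univ_succ] at hij ⊢

theorem isomorphic_T06 (F : FrameThree μ x y t z w u 0 (-1) 0 0 0 0 0 1 0)
    (hV : Module.finrank ℂ V = 6) : Isomorphic μ Name.T06.product := by
  refine isomorphic_of_frame hV F.anti .T06 ![x, y, z, w, t, u] (fun S hS => ?_) ?_
  · simp [Fin.forall_fin_succ] at hS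
    grind [F.span S]
  · intro i j hij
    fin_cases i <;> fin_cases j <;> simp [F.table, Name.coords, e, Fin.sum_univ_succ] at hij ⊢

theorem isomorphic_T07 (F : FrameThree μ x y t z w u 0 0 0 0 0 0 0 0 1)
    (hV : Module.finrank ℂ V = 6) : Isomorphic μ Name.T07.product := by
  refine isomorphic_of_frame hV F.anti .T07 ![x, y, z, w, -t, u] (fun S hS => ?_) ?_
  · simp [Fin.forall_fin_succ] at hS
    grind [F.span S]
  · intro i j hij
    fin_cases i <;> fin_cases j <;> simp [F.table, Name.coords, e, Fin.sum_univ_succ] at hij ⊢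

/-- In the tables `T10` to `T14` the vector e₂ plays the role of x, and e₁ that of -y, the sign
being chosen so that e₁e₂ = xy. -/
theorem isomorphic_T10 (F : FrameThree μ x y t z w u (-1) 0 0 0 (-1) 0 0 0 1)
    (hV : Module.finrank ℂ V = 6) : Isomorphic μ Name.T10.product := by
  refine isomorphic_of_frame hV F.anti .T10 ![-y, x, z, t, w, u] (fun S hS => ?_) ?_
  · simp [Fin.forall_fin_succ] at hS
    grind [F.span S]
  · intro i j hij
    fin_cases i <;> fin_cases j <;> simp [F.table, Name.coords, e, Fin.sum_univ_succ] at hij ⊢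

theorem isomorphic_T11 (F : FrameThree μ x y t z w u 0 0 0 0 (-1) 0 0 1 0)
    (hV : Module.finrank ℂ V = 6) : Isomorphic μ Name.T11.product := by
  refine isomorphic_of_frame hV F.anti .T11 ![-y, x, z, t, w, -u] (fun S hS => ?_) ?_
  · simp [Fin.forall_fin_succ] at hS
    grind [F.span S]
  · intro i j hij
    fin_cases i <;> fin_cases j <;> simp [F.table, Name.coords, e, Fin.sum_univ_succ] at hij ⊢

theorem isomorphic_T12 (F : FrameThree μ x y t z w u 0 0 0 (-1) (-1) 0 0 1 0)
    (hV : Module.finrank ℂ V = 6) : Isomorphic μ Name.T12.product := by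
  refine isomorphic_of_frame hV F.anti .T12 ![-y, x, z, t, w, -u] (fun S hS => ?_) ?_
  · simp [Fin.forall_fin_succ] at hS
    grind [F.span S]
  · intro i j hij
    fin_cases i <;> fin_cases j <;> simp [F.table, Name.coords, e, Fin.sum_univ_succ] at hij ⊢

theorem isomorphic_T13 (F : FrameThree μ x y t z w u 0 1 0 0 (-1) 0 0 1 0)
    (hV : Module.finrank ℂ V = 6) : Isomorphic μ Name.T13.product := by
  refine isomorphic_of_frame hV F.anti .T13 ![-y, x, z, t, w, -u] (fun S hS => ?_) ?_
  · simp [Fin.forall_fin_succ] at hS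
    grind [F.span S]
  · intro i j hij
    fin_cases i <;> fin_cases j <;> simp [F.table, Name.coords, e, Fin.sum_univ_succ] at hij ⊢

theorem isomorphic_T14 (F : FrameThree μ x y t z w u 0 0 0 0 (-1) 0 0 0 1)
    (hV : Module.finrank ℂ V = 6) : Isomorphic μ Name.T14.product := by
  refine isomorphic_of_frame hV F.anti .T14 ![-y, x, z, t, w, u] (fun S hS => ?_) ?_
  · simp [Fin.forall_fin_succ] at hS
    grind [F.span S]
  · intro i j hij
    fin_cases i <;> fin_cases j <;> simp [F.table, Name.coords, e, Fin.sum_univ_succ] at hij ⊢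

theorem exists_isomorphic_tw (F : FrameThree μ x y t z w u p q a b c d k l 1)
    (hV : Module.finrank ℂ V = 6) : ∃ N : Name, N.Nondegenerate ∧ Isomorphic μ N.product := by
  obtain ⟨x, y, t, z, w, u, p, q, a, b, c, d, F⟩ := F.exists_tw
  obtain ⟨x, y, t, z, w, u, p, c, F⟩ := F.exists_reduced_tw
  -- The surviving parameters are scaled to the values in the tables; the scaling factors solve the
  -- resulting monomial equations.
  by_cases hp : p = 0 <;> by_cases hc : c = 0
  · subst hp hc
    exact ⟨.T07, trivial, F.isomorphic_T07 hV⟩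
  · subst hp
    refine ⟨.T14, trivial, isomorphic_T14 ((F.scale (α := 1) (β := 1) (γ := -1 / c) (δ := -1 / c) one_ne_zero one_ne_zero
      (by simp [*]) (by simp [*])).cast ?_ ?_ ?_ ?_ ?_ ?_ ?_ ?_ ?_) hV⟩ <;>
      field_simp <;> simp
  · subst hc
    refine ⟨.T05, trivial, isomorphic_T05 ((F.scale (α := 1) (β := 1) (γ := p) (δ := p) one_ne_zero one_ne_zero
      (by simp [*]) (by simp [*])).cast ?_ ?_ ?_ ?_ ?_ ?_ ?_ ?_ ?_) hV⟩ <;>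
      field_simp <;> simp
  · refine ⟨.T10, trivial, isomorphic_T10 ((F.scale (α := 1) (β := 1 / (p * c)) (γ := -1 / c) (δ := -1 / (p * c ^ 2)) one_ne_zero (by simp [*])
      (by simp [*]) (by simp [*])).cast ?_ ?_ ?_ ?_ ?_ ?_ ?_ ?_ ?_) hV⟩ <;>
      field_simp <;> simp

theorem exists_isomorphic_yw (F : FrameThree μ x y t z w u p q a b c d k 1 0)
    (hV : Module.finrank ℂ V = 6) : ∃ N : Name, N.Nondegenerate ∧ Isomorphic μ N.product := by
  obtain ⟨x, y, t, z, w, u, p, q, a, b, c, d, F⟩ := F.exists_yw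
  obtain ⟨x, y, t, z, w, u, q, b, c, F⟩ := F.exists_reduced_yw
  by_cases hq : q = 0
  · subst hq
    by_cases hb : b = 0 <;> by_cases hc : c = 0
    · subst hb hc
      exact ⟨.T00, trivial, F.isomorphic_T00 hV⟩
    · subst hb
      refine ⟨.T11, trivial, isomorphic_T11 ((F.scale (α := 1) (β := 1) (γ := -1 / c) (δ := 1) one_ne_zero one_ne_zero
      (by simp [*]) one_ne_zero).cast ?_ ?_ ?_ ?_ ?_ ?_ ?_ ?_ ?_) hV⟩ <;>
      field_simp <;> simp
    · subst hc
      refine ⟨.T04, trivial, isomorphic_T04 ((F.scale (α := 1) (β := 1) (γ := 1 / b) (δ := 1) one_ne_zero one_ne_zero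
      (by simp [*]) one_ne_zero).cast ?_ ?_ ?_ ?_ ?_ ?_ ?_ ?_ ?_) hV⟩ <;>
      field_simp <;> simp
    · refine ⟨.T12, trivial, isomorphic_T12 ((F.scale (α := c / b) (β := 1) (γ := -c / b ^ 2) (δ := (c / b) ^ 2) (by simp [*]) one_ne_zero
      (by simp [*]) (by simp [*])).cast ?_ ?_ ?_ ?_ ?_ ?_ ?_ ?_ ?_) hV⟩ <;>
      field_simp <;> simp
  · obtain ⟨x, F⟩ := F.exists_xt_eq_zero hq
    by_cases hc : c = 0
    · subst hc
      refine ⟨.T06, trivial, isomorphic_T06 ((F.scale (α := 1) (β := 1) (γ := -1 / q) (δ := 1) one_ne_zero one_ne_zero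
      (by simp [*]) one_ne_zero).cast ?_ ?_ ?_ ?_ ?_ ?_ ?_ ?_ ?_) hV⟩ <;>
      field_simp <;> simp
    · refine ⟨.T13, trivial, isomorphic_T13 ((F.scale (α := 1) (β := -q / c) (γ := -1 / c) (δ := (q / c) ^ 2) one_ne_zero (by simp [*])
      (by simp [*]) (by simp [*])).cast ?_ ?_ ?_ ?_ ?_ ?_ ?_ ?_ ?_) hV⟩ <;>
      field_simp <;> simp

end FrameThree

end Tortkara

/-! ### Three generators: existence of the normal form. -/

namespace Tortkara

variable {V : Type*} [AddCommGroup V] [Module ℂ V] {μ : Product V} {x y t : V}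

theorem Generate.swap_left (h : Generate μ x y t) : Generate μ y x t := by
  intro a
  obtain ⟨α, β, γ, ha⟩ := h a
  exact ⟨β, α, γ, by rwa [add_comm (β • y)]⟩

theorem Generate.swap_right (h : Generate μ x y t) : Generate μ x t y := by
  intro a
  obtain ⟨α, β, γ, ha⟩ := h a
  exact ⟨α, γ, β, by rwa [add_right_comm]⟩

theorem Generate.add_smul (h : Generate μ x y t) (b c : ℂ) :
    Generate μ x y (t + (b • x + c • y)) := by
  intro a
  obtain ⟨α, β, γ, ha⟩ := h a
  refine ⟨α - γ * b, β - γ * c, γ, ?_⟩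
  convert ha using 1
  module

/-- If the square has dimension one modulo the cube, then three generators can be adapted to it. -/
theorem Generate.exists_adapted [FiniteDimensional ℂ V] (hT : IsTortkara μ) (hN : IsNilpotent μ)
    (h₁ : lcs μ 1 ≠ ⊥)
    (hfin : Module.finrank ℂ (lcs μ 1) ≤ Module.finrank ℂ (lcs μ 2) + 1)
    (hG : Generate μ x y t) : ∃ x y t, Adapted μ x y t := by
  have key : ∀ {x y t : V}, Generate μ x y t → μ x y ∉ lcs μ 2 → ∃ x y t, Adapted μ x y t := by
    intro x y t hG hxy
    obtain ⟨a, ha⟩ := exists_sub_smul_mem (lcs_succ_le μ 1) hfin (mul_mem_lcs_one μ x y) hxy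
      (mul_mem_lcs_one μ x t)
    obtain ⟨b, hb⟩ := exists_sub_smul_mem (lcs_succ_le μ 1) hfin (mul_mem_lcs_one μ x y) hxy
      (mul_mem_lcs_one μ y t)
    refine ⟨x, y, _, hT, hG.add_smul b (-a), ?_, ?_⟩
    · convert ha using 1
      simp only [map_add, map_smul, hT.1.mul_self]
      module
    · convert hb using 1
      simp only [map_add, map_smul, hT.1.mul_self, hT.1 y x]
      module
  by_cases hxy : μ x y ∈ lcs μ 2
  · by_cases hxt : μ x t ∈ lcs μ 2
    · by_cases hyt : μ y t ∈ lcs μ 2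
      · exact absurd (lcs_eq_bot_of_le hN (hG.lcs_one_le hT.1 le_rfl hxy hxt hyt)) h₁
      · exact key hG.swap_left.swap_right hyt
    · exact key hG.swap_right hxt
  · exact key hG hxy

namespace Adapted

theorem swap (h : Adapted μ x y t) : Adapted μ y x t :=
  ⟨h.tortkara, h.generate.swap_left, h.yt_mem, h.xt_mem⟩

/-- The third generator annihilates the square modulo the fourth term of the series. -/
theorem tz_mem (h : Adapted μ x y t) [FiniteDimensional ℂ V]
    (h₄ : lcs μ 4 = ⊥) (h₃ : lcs μ 3 ≠ ⊥)
    (hfin : Module.finrank ℂ (lcs μ 2) ≤ Module.finrank ℂ (lcs μ 3) + 1) :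
    μ t (μ x y) ∈ lcs μ 3 := by
  by_contra htz
  have hμ := h.tortkara.1
  have hz := mul_mem_lcs_one μ x y
  set l := μ (μ y t) x + μ (μ t x) y with hl
  have hl3 : l ∈ lcs μ 3 := by
    refine add_mem (mul_mem_lcs' hμ h.yt_mem _) (mul_mem_lcs' hμ ?_ _)
    rw [hμ]
    exact neg_mem h.xt_mem
  have hJ : jacobian μ x y t = -μ t (μ x y) + l := by
    rw [hl, jacobian, hμ (μ x y) t, add_assoc]
  -- Modulo `lcs μ 3` one has J(x,y,t) = -tz, and the Tortkara identity turns J(x,y,t)g, for g a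
  -- generator, into a product within the square. So every generator sends tz into `lcs μ 4`; as tz
  -- would span `lcs μ 2` modulo `lcs μ 3`, this would make `lcs μ 3` vanish.
  have key : ∀ g, μ (jacobian μ x y t) g ∈ lcs μ 4 → μ g (μ t (μ x y)) ∈ lcs μ 4 := by
    intro g hg
    rw [hJ] at hg
    have h₁ : μ g (μ t (μ x y)) = μ (-μ t (μ x y) + l) g - μ l g := by
      rw [hμ g]
      simp
    rw [h₁]
    exact sub_mem hg (mul_mem_lcs' hμ hl3 _)
  have hx : μ x (μ t (μ x y)) ∈ lcs μ 4 := by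
    refine key x ?_
    rw [← neg_neg (jacobian μ x y t), ← jacobian_swap hμ, map_neg, LinearMap.neg_apply,
      ← h.tortkara.2]
    refine neg_mem (h.one_mul_two (mul_mem_lcs_one μ _ _) ?_)
    rw [hμ]
    exact neg_mem h.xt_mem
  have hy : μ y (μ t (μ x y)) ∈ lcs μ 4 := by
    refine key y ?_
    rw [← h.tortkara.2]
    refine h.one_mul_two (mul_mem_lcs_one μ _ _) ?_
    rw [hμ]
    exact neg_mem h.yt_mem
  have ht : μ t (μ t (μ x y)) ∈ lcs μ 4 := by
    refine key t ?_
    rw [← jacobian_rotate, ← h.tortkara.2]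
    exact h.two_mul_two h.yt_mem h.xt_mem
  refine h₃ (eq_bot_iff.mpr ((h.generate.lcs_le (n := 2) ?_ ?_ ?_ ?_).trans h₄.le))
  · exact fun b hb l hl => h.one_mul_two hl hb
  all_goals
    intro b hb
    obtain ⟨c, hc⟩ := Tortkara.exists_sub_smul_mem (lcs_succ_le μ 2) hfin (mul_mem_lcs μ t hz) htz hb
    rw [← sub_add_cancel b (c • μ t (μ x y)), map_add, map_smul]
    refine add_mem (mul_mem_lcs μ _ hc) (Submodule.smul_mem _ _ ?_)
    assumption

/-- The second generator can be chosen to annihilate the square modulo the fourth term. -/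
theorem exists_yz_mem (h : Adapted μ x y t) (hN : IsNilpotent μ) [FiniteDimensional ℂ V]
    (h₂ : lcs μ 2 ≠ ⊥) (hfin : Module.finrank ℂ (lcs μ 2) ≤ Module.finrank ℂ (lcs μ 3) + 1)
    (ht : μ t (μ x y) ∈ lcs μ 3) :
    ∃ x y, Adapted μ x y t ∧ μ x (μ x y) ∉ lcs μ 3 ∧ μ y (μ x y) ∈ lcs μ 3 ∧
      μ t (μ x y) ∈ lcs μ 3 := by
  have key : ∀ {x y : V}, Adapted μ x y t → μ t (μ x y) ∈ lcs μ 3 → μ x (μ x y) ∉ lcs μ 3 →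
      ∃ x y, Adapted μ x y t ∧ μ x (μ x y) ∉ lcs μ 3 ∧ μ y (μ x y) ∈ lcs μ 3 ∧
        μ t (μ x y) ∈ lcs μ 3 := by
    intro x y h ht hxz
    have hμ := h.tortkara.1
    have hz := mul_mem_lcs_one μ x y
    obtain ⟨c, hc⟩ := Tortkara.exists_sub_smul_mem (lcs_succ_le μ 2) hfin (mul_mem_lcs μ x hz) hxz
      (mul_mem_lcs μ y hz)
    -- Subtracting a multiple of x from y leaves z unchanged.
    have hz' : μ x (y - c • x) = μ x y := by simp [hμ.mul_self]
    refine ⟨x, y - c • x, ⟨h.tortkara, fun a => ?_, h.xt_mem, ?_⟩, ?_, ?_, ?_⟩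
    · obtain ⟨α, β, γ, ha⟩ := h.generate a
      refine ⟨α + β * c, β, γ, ?_⟩
      convert ha using 1
      module
    · simpa using sub_mem h.yt_mem (Submodule.smul_mem _ c h.xt_mem)
    · rwa [hz']
    · rw [hz']
      simpa using hc
    · rwa [hz']
  by_cases hxz : μ x (μ x y) ∈ lcs μ 3
  · by_cases hyz : μ y (μ x y) ∈ lcs μ 3
    · refine absurd (lcs_eq_bot_of_le hN ?_) h₂
      refine h.generate.lcs_le (n := 1) ?_ ?_ ?_ ?_
      · exact fun b hb l hl => h.generate.mul_mem_three h.tortkara hl hb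
      all_goals
        intro b hb
        obtain ⟨c, hc⟩ := h.exists_sub_smul_mem hb
        rw [← sub_add_cancel b (c • μ x y), map_add, map_smul]
        refine add_mem (mul_mem_lcs μ _ hc) (Submodule.smul_mem _ _ ?_)
        assumption
    · refine key h.swap ?_ ?_ <;> rw [h.tortkara.1 y x, map_neg, neg_mem_iff] <;> assumption
  · exact key h ht hxz

end Adapted

theorem exists_eq_smul [FiniteDimensional ℂ V] {M : Submodule ℂ V} (hM : Module.finrank ℂ M ≤ 1)
    {u : V} (hu : u ∈ M) (hu' : u ≠ 0) {a : V} (ha : a ∈ M) : ∃ c : ℂ, a = c • u := by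
  obtain ⟨c, hc⟩ := exists_sub_smul_mem (M' := ⊥) bot_le (by simpa using hM) hu (by simpa using hu') ha
  exact ⟨c, sub_eq_zero.mp (by simpa using hc)⟩

/-- Nilpotent Tortkara algebras of dimension six with three generators. -/
theorem exists_isomorphic_of_three_generators (hV : Module.finrank ℂ V = 6) (hT : IsTortkara μ)
    (hN : IsNilpotent μ) (hM : ¬ IsMalcev μ) (h₁ : Module.finrank ℂ (lcs μ 1) = 3) :
    ∃ N : Name, N.Nondegenerate ∧ Isomorphic μ N.product := by
  have : FiniteDimensional ℂ V := Module.finite_of_finrank_eq_succ hV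
  have h₃ := lcs_three_ne_bot hV hT hN hM
  have hn₂ : lcs μ 2 ≠ ⊥ := fun h => h₃ (eq_bot_iff.mpr ((lcs_succ_le μ 2).trans h.le))
  have hn₁ : lcs μ 1 ≠ ⊥ := fun h => hn₂ (eq_bot_iff.mpr ((lcs_succ_le μ 1).trans h.le))
  have f₁ : Module.finrank ℂ (lcs μ 2) < _ := finrank_lcs_succ_lt hN hn₁
  have f₂ : Module.finrank ℂ (lcs μ 3) < _ := finrank_lcs_succ_lt hN hn₂
  have f₃ : Module.finrank ℂ (lcs μ 4) < _ := finrank_lcs_succ_lt hN h₃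
  have h₄ : lcs μ 4 = ⊥ := Submodule.finrank_eq_zero.mp (by omega)
  have z₄ : ∀ {v}, v ∈ lcs μ 4 → v = 0 := fun h => by rwa [h₄, Submodule.mem_bot] at h
  obtain ⟨x, y, t, hG⟩ := exists_generate_three μ (by omega)
  obtain ⟨x, y, t, hA⟩ := hG.exists_adapted hT hN hn₁ (by omega)
  obtain ⟨x, y, hA, hxz, hyz, htz⟩ :=
    hA.exists_yz_mem hN hn₂ (by omega) (hA.tz_mem h₄ h₃ (by omega))
  have hμ := hT.1
  have hz := mul_mem_lcs_one μ x y
  have hw := mul_mem_lcs μ x hz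
  have hL₂ : ∀ {v}, v ∈ lcs μ 2 → ∃ c : ℂ, v - c • μ x (μ x y) ∈ lcs μ 3 :=
    fun hv => exists_sub_smul_mem (lcs_succ_le μ 2) (by simp only [Nat.reduceAdd]; omega) hw hxz hv
  -- The generator u of `lcs μ 3` is left open, to be chosen as tw or yw, whichever is nonzero.
  have hframe : ∀ {u : V}, u ∈ lcs μ 3 → u ≠ 0 → ∃ p q a b c d k l m : ℂ,
      μ y (μ x (μ x y)) = l • u ∧ μ t (μ x (μ x y)) = m • u ∧
      FrameThree μ x y t (μ x y) (μ x (μ x y)) u p q a b c d k l m := by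
    intro u hu hu'
    have hL₃ : ∀ {v}, v ∈ lcs μ 3 → ∃ c : ℂ, v = c • u :=
      fun hv => exists_eq_smul (by omega) hu hu' hv
    obtain ⟨p, hp⟩ := hL₃ hyz
    obtain ⟨q, hq⟩ := hL₃ htz
    obtain ⟨k, hk⟩ := hL₃ (mul_mem_lcs μ x hw)
    obtain ⟨l, hl⟩ := hL₃ (mul_mem_lcs μ y hw)
    obtain ⟨m, hm⟩ := hL₃ (mul_mem_lcs μ t hw)
    obtain ⟨a, ha⟩ := hL₂ hA.xt_mem
    obtain ⟨b, hb⟩ := hL₃ ha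
    obtain ⟨c, hc⟩ := hL₂ hA.yt_mem
    obtain ⟨d, hd⟩ := hL₃ hc
    have hu₀ : ∀ v, μ v u = 0 := fun v => z₄ (mul_mem_lcs μ v hu)
    refine ⟨p, q, a, b, c, d, k, l, m, hl, hm, hμ, fun S hxS hyS htS hzS hwS huS => ?_,
      rfl, ?_, rfl, hk, hu₀ _, ?_, hp, hl, hu₀ _, hq, hm, hu₀ _, z₄ (hA.one_mul_two hz hw), hu₀ _,
      hu₀ _⟩
    · have s₃ : lcs μ 3 ≤ S := fun v hv => by
        obtain ⟨c, rfl⟩ := hL₃ hv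
        exact S.smul_mem c huS
      have s₂ : lcs μ 2 ≤ S := fun v hv => by
        obtain ⟨c, hc⟩ := hL₂ hv
        exact (S.sub_mem_iff_left (S.smul_mem c hwS)).mp (s₃ hc)
      have s₁ : lcs μ 1 ≤ S := fun v hv => by
        obtain ⟨c, hc⟩ := hA.exists_sub_smul_mem hv
        exact (S.sub_mem_iff_left (S.smul_mem c hzS)).mp (s₂ hc)
      refine eq_top_iff.mpr fun v _ => ?_
      obtain ⟨α, β, γ, hv⟩ := hA.generate v
      exact (S.sub_mem_iff_left (add_mem (add_mem (S.smul_mem α hxS) (S.smul_mem β hyS))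
        (S.smul_mem γ htS))).mp (s₁ hv)
    · rw [← hb, add_sub_cancel]
    · rw [← hd, add_sub_cancel]
  by_cases htw : μ t (μ x (μ x y)) = 0
  · by_cases hyw : μ y (μ x (μ x y)) = 0
    · refine absurd (isMalcev_of_mul_comm hT (fun a ha b hb => z₄ (hA.one_mul_one ha hb)) ?_) hM
      -- If tw = yw = 0, then a acts on z modulo `lcs μ 3`, and on w, as α times x does; hence left
      -- multiplications commute on the square.
      have hcoord : ∀ a, ∃ α : ℂ, μ a (μ x y) - α • μ x (μ x y) ∈ lcs μ 3 ∧
          μ a (μ x (μ x y)) = α • μ x (μ x (μ x y)) := by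
        intro a
        obtain ⟨α, β, γ, ha⟩ := hA.generate a
        rw [← sub_add_cancel a (α • x + β • y + γ • t)]
        refine ⟨α, ?_, ?_⟩
        · have h := add_mem (add_mem (lcs_succ_le μ 3 (hA.one_mul_one ha hz))
            (Submodule.smul_mem _ β hyz)) (Submodule.smul_mem _ γ htz)
          convert h using 1
          simp only [map_add, map_smul, LinearMap.add_apply, LinearMap.smul_apply]
          module
        · rw [map_add, LinearMap.add_apply, z₄ (hA.one_mul_two ha hw)]
          simp [htw, hyw]
      have hprod : ∀ a b, ∃ α β : ℂ, μ a (μ b (μ x y)) = (α * β) • μ x (μ x (μ x y)) ∧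
          μ b (μ a (μ x y)) = (β * α) • μ x (μ x (μ x y)) := by
        intro a b
        obtain ⟨α, h₁, h₂⟩ := hcoord a
        obtain ⟨β, h₃, h₄⟩ := hcoord b
        have h₅ := z₄ (mul_mem_lcs μ a h₃)
        have h₆ := z₄ (mul_mem_lcs μ b h₁)
        rw [map_sub, map_smul, sub_eq_zero] at h₅ h₆
        refine ⟨β, α, ?_, ?_⟩
        · rw [h₅, h₂, smul_smul]
        · rw [h₆, h₄, smul_smul]
      intro q hq a b
      obtain ⟨c, hc⟩ := hA.exists_sub_smul_mem hq
      obtain ⟨α, β, h₁, h₂⟩ := hprod a b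
      have h₅ := z₄ (mul_mem_lcs μ a (mul_mem_lcs μ b hc))
      have h₆ := z₄ (mul_mem_lcs μ b (mul_mem_lcs μ a hc))
      simp only [map_sub, map_smul, sub_eq_zero] at h₅ h₆
      rw [h₅, h₆, h₁, h₂, mul_comm α]
    · obtain ⟨p, q, a, b, c, d, k, l, m, hl, hm, F⟩ := hframe (mul_mem_lcs μ y hw) hyw
      have hl' : l = 1 := by
        have : (l - 1) • μ y (μ x (μ x y)) = 0 := by rw [sub_smul, ← hl, one_smul, sub_self]
        exact sub_eq_zero.mp ((smul_eq_zero.mp this).resolve_right hyw)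
      have hm' : m = 0 := by
        rw [htw] at hm
        exact (smul_eq_zero.mp hm.symm).resolve_right hyw
      subst hl' hm'
      exact F.exists_isomorphic_yw hV
  · obtain ⟨p, q, a, b, c, d, k, l, m, hl, hm, F⟩ := hframe (mul_mem_lcs μ t hw) htw
    have hm' : m = 1 := by
      have : (m - 1) • μ t (μ x (μ x y)) = 0 := by rw [sub_smul, ← hm, one_smul, sub_self]
      exact sub_eq_zero.mp ((smul_eq_zero.mp this).resolve_right htw)
    subst hm'
    exact F.exists_isomorphic_tw hV

end Tortkara

/-! ### Two generators: reduction of the multiplication tables. -/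

namespace Tortkara

variable {V : Type*} [AddCommGroup V] [Module ℂ V]

/-- The multiplication table of an algebra with two generators `x`, `y`, whose lower central series has
the factors `⟨x, y⟩`, `⟨z⟩`, `⟨v, w⟩`, `⟨u⟩`. -/
structure FrameForm (μ : Product V) (x y z v w u : V) (a b c d : ℂ) : Prop where
  anti : IsAnticommutative μ
  span : ∀ S : Submodule ℂ V, x ∈ S → y ∈ S → z ∈ S → v ∈ S → w ∈ S → u ∈ S → S = ⊤
  products :
    μ x y = z ∧ μ x z = v ∧ μ x v = a • u ∧ μ x w = b • u ∧ μ x u = 0 ∧ μ y z = w ∧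
    μ y v = c • u ∧ μ y w = d • u ∧ μ y u = 0 ∧ μ z v = 0 ∧ μ z w = 0 ∧ μ z u = 0 ∧ μ v w = 0 ∧
    μ v u = 0 ∧ μ w u = 0

namespace FrameForm

variable {μ : Product V} {x y z v w u : V} {a b c d : ℂ}

theorem table (F : FrameForm μ x y z v w u a b c d) :
    (μ x y = z ∧ μ x z = v ∧ μ x v = a • u ∧ μ x w = b • u ∧ μ x u = 0 ∧ μ y z = w ∧
    μ y v = c • u ∧ μ y w = d • u ∧ μ y u = 0 ∧ μ z v = 0 ∧ μ z w = 0 ∧ μ z u = 0 ∧ μ v w = 0 ∧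
    μ v u = 0 ∧ μ w u = 0) ∧
    (μ y x = -z ∧ μ z x = -v ∧ μ v x = -(a • u) ∧ μ w x = -(b • u) ∧ μ u x = 0 ∧ μ z y = -w ∧
    μ v y = -(c • u) ∧ μ w y = -(d • u) ∧ μ u y = 0 ∧ μ v z = 0 ∧ μ w z = 0 ∧ μ u z = 0 ∧
    μ w v = 0 ∧ μ u v = 0 ∧ μ u w = 0) := by
  refine ⟨F.products, ?_⟩
  rw [F.anti y x, F.anti z x, F.anti v x, F.anti w x, F.anti u x, F.anti z y, F.anti v y,
    F.anti w y, F.anti u y, F.anti v z, F.anti w z, F.anti u z, F.anti w v, F.anti u v, F.anti u w]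
  simp only [F.products, neg_zero, and_self]

/-- The scalars a, b, c, d form the matrix of B, where g(hz) = B(g,h)u. A change of generators acts
by congruence, with the extra factor Δ = αδ - βγ from the new z and 1/ν from the new u. -/
theorem change (F : FrameForm μ x y z v w u a b c d) {α β γ δ ν : ℂ}
    (hΔ : α * δ - β * γ ≠ 0) (hν : ν ≠ 0) :
    FrameForm μ (α • x + β • y) (γ • x + δ • y) ((α * δ - β * γ) • z)
      ((α * δ - β * γ) • (α • v + β • w)) ((α * δ - β * γ) • (γ • v + δ • w)) (ν • u)
      ((α * δ - β * γ) * (α ^ 2 * a + α * β * (b + c) + β ^ 2 * d) / ν)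
      ((α * δ - β * γ) * (α * γ * a + α * δ * b + β * γ * c + β * δ * d) / ν)
      ((α * δ - β * γ) * (α * γ * a + β * γ * b + α * δ * c + β * δ * d) / ν)
      ((α * δ - β * γ) * (γ ^ 2 * a + γ * δ * (b + c) + δ ^ 2 * d) / ν) where
  anti := F.anti
  span S hx hy hz hv hw hu := by
    have key : ∀ {p q : V}, α • p + β • q ∈ S → γ • p + δ • q ∈ S → p ∈ S ∧ q ∈ S := by
      intro p q h₁ h₂
      refine ⟨(S.smul_mem_iff hΔ).mp ?_, (S.smul_mem_iff hΔ).mp ?_⟩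
      · convert S.sub_mem (S.smul_mem δ h₁) (S.smul_mem β h₂) using 1
        module
      · convert S.sub_mem (S.smul_mem α h₂) (S.smul_mem γ h₁) using 1
        module
    have h₁ := key hx hy
    have h₂ := key ((S.smul_mem_iff hΔ).mp hv) ((S.smul_mem_iff hΔ).mp hw)
    exact F.span S h₁.1 h₁.2 ((S.smul_mem_iff hΔ).mp hz) h₂.1 h₂.2 ((S.smul_mem_iff hν).mp hu)
  products := by
    refine ⟨?_, ?_, ?_, ?_, ?_, ?_, ?_, ?_, ?_, ?_, ?_, ?_, ?_, ?_, ?_⟩ <;>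
      simp only [F.table, F.anti.mul_self, map_add, map_sub, map_smul, LinearMap.add_apply,
        LinearMap.sub_apply, LinearMap.smul_apply] <;> match_scalars <;> field_simp <;> ring

theorem cast (F : FrameForm μ x y z v w u a b c d) {a' b' c' d' : ℂ} (ha : a = a') (hb : b = b')
    (hc : c = c') (hd : d = d') : FrameForm μ x y z v w u a' b' c' d' := by
  subst ha hb hc hd
  exact F

theorem isomorphic_T08 (F : FrameForm μ x y z v w u 1 (-1) 1 0)
    (hV : Module.finrank ℂ V = 6) : Isomorphic μ Name.T08.product := by
  refine isomorphic_of_frame hV F.anti .T08 ![x, y, z, v, w, u] (fun S hS => ?_) ?_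
  · simp [Fin.forall_fin_succ] at hS
    grind [F.span S]
  · intro i j hij
    fin_cases i <;> fin_cases j <;> simp [F.table, Name.coords, e, Fin.sum_univ_succ] at hij ⊢

theorem isomorphic_T09 {α : ℂ} (F : FrameForm μ x y z v w u 0 (α + 1) α 0)
    (hV : Module.finrank ℂ V = 6) : Isomorphic μ (Name.T09 α).product := by
  refine isomorphic_of_frame hV F.anti (.T09 α) ![x, y, z, v, w, u] (fun S hS => ?_) ?_
  · simp [Fin.forall_fin_succ] at hS
    grind [F.span S]
  · intro i j hij
    fin_cases i <;> fin_cases j <;> simp [F.table, Name.coords, e, Fin.sum_univ_succ] at hij ⊢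

/-- If both generators are isotropic, the algebra is in the family `T09`. -/
theorem exists_isomorphic_of_isotropic (F : FrameForm μ x y z v w u 0 b c 0) (hbc : b ≠ c)
    (hV : Module.finrank ℂ V = 6) : ∃ N : Name, N.Nondegenerate ∧ Isomorphic μ N.product := by
  have hbc' : b - c ≠ 0 := sub_ne_zero.mpr hbc
  have F' : Isomorphic μ (Name.T09 (c / (b - c))).product := by
    -- Dividing by b - c normalizes the antisymmetric part, so that the coefficients become α + 1
    -- and α.
    refine isomorphic_T09 ((F.change (α := 1) (β := 0) (γ := 0) (δ := 1) (ν := b - c) (by simp)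
      hbc').cast ?_ ?_ ?_ ?_) hV <;> field_simp <;> ring
  by_cases h₀ : c / (b - c) = 0
  · rw [h₀] at F'
    exact ⟨.T02, trivial, F'.trans isomorphic_T09_zero⟩
  by_cases h₁ : c / (b - c) = -1
  · rw [h₁] at F'
    exact ⟨.T02, trivial, F'.trans isomorphic_T09_neg_one⟩
  exact ⟨.T09 _, ⟨h₀, h₁⟩, F'⟩

/-- Over ℂ the quadratic form of B has an isotropic vector, which is taken as y. If b + c ≠ 0, there
is a second isotropic line, spanned by a vector x + βy. If b + c = 0, then either x is isotropic as
well or B has the shape of `T08`. -/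
theorem exists_isomorphic (F : FrameForm μ x y z v w u a b c d) (hbc : b ≠ c)
    (hV : Module.finrank ℂ V = 6) : ∃ N : Name, N.Nondegenerate ∧ Isomorphic μ N.product := by
  have key : ∀ {x y z v w u : V} {a b c : ℂ}, FrameForm μ x y z v w u a b c 0 → b ≠ c →
      ∃ N : Name, N.Nondegenerate ∧ Isomorphic μ N.product := by
    intro x y z v w u a b c F hbc
    by_cases hs : b + c = 0
    · obtain rfl : b = -c := eq_neg_of_add_eq_zero_left hs
      have hc : c ≠ 0 := fun h => hbc (by simp [h])
      by_cases ha : a = 0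
      · subst ha
        exact F.exists_isomorphic_of_isotropic hbc hV
      · refine ⟨.T08, trivial, isomorphic_T08 ((F.change (α := 1) (β := 0) (γ := 0) (δ := a / c)
          (ν := a ^ 2 / c) (by simp [*]) (by simp [*])).cast ?_ ?_ ?_ ?_) hV⟩ <;> field_simp <;> ring
    · refine exists_isomorphic_of_isotropic ((F.change (α := 1) (β := -a / (b + c)) (γ := 0)
        (δ := 1) (ν := 1) (by simp) one_ne_zero).cast ?_ rfl rfl ?_) ?_ hV
      · field_simp
        ring
      · simp
      · simpa using hbc
  by_cases hd : d = 0
  · subst hd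
    exact key F hbc
  -- The equation says that x + r • y is isotropic; this vector becomes the second generator.
  · obtain ⟨r, hr⟩ : ∃ r : ℂ, d * (r * r) + (b + c) * r + a = 0 := by
      refine exists_quadratic_eq_zero hd ?_
      obtain ⟨s, hs⟩ := IsAlgClosed.exists_pow_nat_eq (discrim d (b + c) a) (n := 2) (by norm_num)
      exact ⟨s, by rw [← hs, sq]⟩
    refine key ((F.change (α := 0) (β := 1) (γ := 1) (δ := r) (ν := 1) (by simp)
      one_ne_zero).cast rfl rfl rfl ?_) ?_
    · linear_combination -hr
    · intro h
      apply hbc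
      linear_combination h

end FrameForm

/-- The multiplication table of an algebra with two generators `x`, `y`, whose lower central series has
the factors `⟨x, y⟩`, `⟨z⟩`, `⟨w⟩`, `⟨s, r⟩`. -/
structure FramePlane (μ : Product V) (x y z w s r : V) (a b : ℂ) : Prop where
  anti : IsAnticommutative μ
  span : ∀ S : Submodule ℂ V, x ∈ S → y ∈ S → z ∈ S → w ∈ S → s ∈ S → r ∈ S → S = ⊤
  products :
    μ x y = z ∧ μ x z = w ∧ μ x w = s ∧ μ x s = 0 ∧ μ x r = 0 ∧ μ y z = a • s + b • r ∧
    μ y w = r ∧ μ y s = 0 ∧ μ y r = 0 ∧ μ z w = 0 ∧ μ z s = 0 ∧ μ z r = 0 ∧ μ w s = 0 ∧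
    μ w r = 0 ∧ μ s r = 0

namespace FramePlane

variable {μ : Product V} {x y z w s r : V} {a b : ℂ}

theorem table (F : FramePlane μ x y z w s r a b) :
    (μ x y = z ∧ μ x z = w ∧ μ x w = s ∧ μ x s = 0 ∧ μ x r = 0 ∧ μ y z = a • s + b • r ∧
    μ y w = r ∧ μ y s = 0 ∧ μ y r = 0 ∧ μ z w = 0 ∧ μ z s = 0 ∧ μ z r = 0 ∧ μ w s = 0 ∧
    μ w r = 0 ∧ μ s r = 0) ∧
    (μ y x = -z ∧ μ z x = -w ∧ μ w x = -s ∧ μ s x = 0 ∧ μ r x = 0 ∧ μ z y = -(a • s + b • r) ∧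
    μ w y = -r ∧ μ s y = 0 ∧ μ r y = 0 ∧ μ w z = 0 ∧ μ s z = 0 ∧ μ r z = 0 ∧ μ s w = 0 ∧
    μ r w = 0 ∧ μ r s = 0) := by
  refine ⟨F.products, ?_⟩
  rw [F.anti y x, F.anti z x, F.anti w x, F.anti s x, F.anti r x, F.anti z y, F.anti w y,
    F.anti s y, F.anti r y, F.anti w z, F.anti s z, F.anti r z, F.anti s w, F.anti r w, F.anti r s]
  simp only [F.products, neg_zero, and_self]

theorem isomorphic_T01 (F : FramePlane μ x y z w s r 1 0)
    (hV : Module.finrank ℂ V = 6) : Isomorphic μ Name.T01.product := by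
  refine isomorphic_of_frame hV F.anti .T01 ![x, y, z, w, s, r] (fun S hS => ?_) ?_
  · simp [Fin.forall_fin_succ] at hS
    grind [F.span S]
  · intro i j hij
    fin_cases i <;> fin_cases j <;> simp [F.table, Name.coords, e, Fin.sum_univ_succ] at hij ⊢

theorem isomorphic_T03 (F : FramePlane μ x y z w s r 0 0)
    (hV : Module.finrank ℂ V = 6) : Isomorphic μ Name.T03.product := by
  refine isomorphic_of_frame hV F.anti .T03 ![x, y, z, w, s, r] (fun S hS => ?_) ?_
  · simp [Fin.forall_fin_succ] at hS
    grind [F.span S]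
  · intro i j hij
    fin_cases i <;> fin_cases j <;> simp [F.table, Name.coords, e, Fin.sum_univ_succ] at hij ⊢

theorem exists_reduced (F : FramePlane μ x y z w s r a b) :
    ∃ y z w, FramePlane μ x y z w s r a 0 := by
  -- Since yw = r, the correction -b • z kills the r-part of yz.
  refine ⟨y - b • z, z - b • w, w - b • s, F.anti, fun S hx hy hz hw hs hr => ?_, ?_⟩
  · have hw' := (S.sub_mem_iff_left (S.smul_mem _ hs)).mp hw
    have hz' := (S.sub_mem_iff_left (S.smul_mem _ hw')).mp hz
    exact F.span S hx ((S.sub_mem_iff_left (S.smul_mem _ hz')).mp hy) hz' hw' hs hr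
  · refine ⟨?_, ?_, ?_, ?_, ?_, ?_, ?_, ?_, ?_, ?_, ?_, ?_, ?_, ?_, ?_⟩ <;>
      simp only [F.table, F.anti.mul_self, map_add, map_sub, map_smul, LinearMap.add_apply,
        LinearMap.sub_apply, LinearMap.smul_apply] <;> module

theorem scale (F : FramePlane μ x y z w s r a 0) (ha : a ≠ 0) :
    FramePlane μ (a • x) (a • y) ((a ^ 2) • z) ((a ^ 3) • w) ((a ^ 4) • s) ((a ^ 4) • r) 1 0 where
  anti := F.anti
  span S hx hy hz hw hs hr := F.span S ((S.smul_mem_iff ha).mp hx) ((S.smul_mem_iff ha).mp hy)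
    ((S.smul_mem_iff (pow_ne_zero _ ha)).mp hz) ((S.smul_mem_iff (pow_ne_zero _ ha)).mp hw)
    ((S.smul_mem_iff (pow_ne_zero _ ha)).mp hs) ((S.smul_mem_iff (pow_ne_zero _ ha)).mp hr)
  products := by
    refine ⟨?_, ?_, ?_, ?_, ?_, ?_, ?_, ?_, ?_, ?_, ?_, ?_, ?_, ?_, ?_⟩ <;>
      simp only [F.table, map_smul, LinearMap.smul_apply] <;> module

theorem exists_isomorphic (F : FramePlane μ x y z w s r a b) (hV : Module.finrank ℂ V = 6) :
    ∃ N : Name, N.Nondegenerate ∧ Isomorphic μ N.product := by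
  obtain ⟨y, z, w, F⟩ := F.exists_reduced
  by_cases ha : a = 0
  · subst ha
    exact ⟨.T03, trivial, F.isomorphic_T03 hV⟩
  · exact ⟨.T01, trivial, (F.scale ha).isomorphic_T01 hV⟩

end FramePlane

/-- The multiplication table of an algebra with two generators `x`, `y`, whose lower central series has
the factors `⟨x, y⟩`, `⟨z⟩`, `⟨w⟩`, `⟨s⟩`, `⟨v⟩`, where `yw = s`. -/
structure FrameTwisted (μ : Product V) (x y z w s v : V) (a b k l : ℂ) : Prop where
  anti : IsAnticommutative μ
  span : ∀ S : Submodule ℂ V, x ∈ S → y ∈ S → z ∈ S → w ∈ S → s ∈ S → v ∈ S → S = ⊤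
  products :
    μ x y = z ∧ μ x z = w ∧ μ x w = k • s + l • v ∧ μ x s = v ∧ μ x v = 0 ∧
    μ y z = a • s + b • v ∧ μ y w = s ∧ μ y s = 0 ∧ μ y v = 0 ∧ μ z w = v ∧ μ z s = 0 ∧
    μ z v = 0 ∧ μ w s = 0 ∧ μ w v = 0 ∧ μ s v = 0

namespace FrameTwisted

variable {μ : Product V} {x y z w s v : V} {a b k l : ℂ}

theorem table (F : FrameTwisted μ x y z w s v a b k l) :
    (μ x y = z ∧ μ x z = w ∧ μ x w = k • s + l • v ∧ μ x s = v ∧ μ x v = 0 ∧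
    μ y z = a • s + b • v ∧ μ y w = s ∧ μ y s = 0 ∧ μ y v = 0 ∧ μ z w = v ∧ μ z s = 0 ∧
    μ z v = 0 ∧ μ w s = 0 ∧ μ w v = 0 ∧ μ s v = 0) ∧
    (μ y x = -z ∧ μ z x = -w ∧ μ w x = -(k • s + l • v) ∧ μ s x = -v ∧ μ v x = 0 ∧
    μ z y = -(a • s + b • v) ∧ μ w y = -s ∧ μ s y = 0 ∧ μ v y = 0 ∧ μ w z = -v ∧ μ s z = 0 ∧
    μ v z = 0 ∧ μ s w = 0 ∧ μ v w = 0 ∧ μ v s = 0) := by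
  refine ⟨F.products, ?_⟩
  rw [F.anti y x, F.anti z x, F.anti w x, F.anti s x, F.anti v x, F.anti z y, F.anti w y,
    F.anti s y, F.anti v y, F.anti w z, F.anti s z, F.anti v z, F.anti s w, F.anti v w, F.anti v s]
  simp only [F.products, neg_zero, and_self]

theorem isomorphic_T19 (F : FrameTwisted μ x y z w s v 0 0 0 0)
    (hV : Module.finrank ℂ V = 6) : Isomorphic μ Name.T19.product := by
  refine isomorphic_of_frame hV F.anti .T19 ![x, y, z, w, s, v] (fun S hS => ?_) ?_
  · simp [Fin.forall_fin_succ] at hS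
    grind [F.span S]
  · intro i j hij
    fin_cases i <;> fin_cases j <;> simp [F.table, Name.coords, e, Fin.sum_univ_succ] at hij ⊢

theorem exists_xw (F : FrameTwisted μ x y z w s v a b k l) :
    ∃ x w l, FrameTwisted μ x y z w s v a b 0 l := by
  -- Since yw = s, subtracting k • y from x kills the s-part of xw.
  refine ⟨x - k • y, w - (k * a) • s - (k * b) • v, l - k * a, F.anti,
    fun S hx hy hz hw hs hv => ?_, ?_⟩
  · have hw' := (S.sub_mem_iff_left (S.smul_mem _ hs)).mp
      ((S.sub_mem_iff_left (S.smul_mem _ hv)).mp hw)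
    exact F.span S ((S.sub_mem_iff_left (S.smul_mem _ hy)).mp hx) hy hz hw' hs hv
  · refine ⟨?_, ?_, ?_, ?_, ?_, ?_, ?_, ?_, ?_, ?_, ?_, ?_, ?_, ?_, ?_⟩ <;>
      simp only [F.table, F.anti.mul_self, map_add, map_sub, map_smul, LinearMap.add_apply,
        LinearMap.sub_apply, LinearMap.smul_apply] <;> module

theorem exists_yz (F : FrameTwisted μ x y z w s v a b 0 l) :
    ∃ y z w s b, FrameTwisted μ x y z w s v 0 b 0 l := by
  refine ⟨y - a • z, z - a • w, w - (a * l) • v, s - a • v, b + a ^ 2, F.anti,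
    fun S hx hy hz hw hs hv => ?_, ?_⟩
  · have hw' := (S.sub_mem_iff_left (S.smul_mem _ hv)).mp hw
    have hz' := (S.sub_mem_iff_left (S.smul_mem _ hw')).mp hz
    exact F.span S hx ((S.sub_mem_iff_left (S.smul_mem _ hz')).mp hy) hz' hw'
      ((S.sub_mem_iff_left (S.smul_mem _ hv)).mp hs) hv
  · refine ⟨?_, ?_, ?_, ?_, ?_, ?_, ?_, ?_, ?_, ?_, ?_, ?_, ?_, ?_, ?_⟩ <;>
      simp only [F.table, F.anti.mul_self, map_add, map_sub, map_smul, LinearMap.add_apply,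
        LinearMap.sub_apply, LinearMap.smul_apply] <;> module

theorem exists_reduced (F : FrameTwisted μ x y z w s v 0 b 0 l) :
    ∃ x y z, FrameTwisted μ x y z w s v 0 0 0 0 := by
  -- Since zw = v, multiples of z in x and of w in y absorb the remaining v-parts of xw and yz.
  refine ⟨x - l • z, y + b • w, z + (b * l) • v, F.anti, fun S hx hy hz hw hs hv => ?_, ?_⟩
  · have hz' := (S.add_mem_iff_left (S.smul_mem _ hv)).mp hz
    exact F.span S ((S.sub_mem_iff_left (S.smul_mem _ hz')).mp hx)
      ((S.add_mem_iff_left (S.smul_mem _ hw)).mp hy) hz' hw hs hv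
  · refine ⟨?_, ?_, ?_, ?_, ?_, ?_, ?_, ?_, ?_, ?_, ?_, ?_, ?_, ?_, ?_⟩ <;>
      simp only [F.table, F.anti.mul_self, map_add, map_sub, map_smul, LinearMap.add_apply,
        LinearMap.sub_apply, LinearMap.smul_apply] <;> module

theorem exists_isomorphic (F : FrameTwisted μ x y z w s v a b k l) (hV : Module.finrank ℂ V = 6) :
    ∃ N : Name, N.Nondegenerate ∧ Isomorphic μ N.product := by
  obtain ⟨x, w, l, F⟩ := F.exists_xw
  obtain ⟨y, z, w, s, b, F⟩ := F.exists_yz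
  obtain ⟨x, y, z, F⟩ := F.exists_reduced
  exact ⟨.T19, trivial, F.isomorphic_T19 hV⟩

end FrameTwisted

/-- The multiplication table of an algebra with two generators `x`, `y`, whose lower central series has
the factors `⟨x, y⟩`, `⟨z⟩`, `⟨w⟩`, `⟨s⟩`, `⟨v⟩`, where `xw = s`. -/
structure FrameChain (μ : Product V) (x y z w s v : V) (a b l n m : ℂ) : Prop where
  anti : IsAnticommutative μ
  span : ∀ S : Submodule ℂ V, x ∈ S → y ∈ S → z ∈ S → w ∈ S → s ∈ S → v ∈ S → S = ⊤
  products :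
    μ x y = z ∧ μ x z = w ∧ μ x w = s ∧ μ x s = n • v ∧ μ x v = 0 ∧ μ y z = a • s + b • v ∧
    μ y w = l • v ∧ μ y s = m • v ∧ μ y v = 0 ∧ μ z w = 0 ∧ μ z s = 0 ∧ μ z v = 0 ∧ μ w s = 0 ∧
    μ w v = 0 ∧ μ s v = 0

namespace FrameChain

variable {μ : Product V} {x y z w s v : V} {a b l n m : ℂ}

theorem table (F : FrameChain μ x y z w s v a b l n m) :
    (μ x y = z ∧ μ x z = w ∧ μ x w = s ∧ μ x s = n • v ∧ μ x v = 0 ∧ μ y z = a • s + b • v ∧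
    μ y w = l • v ∧ μ y s = m • v ∧ μ y v = 0 ∧ μ z w = 0 ∧ μ z s = 0 ∧ μ z v = 0 ∧ μ w s = 0 ∧
    μ w v = 0 ∧ μ s v = 0) ∧
    (μ y x = -z ∧ μ z x = -w ∧ μ w x = -s ∧ μ s x = -(n • v) ∧ μ v x = 0 ∧
    μ z y = -(a • s + b • v) ∧ μ w y = -(l • v) ∧ μ s y = -(m • v) ∧ μ v y = 0 ∧ μ w z = 0 ∧
    μ s z = 0 ∧ μ v z = 0 ∧ μ s w = 0 ∧ μ v w = 0 ∧ μ v s = 0) := by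
  refine ⟨F.products, ?_⟩
  rw [F.anti y x, F.anti z x, F.anti w x, F.anti s x, F.anti v x, F.anti z y, F.anti w y,
    F.anti s y, F.anti v y, F.anti w z, F.anti s z, F.anti v z, F.anti s w, F.anti v w, F.anti v s]
  simp only [F.products, neg_zero, and_self]

theorem isomorphic_T15 (F : FrameChain μ x y z w s v 0 0 1 1 0)
    (hV : Module.finrank ℂ V = 6) : Isomorphic μ Name.T15.product := by
  refine isomorphic_of_frame hV F.anti .T15 ![x, y, z, w, s, v] (fun S hS => ?_) ?_
  · simp [Fin.forall_fin_succ] at hS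
    grind [F.span S]
  · intro i j hij
    fin_cases i <;> fin_cases j <;> simp [F.table, Name.coords, e, Fin.sum_univ_succ] at hij ⊢

theorem isomorphic_T16 (F : FrameChain μ x y z w s v 0 0 0 0 1)
    (hV : Module.finrank ℂ V = 6) : Isomorphic μ Name.T16.product := by
  refine isomorphic_of_frame hV F.anti .T16 ![x, y, z, w, s, v] (fun S hS => ?_) ?_
  · simp [Fin.forall_fin_succ] at hS
    grind [F.span S]
  · intro i j hij
    fin_cases i <;> fin_cases j <;> simp [F.table, Name.coords, e, Fin.sum_univ_succ] at hij ⊢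

theorem isomorphic_T17 (F : FrameChain μ x y z w s v 1 0 0 0 1)
    (hV : Module.finrank ℂ V = 6) : Isomorphic μ Name.T17.product := by
  refine isomorphic_of_frame hV F.anti .T17 ![x, y, z, w, s, v] (fun S hS => ?_) ?_
  · simp [Fin.forall_fin_succ] at hS
    grind [F.span S]
  · intro i j hij
    fin_cases i <;> fin_cases j <;> simp [F.table, Name.coords, e, Fin.sum_univ_succ] at hij ⊢

theorem isomorphic_T18 {α : ℂ} (F : FrameChain μ x y z w s v 1 0 α (α + 1) 0)
    (hV : Module.finrank ℂ V = 6) : Isomorphic μ (Name.T18 α).product := by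
  refine isomorphic_of_frame hV F.anti (.T18 α) ![x, y, z, w, s, v] (fun S hS => ?_) ?_
  · simp [Fin.forall_fin_succ] at hS
    grind [F.span S]
  · intro i j hij
    fin_cases i <;> fin_cases j <;> simp [F.table, Name.coords, e, Fin.sum_univ_succ] at hij ⊢

theorem scale (F : FrameChain μ x y z w s v a b l n m) {β δ : ℂ} (hβ : β ≠ 0) (hδ : δ ≠ 0) :
    FrameChain μ x (β • y) (β • z) (β • w) (β • s) (δ • v) (β * a) (β ^ 2 * b / δ) (β ^ 2 * l / δ)
      (β * n / δ) (β ^ 2 * m / δ) where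
  anti := F.anti
  span S hx hy hz hw hs hv := F.span S hx ((S.smul_mem_iff hβ).mp hy) ((S.smul_mem_iff hβ).mp hz)
    ((S.smul_mem_iff hβ).mp hw) ((S.smul_mem_iff hβ).mp hs) ((S.smul_mem_iff hδ).mp hv)
  products := by
    refine ⟨?_, ?_, ?_, ?_, ?_, ?_, ?_, ?_, ?_, ?_, ?_, ?_, ?_, ?_, ?_⟩ <;>
      simp only [F.table, map_smul, LinearMap.smul_apply, smul_zero] <;> match_scalars <;> field_simp

theorem cast (F : FrameChain μ x y z w s v a b l n m) {a' b' l' n' m' : ℂ} (ha : a = a')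
    (hb : b = b') (hl : l = l') (hn : n = n') (hm : m = m') :
    FrameChain μ x y z w s v a' b' l' n' m' := by
  subst ha hb hl hn hm
  exact F

theorem exists_xs_eq_zero (F : FrameChain μ x y z w s v a b l n 1) :
    ∃ x w s b l, FrameChain μ x y z w s v a b l 0 1 := by
  refine ⟨x - n • y, w - (n * a) • s - (n * b) • v, s - (n * l) • v, b + a * n * l, l - n * a, F.anti,
    fun S hx hy hz hw hs hv => ?_, ?_⟩
  · have hs' := (S.sub_mem_iff_left (S.smul_mem _ hv)).mp hs
    have hw' := (S.sub_mem_iff_left (S.smul_mem _ hs')).mp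
      ((S.sub_mem_iff_left (S.smul_mem _ hv)).mp hw)
    exact F.span S ((S.sub_mem_iff_left (S.smul_mem _ hy)).mp hx) hy hz hw' hs' hv
  · refine ⟨?_, ?_, ?_, ?_, ?_, ?_, ?_, ?_, ?_, ?_, ?_, ?_, ?_, ?_, ?_⟩ <;>
      simp only [F.table, F.anti.mul_self, map_add, map_sub, map_smul, LinearMap.add_apply,
        LinearMap.sub_apply, LinearMap.smul_apply] <;> module

theorem exists_reduced_ys (F : FrameChain μ x y z w s v a b l 0 1) :
    ∃ y z w, FrameChain μ x y z w s v a 0 0 0 1 := by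
  -- Since ys = v, the term -l • z kills yw; it changes the v-part of yz to b - l², which the
  -- multiple of w cancels.
  refine ⟨y - l • z + (l ^ 2 - b) • w, z - l • w + (l ^ 2 - b) • s, w - l • s, F.anti,
    fun S hx hy hz hw hs hv => ?_, ?_⟩
  · have hw' := (S.sub_mem_iff_left (S.smul_mem _ hs)).mp hw
    have hz' := (S.sub_mem_iff_left (S.smul_mem _ hw')).mp
      ((S.add_mem_iff_left (S.smul_mem _ hs)).mp hz)
    exact F.span S hx ((S.sub_mem_iff_left (S.smul_mem _ hz')).mp
      ((S.add_mem_iff_left (S.smul_mem _ hw')).mp hy)) hz' hw' hs hv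
  · refine ⟨?_, ?_, ?_, ?_, ?_, ?_, ?_, ?_, ?_, ?_, ?_, ?_, ?_, ?_, ?_⟩ <;>
      simp only [F.table, F.anti.mul_self, map_add, map_sub, map_smul, LinearMap.add_apply,
        LinearMap.sub_apply, LinearMap.smul_apply] <;> module

theorem exists_isomorphic_ys (F : FrameChain μ x y z w s v a b l n 1)
    (hV : Module.finrank ℂ V = 6) : ∃ N : Name, N.Nondegenerate ∧ Isomorphic μ N.product := by
  obtain ⟨x, w, s, b, l, F⟩ := F.exists_xs_eq_zero
  obtain ⟨y, z, w, F⟩ := F.exists_reduced_ys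
  by_cases ha : a = 0
  · subst ha
    exact ⟨.T16, trivial, F.isomorphic_T16 hV⟩
  · refine ⟨.T17, trivial, isomorphic_T17 ((F.scale (β := 1 / a) (δ := (1 / a) ^ 2) (by simp [ha])
      (by simp [ha])).cast ?_ ?_ ?_ ?_ ?_) hV⟩ <;> field_simp <;> simp

theorem exists_reduced_xs (F : FrameChain μ x y z w s v a b l 1 0) (hl : l ≠ a) :
    ∃ y z w s, FrameChain μ x y z w s v a 0 l 1 0 := by
  have hl' : l - a ≠ 0 := sub_ne_zero.mpr hl
  -- Replacing y by y - c • z changes the v-part of yz to b - c(l - a): cl comes from zy and zw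
  -- terms recomputed with yw = l • v, and ca from rewriting s. Hence the condition l ≠ a.
  refine ⟨y - (b / (l - a)) • z, z - (b / (l - a)) • w, w - (b / (l - a)) • s,
    s - (b / (l - a)) • v, F.anti, fun S hx hy hz hw hs hv => ?_, ?_⟩
  · have hs' := (S.sub_mem_iff_left (S.smul_mem _ hv)).mp hs
    have hw' := (S.sub_mem_iff_left (S.smul_mem _ hs')).mp hw
    have hz' := (S.sub_mem_iff_left (S.smul_mem _ hw')).mp hz
    exact F.span S hx ((S.sub_mem_iff_left (S.smul_mem _ hz')).mp hy) hz' hw' hs' hv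
  · refine ⟨?_, ?_, ?_, ?_, ?_, ?_, ?_, ?_, ?_, ?_, ?_, ?_, ?_, ?_, ?_⟩ <;>
      simp only [F.table, F.anti.mul_self, map_add, map_sub, map_smul, LinearMap.add_apply,
        LinearMap.sub_apply, LinearMap.smul_apply] <;> match_scalars <;> field_simp <;> ring

theorem exists_isomorphic_xs (F : FrameChain μ x y z w s v a b l 1 0) (hl : l ≠ a)
    (hV : Module.finrank ℂ V = 6) : ∃ N : Name, N.Nondegenerate ∧ Isomorphic μ N.product := by
  obtain ⟨y, z, w, s, F⟩ := F.exists_reduced_xs hl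
  by_cases ha : a = 0
  · subst ha
    refine ⟨.T15, trivial, isomorphic_T15 ((F.scale (β := 1 / l) (δ := 1 / l) (by simp [hl])
      (by simp [hl])).cast ?_ ?_ ?_ ?_ ?_) hV⟩ <;> field_simp <;> simp
  · have hl' : a - l ≠ 0 := sub_ne_zero.mpr hl.symm
    have hδ : (a - l) / a ^ 2 ≠ 0 := div_ne_zero hl' (pow_ne_zero _ ha)
    refine ⟨.T18 (l / (a - l)), ?_, isomorphic_T18 ((F.scale (β := 1 / a) (δ := (a - l) / a ^ 2)
      (by simp [ha]) hδ).cast ?_ ?_ ?_ ?_ ?_) hV⟩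
    -- The excluded value -1 of the parameter would mean a = 0, the case already assigned to `T15`.
    · intro h
      rw [div_eq_iff hl'] at h
      exact ha (by linear_combination h)
    all_goals
      field_simp
      try ring

end FrameChain

end Tortkara

/-! ### Two generators: existence of the normal forms, and completeness of the list. -/

namespace Tortkara

variable {V : Type*} [AddCommGroup V] [Module ℂ V] {μ : Product V} {x y t : V}

/-- Two generators are always adapted. -/
theorem Generate.adapted_two (hT : IsTortkara μ) (h : Generate μ x y 0) : Adapted μ x y 0 :=
  ⟨hT, h, by simp, by simp⟩

namespace Adapted

theorem jacobian_mem_four (h : Adapted μ x y t) (a b : V) {q : V} (hq : q ∈ lcs μ 2) :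
    jacobian μ a b q ∈ lcs μ 4 :=
  add_mem (add_mem (h.one_mul_two (mul_mem_lcs_one μ _ _) hq)
    (mul_mem_lcs' h.tortkara.1 (mul_mem_lcs μ _ hq) _))
    (mul_mem_lcs' h.tortkara.1 (mul_mem_lcs' h.tortkara.1 hq _) _)

theorem span_eq_top (h : Adapted μ x y 0) {S : Submodule ℂ V} (hx : x ∈ S) (hy : y ∈ S)
    (hz : μ x y ∈ S) (h₂ : lcs μ 2 ≤ S) : S = ⊤ := by
  have h₁ : lcs μ 1 ≤ S := fun v hv => by
    obtain ⟨c, hc⟩ := h.exists_sub_smul_mem hv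
    exact (S.sub_mem_iff_left (S.smul_mem c hz)).mp (h₂ hc)
  refine eq_top_iff.mpr fun v _ => ?_
  obtain ⟨α, β, γ, hv⟩ := h.generate v
  exact (S.sub_mem_iff_left (add_mem (add_mem (S.smul_mem α hx) (S.smul_mem β hy))
    (S.smul_mem γ S.zero_mem))).mp (h₁ hv)

/-- In the case of two generators, the product with `xy` raises the degree by two. -/
theorem z_mul_three (h : Adapted μ x y 0) {q : V} (hq : q ∈ lcs μ 3) :
    μ (μ x y) q ∈ lcs μ 5 := by
  have hμ := h.tortkara.1
  refine h.generate.lcs_le (n := 2) (S := (lcs μ 5).comap (μ (μ x y))) ?_ ?_ ?_ ?_ hq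
  · exact fun b hb l hl => mul_mem_lcs μ _ (h.one_mul_two hl hb)
  · intro b hb
    rw [Submodule.mem_comap, mul_mul_eq h.tortkara]
    exact neg_mem (mul_mem_lcs' hμ (h.jacobian_mem_four _ _ hb) _)
  · intro b hb
    rw [Submodule.mem_comap, hμ y, map_neg, h.tortkara.2]
    exact neg_mem (mul_mem_lcs' hμ (h.jacobian_mem_four _ _ hb) _)
  · simp

/-- Write w = xz. The product w(xb) has the common letter x. For w(yb) the linearized identity
leaves the error (zy)(bx), a product of two elements of `lcs μ 3`. -/
theorem w_mul_three (h : Adapted μ x y 0) (hyz : μ y (μ x y) ∈ lcs μ 3)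
    (h₃ : ∀ a ∈ lcs μ 3, ∀ b ∈ lcs μ 3, μ a b ∈ lcs μ 5) {q : V} (hq : q ∈ lcs μ 3) :
    μ (μ x (μ x y)) q ∈ lcs μ 5 := by
  have hμ := h.tortkara.1
  refine h.generate.lcs_le (n := 2) (S := (lcs μ 5).comap (μ (μ x (μ x y)))) ?_ ?_ ?_ ?_ hq
  · exact fun b hb l hl => mul_mem_lcs μ _ (h.one_mul_two hl hb)
  · intro b hb
    rw [Submodule.mem_comap, mul_mul_eq h.tortkara]
    exact neg_mem (mul_mem_lcs' hμ (h.jacobian_mem_four _ _ hb) _)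
  · intro b hb
    have h₁ := h.tortkara.linearized (μ x y) x y b
    rw [Submodule.mem_comap, hμ x (μ x y), hμ y b, map_neg, map_neg, LinearMap.neg_apply, neg_neg,
      eq_sub_of_add_eq h₁]
    refine sub_mem (add_mem ?_ ?_) ?_
    · exact mul_mem_lcs' hμ (h.jacobian_mem_four _ _ hb) _
    · exact mul_mem_lcs' hμ (h.jacobian_mem_four _ _ hb) _
    · refine h₃ _ ?_ _ (mul_mem_lcs' hμ hb _)
      rw [hμ]
      exact neg_mem hyz
  · simp

end Adapted

/-- Symmetry of the form B means g(hz) = h(gz), and on the rest of the square twofold left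
multiplications vanish. -/
theorem FrameForm.isMalcev {z v w u : V} {a b d : ℂ} (F : FrameForm μ x y z v w u a b b d)
    (hT : IsTortkara μ) (hG : Generate μ x y 0)
    (h : ∀ {q}, q ∈ lcs μ 1 → ∃ a b c d : ℂ, q = a • z + b • v + c • w + d • u) :
    IsMalcev μ := by
  refine isMalcev_of_mul_comm hT (fun g hg g' hg' => ?_) fun q hq g g' => ?_
  · obtain ⟨g₁, g₂, g₃, g₄, rfl⟩ := h hg
    obtain ⟨g₁', g₂', g₃', g₄', rfl⟩ := h hg'
    simp [F.table, F.anti.mul_self]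
  · obtain ⟨q₁, q₂, q₃, q₄, rfl⟩ := h hq
    obtain ⟨α, β, γ, hg⟩ := hG g
    obtain ⟨α', β', γ', hg'⟩ := hG g'
    obtain ⟨g₁, g₂, g₃, g₄, hg⟩ := h hg
    obtain ⟨g₁', g₂', g₃', g₄', hg'⟩ := h hg'
    rw [eq_add_of_sub_eq hg, eq_add_of_sub_eq hg']
    simp only [smul_zero, add_zero, zero_add, F.table, F.anti.mul_self, map_add, map_smul,
      LinearMap.add_apply, LinearMap.smul_apply]
    module

/-- The value l = an expresses x(yz) = y(xz), and m = 0 expresses x(yw) = y(xw). -/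
theorem FrameChain.isMalcev {z w s v : V} {a b n : ℂ}
    (F : FrameChain μ x y z w s v a b (a * n) n 0) (hT : IsTortkara μ) (hG : Generate μ x y 0)
    (h : ∀ {q}, q ∈ lcs μ 1 → ∃ a b c d : ℂ, q = a • z + b • w + c • s + d • v) :
    IsMalcev μ := by
  refine isMalcev_of_mul_comm hT (fun g hg g' hg' => ?_) fun q hq g g' => ?_
  · obtain ⟨g₁, g₂, g₃, g₄, rfl⟩ := h hg
    obtain ⟨g₁', g₂', g₃', g₄', rfl⟩ := h hg'
    simp [F.table, F.anti.mul_self]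
  · obtain ⟨q₁, q₂, q₃, q₄, rfl⟩ := h hq
    obtain ⟨α, β, γ, hg⟩ := hG g
    obtain ⟨α', β', γ', hg'⟩ := hG g'
    obtain ⟨g₁, g₂, g₃, g₄, hg⟩ := h hg
    obtain ⟨g₁', g₂', g₃', g₄', hg'⟩ := h hg'
    rw [eq_add_of_sub_eq hg, eq_add_of_sub_eq hg']
    simp only [smul_zero, add_zero, zero_add, F.table, F.anti.mul_self, map_add, map_smul,
      LinearMap.add_apply, LinearMap.smul_apply]
    module

/-- Two generators whose cube is spanned by two elements modulo the one-dimensional fourth term. -/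
theorem Adapted.exists_isomorphic_of_finrank_one (hA : Adapted μ x y 0)
    (hV : Module.finrank ℂ V = 6) (hM : ¬ IsMalcev μ) [FiniteDimensional ℂ V] (h₄ : lcs μ 4 = ⊥)
    (h₃ : Module.finrank ℂ (lcs μ 3) = 1) :
    ∃ N : Name, N.Nondegenerate ∧ Isomorphic μ N.product := by
  have hμ := hA.tortkara.1
  have z₄ : ∀ {v}, v ∈ lcs μ 4 → v = 0 := fun h => by rwa [h₄, Submodule.mem_bot] at h
  have hz := mul_mem_lcs_one μ x y
  have hv := mul_mem_lcs μ x hz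
  have hw := mul_mem_lcs μ y hz
  obtain ⟨u, hu, hu'⟩ := Submodule.exists_mem_ne_zero_of_ne_bot
    (fun h => by rw [h, finrank_bot] at h₃; omega : lcs μ 3 ≠ ⊥)
  have hL₃ : ∀ {v}, v ∈ lcs μ 3 → ∃ c : ℂ, v = c • u := fun hv => exists_eq_smul h₃.le hu hu' hv
  have hL₂ : ∀ {q}, q ∈ lcs μ 2 → ∃ b c d : ℂ,
      q = b • μ x (μ x y) + c • μ y (μ x y) + d • u := by
    intro q hq
    have hle : lcs μ 2 ≤ Submodule.span ℂ {μ x (μ x y), μ y (μ x y), u} := by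
      have key : ∀ g, μ g (μ x y) ∈ Submodule.span ℂ {μ x (μ x y), μ y (μ x y), u} →
          ∀ b ∈ lcs μ 1, μ g b ∈ Submodule.span ℂ {μ x (μ x y), μ y (μ x y), u} := by
        intro g hg b hb
        obtain ⟨c, hc⟩ := hA.exists_sub_smul_mem hb
        obtain ⟨d, hd⟩ := hL₃ (mul_mem_lcs μ g hc)
        rw [← sub_add_cancel b (c • μ x y), map_add, map_smul, hd]
        exact add_mem (Submodule.smul_mem _ _ (Submodule.subset_span (by simp)))
          (Submodule.smul_mem _ _ hg)
      refine hA.generate.lcs_le (n := 1) (fun b hb l hl => ?_) (key _ ?_) (key _ ?_) (by simp)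
      · rw [z₄ (hA.one_mul_one hl hb)]
        exact zero_mem _
      · exact Submodule.subset_span (by simp)
      · exact Submodule.subset_span (by simp)
    obtain ⟨b, c, d, h⟩ := Submodule.mem_span_triple.mp (hle hq)
    exact ⟨b, c, d, h.symm⟩
  have hL₁ : ∀ {q}, q ∈ lcs μ 1 → ∃ a b c d : ℂ,
      q = a • μ x y + b • μ x (μ x y) + c • μ y (μ x y) + d • u := by
    intro q hq
    obtain ⟨a, ha⟩ := hA.exists_sub_smul_mem hq
    obtain ⟨b, c, d, h⟩ := hL₂ ha
    refine ⟨a, b, c, d, ?_⟩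
    rw [eq_add_of_sub_eq h]
    module
  obtain ⟨a, ha⟩ := hL₃ (mul_mem_lcs μ x hv)
  obtain ⟨b, hb⟩ := hL₃ (mul_mem_lcs μ x hw)
  obtain ⟨c, hc⟩ := hL₃ (mul_mem_lcs μ y hv)
  obtain ⟨d, hd⟩ := hL₃ (mul_mem_lcs μ y hw)
  have hu₀ : ∀ v, μ v u = 0 := fun v => z₄ (mul_mem_lcs μ v hu)
  have F : FrameForm μ x y (μ x y) (μ x (μ x y)) (μ y (μ x y)) u a b c d := by
    refine ⟨hμ, fun S hx hy hz hv hw hu => hA.span_eq_top hx hy hz fun q hq => ?_, rfl, rfl, ha, hb,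
      hu₀ _, rfl, hc, hd, hu₀ _, z₄ (hA.one_mul_two hz hv), z₄ (hA.one_mul_two hz hw), hu₀ _,
      z₄ (hA.two_mul_two hv hw), hu₀ _, hu₀ _⟩
    obtain ⟨b, c, d, rfl⟩ := hL₂ hq
    exact add_mem (add_mem (S.smul_mem _ hv) (S.smul_mem _ hw)) (S.smul_mem _ hu)
  refine F.exists_isomorphic (fun hbc => hM ?_) hV
  subst hbc
  exact F.isMalcev hA.tortkara hA.generate hL₁

/-- Two generators, with one-dimensional factor in degree three and a plane in degree four. -/
theorem Adapted.exists_isomorphic_of_lcs_four_eq_bot (hA : Adapted μ x y 0)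
    (hV : Module.finrank ℂ V = 6) (h₄ : lcs μ 4 = ⊥)
    (hyz : μ y (μ x y) ∈ lcs μ 3)
    (hL₂ : ∀ {v}, v ∈ lcs μ 2 → ∃ c : ℂ, v - c • μ x (μ x y) ∈ lcs μ 3) :
    ∃ N : Name, N.Nondegenerate ∧ Isomorphic μ N.product := by
  have z₄ : ∀ {v}, v ∈ lcs μ 4 → v = 0 := fun h => by rwa [h₄, Submodule.mem_bot] at h
  have hz := mul_mem_lcs_one μ x y
  have hw := mul_mem_lcs μ x hz
  have hs := mul_mem_lcs μ x hw
  have hr := mul_mem_lcs μ y hw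
  have hL₃ : ∀ {q}, q ∈ lcs μ 3 →
      ∃ c d : ℂ, c • μ x (μ x (μ x y)) + d • μ y (μ x (μ x y)) = q := by
    intro q hq
    rw [← Submodule.mem_span_pair]
    have key : ∀ g, μ g (μ x (μ x y)) ∈ Submodule.span ℂ {μ x (μ x (μ x y)), μ y (μ x (μ x y))} →
        ∀ b ∈ lcs μ 2, μ g b ∈ Submodule.span ℂ {μ x (μ x (μ x y)), μ y (μ x (μ x y))} := by
      intro g hg b hb
      obtain ⟨c, hc⟩ := hL₂ hb
      rw [← sub_add_cancel b (c • μ x (μ x y)), map_add, map_smul, z₄ (mul_mem_lcs μ g hc),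
        zero_add]
      exact Submodule.smul_mem _ _ hg
    refine hA.generate.lcs_le (n := 2) (fun b hb l hl => ?_) (key _ ?_) (key _ ?_) (by simp) hq
    · rw [z₄ (hA.one_mul_two hl hb)]
      exact zero_mem _
    · exact Submodule.subset_span (by simp)
    · exact Submodule.subset_span (by simp)
  have h₀ : ∀ {u}, u ∈ lcs μ 3 → ∀ v, μ v u = 0 := fun hu v => z₄ (mul_mem_lcs μ v hu)
  obtain ⟨a, b, hab⟩ := hL₃ hyz
  have F : FramePlane μ x y (μ x y) (μ x (μ x y)) (μ x (μ x (μ x y))) (μ y (μ x (μ x y))) a b := by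
    refine ⟨hA.tortkara.1, fun S hxS hyS hzS hwS hsS hrS => hA.span_eq_top hxS hyS hzS fun q hq => ?_,
      rfl, rfl, rfl, h₀ hs _, h₀ hr _, hab.symm, rfl, h₀ hs _, h₀ hr _, z₄ (hA.one_mul_two hz hw),
      h₀ hs _, h₀ hr _, h₀ hs _, h₀ hr _, h₀ hr _⟩
    obtain ⟨c, hc⟩ := hL₂ hq
    obtain ⟨d, d', hd⟩ := hL₃ hc
    rw [← sub_add_cancel q (c • μ x (μ x y)), ← hd]
    exact add_mem (add_mem (S.smul_mem _ hsS) (S.smul_mem _ hrS)) (S.smul_mem _ hwS)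
  exact F.exists_isomorphic hV

/-- Two generators, with one-dimensional factors from degree two on. -/
theorem Adapted.exists_isomorphic_of_lcs_five_eq_bot (hA : Adapted μ x y 0)
    (hV : Module.finrank ℂ V = 6) (hN : IsNilpotent μ) (hM : ¬ IsMalcev μ) [FiniteDimensional ℂ V]
    (h₅ : lcs μ 5 = ⊥) (f₄ : Module.finrank ℂ (lcs μ 4) = 1) (f₃ : Module.finrank ℂ (lcs μ 3) = 2)
    (hyz : μ y (μ x y) ∈ lcs μ 3)
    (hL₂ : ∀ {v}, v ∈ lcs μ 2 → ∃ c : ℂ, v - c • μ x (μ x y) ∈ lcs μ 3) :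
    ∃ N : Name, N.Nondegenerate ∧ Isomorphic μ N.product := by
  have hμ := hA.tortkara.1
  have z₅ : ∀ {v}, v ∈ lcs μ 5 → v = 0 := fun h => by rwa [h₅, Submodule.mem_bot] at h
  have hz := mul_mem_lcs_one μ x y
  have hw := mul_mem_lcs μ x hz
  have hxw := mul_mem_lcs μ x hw
  have hyw := mul_mem_lcs μ y hw
  have hn₄ : lcs μ 4 ≠ ⊥ := fun h => by rw [h, finrank_bot] at f₄; omega
  have hL₃ : ∀ {s}, s ∈ lcs μ 3 → s ∉ lcs μ 4 → ∀ {q}, q ∈ lcs μ 3 →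
      ∃ c : ℂ, q - c • s ∈ lcs μ 4 := fun hs hs' _ hq =>
    Tortkara.exists_sub_smul_mem (M' := lcs μ 4) (lcs_succ_le μ 3) (by omega) hs hs' hq
  have hL₄ : ∀ {v}, v ∈ lcs μ 4 → v ≠ 0 → ∀ {q}, q ∈ lcs μ 4 → ∃ c : ℂ, q = c • v :=
    fun hv hv' _ hq => exists_eq_smul f₄.le hv hv' hq
  -- As `lcs μ 4` has codimension one in `lcs μ 3`, anticommutativity moves one factor into `lcs μ
  -- 4`.
  have h₃₃ : ∀ a ∈ lcs μ 3, ∀ b ∈ lcs μ 3, μ a b ∈ lcs μ 5 := by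
    intro a ha b hb
    by_cases ha' : a ∈ lcs μ 4
    · exact mul_mem_lcs' hμ ha' _
    · obtain ⟨c, hc⟩ := hL₃ ha ha' hb
      have := mul_mem_lcs μ a hc
      rwa [map_sub, map_smul, hμ.mul_self, smul_zero, sub_zero] at this
  have hzs : ∀ {s}, s ∈ lcs μ 3 → μ (μ x y) s = 0 := fun hs => z₅ (hA.z_mul_three hs)
  have hws : ∀ {s}, s ∈ lcs μ 3 → μ (μ x (μ x y)) s = 0 :=
    fun hs => z₅ (hA.w_mul_three hyz h₃₃ hs)
  have h₀ : ∀ {v}, v ∈ lcs μ 4 → ∀ g, μ g v = 0 := fun hv g => z₅ (mul_mem_lcs μ g hv)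
  have hJ : jacobian μ x y (μ x y) = -μ x (μ y (μ x y)) + μ y (μ x (μ x y)) := by
    rw [jacobian, hμ.mul_self, hμ (μ y (μ x y)) x, hμ (μ x y) x, map_neg, LinearMap.neg_apply,
      hμ (μ x (μ x y)) y, neg_neg, zero_add]
  -- The Tortkara identity leaves no freedom for zw: it equals x(yw), which vanishes exactly in the
  -- untwisted tables. Likewise the next fact, y(yw) = 0.
  have hzw : μ (μ x y) (μ x (μ x y)) = μ x (μ y (μ x (μ x y))) := by
    rw [mul_mul_eq hA.tortkara, hJ, hμ (-_ + _) x, neg_neg, map_add, map_neg,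
      h₀ (mul_mem_lcs μ x hyz), neg_zero, zero_add]
  have hyyw : μ y (μ y (μ x (μ x y))) = 0 := by
    have h := hA.tortkara.2 x y (μ x y)
    rw [hJ, hμ (μ x y) y, map_neg, hzs hyz, hμ (-_ + _) y, map_add, map_neg,
      h₀ (mul_mem_lcs μ x hyz)] at h
    simpa using h.symm
  -- Only x and y can carry `lcs μ 3` onto `lcs μ 4`, so they cannot both kill a vector s that spans
  -- `lcs μ 3` modulo `lcs μ 4`.
  have hgen : ∀ {s}, s ∈ lcs μ 3 → s ∉ lcs μ 4 → μ x s = 0 → μ y s = 0 → False := by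
    intro s hs hs' hxs hys
    have key : ∀ g, μ g s = 0 → ∀ b ∈ lcs μ 3, μ g b ∈ (⊥ : Submodule ℂ V) := by
      intro g hg b hb
      obtain ⟨c, hc⟩ := hL₃ hs hs' hb
      rw [← sub_add_cancel b (c • s), map_add, map_smul, hg, h₀ hc]
      simp
    refine hn₄ (eq_bot_iff.mpr (hA.generate.lcs_le (n := 3) (fun b hb l hl => ?_) (key x hxs)
      (key y hys) (by simp)))
    obtain ⟨c, hc⟩ := hA.exists_sub_smul_mem hl
    obtain ⟨d, hd⟩ := hL₂ hc
    have h := z₅ (h₃₃ _ hd _ hb)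
    simp only [map_sub, map_smul, LinearMap.sub_apply, LinearMap.smul_apply, hzs hb, hws hb,
      smul_zero, sub_zero] at h
    rw [h]
    exact zero_mem _
  have hspan : ∀ {s v}, s ∈ lcs μ 3 → s ∉ lcs μ 4 → v ∈ lcs μ 4 → v ≠ 0 → ∀ {q}, q ∈ lcs μ 1 →
      ∃ a b c d : ℂ, q = a • μ x y + b • μ x (μ x y) + c • s + d • v := by
    intro s v hs hs' hv hv' q hq
    obtain ⟨a, ha⟩ := hA.exists_sub_smul_mem hq
    obtain ⟨b, hb⟩ := hL₂ ha
    obtain ⟨c, hc⟩ := hL₃ hs hs' hb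
    obtain ⟨d, hd⟩ := hL₄ hv hv' hc
    refine ⟨a, b, c, d, ?_⟩
    rw [← hd]
    module
  have htop : ∀ {s v}, s ∈ lcs μ 3 → s ∉ lcs μ 4 → v ∈ lcs μ 4 → v ≠ 0 →
      ∀ S : Submodule ℂ V, x ∈ S → y ∈ S → μ x y ∈ S → μ x (μ x y) ∈ S → s ∈ S → v ∈ S → S = ⊤ := by
    intro s v hs hs' hv hv' S hxS hyS hzS hwS hsS hvS
    refine hA.span_eq_top hxS hyS hzS fun q hq => ?_
    obtain ⟨a, b, c, d, rfl⟩ := hspan hs hs' hv hv' (lcs_succ_le μ 1 hq)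
    exact add_mem (add_mem (add_mem (S.smul_mem _ hzS) (S.smul_mem _ hwS)) (S.smul_mem _ hsS))
      (S.smul_mem _ hvS)
  have hexp : ∀ {s v}, s ∈ lcs μ 3 → s ∉ lcs μ 4 → v ∈ lcs μ 4 → v ≠ 0 → ∀ {q}, q ∈ lcs μ 3 →
      ∃ c d : ℂ, q = c • s + d • v := by
    intro s v hs hs' hv hv' q hq
    obtain ⟨c, hc⟩ := hL₃ hs hs' hq
    obtain ⟨d, hd⟩ := hL₄ hv hv' hc
    exact ⟨c, d, by rw [← hd]; module⟩
  -- The factor in degree three is spanned by xw or by yw. If yw is nonzero there, then zw = x(yw) ≠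
  -- 0, which is the twisted table; otherwise zw = 0 and s = xw.
  by_cases hyw' : μ y (μ x (μ x y)) ∈ lcs μ 4
  · have hxw' : μ x (μ x (μ x y)) ∉ lcs μ 4 := by
      intro hxw'
      have hn₃ : lcs μ 3 ≠ ⊥ := fun h => by rw [h, finrank_bot] at f₃; omega
      have key : ∀ g, μ g (μ x (μ x y)) ∈ lcs μ 4 → ∀ b ∈ lcs μ 2, μ g b ∈ lcs μ 4 := by
        intro g hg b hb
        obtain ⟨c, hc⟩ := hL₂ hb
        rw [← sub_add_cancel b (c • μ x (μ x y)), map_add, map_smul]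
        exact add_mem (mul_mem_lcs μ g hc) (Submodule.smul_mem _ _ hg)
      exact hn₃ (lcs_eq_bot_of_le hN (hA.generate.lcs_le (n := 2)
        (fun b hb l hl => hA.one_mul_two hl hb) (key x hxw') (key y hyw') (by simp)))
    have hzw' : μ (μ x y) (μ x (μ x y)) = 0 := by rw [hzw, h₀ hyw']
    have hframe : ∀ {v}, v ∈ lcs μ 4 → v ≠ 0 → ∃ a b l n m : ℂ,
        μ x (μ x (μ x (μ x y))) = n • v ∧ μ y (μ x (μ x (μ x y))) = m • v ∧
        FrameChain μ x y (μ x y) (μ x (μ x y)) (μ x (μ x (μ x y))) v a b l n m := by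
      intro v hv hv'
      obtain ⟨a, b, hab⟩ := hexp hxw hxw' hv hv' hyz
      obtain ⟨l, hl⟩ := hL₄ hv hv' hyw'
      obtain ⟨n, hn⟩ := hL₄ hv hv' (mul_mem_lcs μ x hxw)
      obtain ⟨m, hm⟩ := hL₄ hv hv' (mul_mem_lcs μ y hxw)
      exact ⟨a, b, l, n, m, hn, hm, hμ, htop hxw hxw' hv hv', rfl, rfl, rfl, hn, h₀ hv _, hab, hl,
        hm, h₀ hv _, hzw', hzs hxw, h₀ hv _, hws hxw, h₀ hv _, h₀ hv _⟩
    by_cases hys : μ y (μ x (μ x (μ x y))) = 0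
    · have hxs : μ x (μ x (μ x (μ x y))) ≠ 0 := fun h => hgen hxw hxw' h hys
      obtain ⟨a, b, l, n, m, hn, hm, F⟩ := hframe (mul_mem_lcs μ x hxw) hxs
      obtain rfl : n = 1 := smul_left_injective ℂ hxs (by simpa using hn.symm)
      obtain rfl : m = 0 := (smul_eq_zero.mp (hm.symm.trans hys)).resolve_right hxs
      refine F.exists_isomorphic_xs (fun hl => hM ?_) hV
      have F : FrameChain μ x y (μ x y) (μ x (μ x y)) (μ x (μ x (μ x y)))
          (μ x (μ x (μ x (μ x y)))) a b (a * 1) 1 0 := by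
        rw [mul_one]
        exact hl ▸ F
      exact F.isMalcev hA.tortkara hA.generate (hspan hxw hxw' (mul_mem_lcs μ x hxw) hxs)
    · obtain ⟨a, b, l, n, m, hn, hm, F⟩ := hframe (mul_mem_lcs μ y hxw) hys
      obtain rfl : m = 1 := smul_left_injective ℂ hys (by simpa using hm.symm)
      exact F.exists_isomorphic_ys hV
  · have hxs : μ x (μ y (μ x (μ x y))) ≠ 0 := fun h => hgen hyw hyw' h hyyw
    have hv := mul_mem_lcs μ x hyw
    obtain ⟨a, b, hab⟩ := hexp hyw hyw' hv hxs hyz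
    obtain ⟨k, l, hkl⟩ := hexp hyw hyw' hv hxs hxw
    have F : FrameTwisted μ x y (μ x y) (μ x (μ x y)) (μ y (μ x (μ x y)))
        (μ x (μ y (μ x (μ x y)))) a b k l :=
      ⟨hμ, htop hyw hyw' hv hxs, rfl, rfl, hkl, rfl, h₀ hv _, hab, rfl, hyyw, h₀ hv _, hzw, hzs hyw,
        h₀ hv _, hws hyw, h₀ hv _, h₀ hv _⟩
    exact F.exists_isomorphic hV

/-- The square of a nilpotent anticommutative algebra has codimension at least two, unless it
vanishes. -/
theorem finrank_lcs_one_add_two_le [FiniteDimensional ℂ V] (hμ : IsAnticommutative μ)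
    (hN : IsNilpotent μ) (h : lcs μ 1 ≠ ⊥) :
    Module.finrank ℂ (lcs μ 1) + 2 ≤ Module.finrank ℂ V := by
  by_contra! hlt
  have htop : (⊤ : Submodule ℂ V) ≠ lcs μ 1 := fun h' =>
    h (eq_bot_iff.mpr (h' ▸ (lcs_eq_bot_of_le (n := 0) hN h'.le).le))
  obtain ⟨v, -, hv⟩ := SetLike.exists_of_lt (lt_of_le_of_ne le_top htop.symm)
  have key : ∀ a, ∃ c : ℂ, a - c • v ∈ lcs μ 1 := fun a =>
    exists_sub_smul_mem (M := ⊤) le_top (by rw [finrank_top]; omega) Submodule.mem_top hv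
      Submodule.mem_top
  refine h (lcs_eq_bot_of_le hN ((lcs_succ_le_iff μ).mpr fun a b _ => ?_))
  obtain ⟨c, hc⟩ := key a
  obtain ⟨d, hd⟩ := key b
  have h₁ : μ a b = μ a (b - d • v) + d • μ (a - c • v) v := by
    simp only [map_sub, map_smul, LinearMap.sub_apply, LinearMap.smul_apply, hμ.mul_self]
    module
  rw [h₁]
  exact add_mem (mul_mem_lcs μ a hd) (Submodule.smul_mem _ _ (mul_mem_lcs' hμ hc v))

theorem Adapted.finrank_lcs_one_le [FiniteDimensional ℂ V] (h : Adapted μ x y t) :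
    Module.finrank ℂ (lcs μ 1) ≤ Module.finrank ℂ (lcs μ 2) + 1 := by
  have hle : lcs μ 1 ≤ Submodule.span ℂ {μ x y} ⊔ lcs μ 2 := fun v hv => by
    obtain ⟨c, hc⟩ := h.exists_sub_smul_mem hv
    rw [← sub_add_cancel v (c • μ x y)]
    exact add_mem (Submodule.mem_sup_right hc)
      (Submodule.mem_sup_left (Submodule.mem_span_singleton.mpr ⟨c, rfl⟩))
  have h₁ := Submodule.finrank_mono hle
  have h₂ := Submodule.finrank_add_le_finrank_add_finrank (Submodule.span ℂ {μ x y}) (lcs μ 2)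
  have h₃ : Module.finrank ℂ (Submodule.span ℂ {μ x y}) ≤ 1 := by
    simpa using finrank_span_le_card (R := ℂ) {μ x y}
  omega

/-- Every six-dimensional nilpotent Tortkara algebra that is not a Malcev algebra is listed. -/
theorem exists_isomorphic (hV : Module.finrank ℂ V = 6) (hT : IsTortkara μ) (hN : IsNilpotent μ)
    (hM : ¬ IsMalcev μ) : ∃ N : Name, N.Nondegenerate ∧ Isomorphic μ N.product := by
  have : FiniteDimensional ℂ V := Module.finite_of_finrank_eq_succ hV
  have n₃ := lcs_three_ne_bot hV hT hN hM
  have n₂ : lcs μ 2 ≠ ⊥ := fun h => n₃ (eq_bot_iff.mpr (h ▸ lcs_succ_le μ 2))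
  have n₁ : lcs μ 1 ≠ ⊥ := fun h => n₂ (eq_bot_iff.mpr (h ▸ lcs_succ_le μ 1))
  have l₂ : Module.finrank ℂ (lcs μ 3) < Module.finrank ℂ (lcs μ 2) := finrank_lcs_succ_lt hN n₂
  have l₁ : Module.finrank ℂ (lcs μ 2) < Module.finrank ℂ (lcs μ 1) := finrank_lcs_succ_lt hN n₁
  have l₃ : Module.finrank ℂ (lcs μ 4) < Module.finrank ℂ (lcs μ 3) := finrank_lcs_succ_lt hN n₃
  have l₀ := finrank_lcs_one_add_two_le hT.1 hN n₁
  -- The square has dimension 3 or 4: at least 3 because the series drops strictly down to the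
  -- nonzero `lcs μ 3`, at most 4 by the bound on its codimension.
  rcases Nat.lt_or_ge 3 (Module.finrank ℂ (lcs μ 1)) with h₁ | h₁
  swap
  · exact exists_isomorphic_of_three_generators hV hT hN hM (by omega)
  obtain ⟨x, y, hG⟩ := exists_generate_two μ (by omega)
  have hA := hG.adapted_two hT
  have h₂ := hA.finrank_lcs_one_le
  -- Here `lcs μ 2` has dimension 3, so `lcs μ 3` has dimension 1 or 2; dimension 2 splits further
  -- according to whether `lcs μ 4` vanishes.
  rcases Nat.lt_or_ge 1 (Module.finrank ℂ (lcs μ 3)) with h₃ | h₃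
  swap
  · exact hA.exists_isomorphic_of_finrank_one hV hM (Submodule.finrank_eq_zero.mp (by omega))
      (by omega)
  obtain ⟨x, y, hA, hxz, hyz, -⟩ := hA.exists_yz_mem hN n₂ (by omega) (by simp)
  have hL₂ : ∀ {v}, v ∈ lcs μ 2 → ∃ c : ℂ, v - c • μ x (μ x y) ∈ lcs μ 3 := fun hv =>
    exists_sub_smul_mem (M' := lcs μ 3) (lcs_succ_le μ 2) (by omega)
      (mul_mem_lcs μ x (mul_mem_lcs_one μ x y)) hxz hv
  by_cases n₄ : lcs μ 4 = ⊥
  · exact hA.exists_isomorphic_of_lcs_four_eq_bot hV n₄ hyz hL₂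
  · have l₄ : Module.finrank ℂ (lcs μ 5) < Module.finrank ℂ (lcs μ 4) := finrank_lcs_succ_lt hN n₄
    exact hA.exists_isomorphic_of_lcs_five_eq_bot hV hN hM
      (Submodule.finrank_eq_zero.mp (by omega)) (by omega) (by omega) hyz hL₂

end Tortkara

theorem mainTheorem1 :
    -- every algebra of the list is a (6-dimensional) nilpotent non-Malcev Tortkara algebra
    (∀ N : Tortkara.Name, Tortkara.IsTortkara N.product ∧ Tortkara.IsNilpotent N.product ∧
      ¬ Tortkara.IsMalcev N.product) ∧
    -- the list is complete
    (∀ (V : Type*) [AddCommGroup V] [Module ℂ V] (μ : Tortkara.Product V),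
      Module.finrank ℂ V = 6 → Tortkara.IsTortkara μ → Tortkara.IsNilpotent μ →
      ¬ Tortkara.IsMalcev μ →
      ∃ N : Tortkara.Name, N.Nondegenerate ∧ Tortkara.Isomorphic μ N.product) ∧
    -- the only isomorphisms between algebras of the list
    (∀ N N' : Tortkara.Name, N.Nondegenerate → N'.Nondegenerate →
      (Tortkara.Isomorphic N.product N'.product ↔
        N = N' ∨ ∃ α : ℂ, N = .T09 α ∧ N' = .T09 (-α - 1))) ∧
    -- the degenerate parameter values
    (Tortkara.Isomorphic (Tortkara.Name.T09 0).product Tortkara.Name.T02.product ∧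
      Tortkara.Isomorphic (Tortkara.Name.T09 (-1)).product Tortkara.Name.T02.product ∧
      Tortkara.Isomorphic (Tortkara.Name.T18 (-1)).product Tortkara.Name.T01.product) := by
  refine ⟨fun N => ⟨Tortkara.isTortkara_product N, Tortkara.isNilpotent_product N,
      Tortkara.not_isMalcev_product N⟩,
    fun V _ _ μ hV hT hN hM => Tortkara.exists_isomorphic hV hT hN hM,
    fun N N' hN hN' => Tortkara.isomorphic_product_iff N N' hN hN',
    Tortkara.isomorphic_T09_zero, Tortkara.isomorphic_T09_neg_one,
    Tortkara.isomorphic_T18_neg_one⟩
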